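/- **Conventions.** Let $\mathcal M=\mathbb R$ or $\mathcal M=\mathbb T=\mathbb R/2\pi\mathbb Z$ and $\langle\xi\rangle=(1+\xi^2)^{1/2}$. For $s\in\mathbb R$, $H^s(\mathbb R)$ is the space of tempered distributions $f$ on $\mathbb R$ with $$\|f\|_{H^s(\mathbb R)}=\|\langle\xi\rangle^s\widehat f(\xi)\|_{L^2_\xi(\mathbb R)}<\infty,\qquad \widehat f(\xi)=\frac1{\sqrt{2\pi}}\int_{\mathbb R}f(x)e^{-i\xi x}\,dx,$$ and $H^s(\mathbb T)$ is the space of distributions $f$ on $\mathbb T$ with $$\|f\|_{H^s(\mathbb T)}=\Big(\sum_{n\in\mathbb Z}\langle n\rangle^{2s}|\widehat f(n)|^2\Big)^{1/2}<\infty,\qquad \widehat f(n)=\frac1{2\pi}\int_{\mathbb T}f(x)e^{-inx}\,dx$$ (the Fourier transform being understood in the sense of distributions). A *smooth solution* of the Benjamin–Bona–Mahony (BBM) equation on $\mathcal M$ is a real-valued function $u\in C^\infty([0,\infty)\times\mathcal M)$ that satisfies $$\partial_t u-\partial_{xxt}u+\partial_x u+\tfrac12\partial_x(u^2)=0$$ pointwise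 and belongs to $C([0,\infty);H^\sigma(\mathcal M))$ for every $\sigma\in\mathbb R$ (for $\mathcal M=\mathbb T$ this last property is automatic). **Theorem 1.3.** Let $\mathcal M=\mathbb R$ or $\mathbb T$, let $s<0$, and let $u_0\in H^s(\mathcal M)$ be real-valued. Then, for every $\varepsilon>0$, there exist a smooth solution $u_\varepsilon$ of the BBM equation on $\mathcal M$ and a time $t_\varepsilon\in(0,\varepsilon)$ such that $$\|u_\varepsilon(0)-u_0\|_{H^s(\mathcal M)}<\varepsilon\qquad\text{and}\qquad \|u_\varepsilon(t_\varepsilon)\|_{H^s(\mathcal M)}>\varepsilon^{-1}.$$ -/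

import Mathlib

open MeasureTheory Filter Topology Set
open scoped SchwartzMap FourierTransform ContDiff ENNReal Real

noncomputable section

namespace BBM

/-! ### The equation -/

/-- `u t x` (time first) is a classical solution, smooth up to `t = 0`, of
`∂ₜu - ∂ₓₓₜu + ∂ₓu + ½ ∂ₓ(u²) = 0` on `[0, ∞) × ℝ`.
(The equation is written at `t > 0`; by smoothness it then also holds at `t = 0`.) -/
structure IsSmoothSolution (u : ℝ → ℝ → ℝ) : Prop where
  smooth : ContDiffOn ℝ ∞ (Function.uncurry u) (Ici (0 : ℝ) ×ˢ (univ : Set ℝ))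
  eqn : ∀ t : ℝ, 0 < t → ∀ x : ℝ,
    deriv (fun τ => u τ x) t
      - deriv (fun τ => iteratedDeriv 2 (fun y => u τ y) x) t
      + deriv (fun y => u t y) x
      + (1 / 2) * deriv (fun y => u t y ^ 2) x = 0

/-! ### Sobolev spaces on the line

`H^s(ℝ)` is Mathlib's `TemperedDistribution.MemSobolev s 2`. -/

/-- A tempered distribution is real-valued if it takes real values on real test functions. -/
def LineIsReal (f : 𝓢'(ℝ, ℂ)) : Prop :=
  ∀ φ : 𝓢(ℝ, ℂ), (∀ x, (φ x).im = 0) → (f φ).im = 0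

/-- The weight `⟨ξ⟩^s = (1 + ξ²)^{s/2}` at the angular frequency `ξ = 2πη`; Mathlib's Fourier
transform uses the character `e^{-2πiηx}`. -/
def lineWeight (s : ℝ) (η : ℝ) : ℝ := (1 + (2 * π * η) ^ 2) ^ (s / 2)

/-- The `H^s(ℝ)` norm `‖⟨ξ⟩^s 𝓕f‖_{L²}`, equal to `⊤` if `⟨ξ⟩^s 𝓕f` is not a function in `L²`
(the function in `L²` is unique if it exists). -/
def lineSobolevNorm (s : ℝ) (f : 𝓢'(ℝ, ℂ)) : ℝ≥0∞ :=
  ⨅ (g : Lp ℂ 2 (volume : Measure ℝ))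
    (_ : TemperedDistribution.smulLeftCLM ℂ (fun η : ℝ => (lineWeight s η : ℂ)) (𝓕 f)
      = (g : 𝓢'(ℝ, ℂ))), ‖g‖ₑ

open Classical in
/-- The tempered distribution `φ ↦ ∫ φ f` given by a real function `f ∈ L²(ℝ)`
(and `0` if `f ∉ L²(ℝ)`). -/
def lineDist (f : ℝ → ℝ) : 𝓢'(ℝ, ℂ) :=
  if h : MemLp (fun x => (f x : ℂ)) 2 (volume : Measure ℝ) then
    ((h.toLp _ : Lp ℂ 2 (volume : Measure ℝ)) : 𝓢'(ℝ, ℂ)) else 0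

/-- Smooth solutions on `ℝ`: classical `C^∞` solutions that belong to `C([0, ∞); H^σ(ℝ))` for
every `σ`. -/
structure IsSmoothSolutionLine (u : ℝ → ℝ → ℝ) : Prop extends IsSmoothSolution u where
  memLp : ∀ t : ℝ, 0 ≤ t → MemLp (fun x => (u t x : ℂ)) 2 (volume : Measure ℝ)
  memSobolev : ∀ σ t : ℝ, 0 ≤ t → TemperedDistribution.MemSobolev σ 2 (lineDist (u t))
  continuous : ∀ σ t : ℝ, 0 ≤ t →
    Tendsto (fun τ => lineSobolevNorm σ (lineDist (u τ) - lineDist (u t)))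
      (𝓝[Ici 0] t) (𝓝 0)

/-! ### Sobolev spaces on the torus `ℝ / 2πℤ` -/

/-- The test functions on the torus: smooth `2π`-periodic functions `ℝ → ℂ`. -/
def TorusTest : Submodule ℂ (ℝ → ℂ) where
  carrier := {φ | ContDiff ℝ ∞ φ ∧ Function.Periodic φ (2 * π)}
  add_mem' := fun ha hb => ⟨ha.1.add hb.1, ha.2.add hb.2⟩
  zero_mem' := ⟨contDiff_const, fun _ => rfl⟩
  smul_mem' := fun c _ ha => ⟨contDiff_const.smul ha.1, fun x => by simp [ha.2 x]⟩

/-- Distributions on the torus: the linear functionals `T` on test functions that are continuous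
in the usual Fréchet topology, i.e. `|T φ| ≤ C max_{j ≤ k} sup |φ^{(j)}|` for some `C`, `k`. -/
def TorusDistribution : Submodule ℂ (TorusTest →ₗ[ℂ] ℂ) where
  carrier := {T | ∃ (C : ℝ) (k : ℕ), 0 ≤ C ∧ ∀ (φ : TorusTest) (M : ℝ),
    (∀ j ≤ k, ∀ x : ℝ, ‖iteratedDeriv j (φ : ℝ → ℂ) x‖ ≤ M) → ‖T φ‖ ≤ C * M}
  add_mem' := by
    rintro S T ⟨C, k, hC, hS⟩ ⟨D, l, hD, hT⟩
    refine ⟨C + D, max k l, by positivity, fun φ M hM => ?_⟩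
    have h1 := hS φ M fun j hj => hM j (hj.trans (le_max_left _ _))
    have h2 := hT φ M fun j hj => hM j (hj.trans (le_max_right _ _))
    calc ‖S φ + T φ‖ ≤ ‖S φ‖ + ‖T φ‖ := norm_add_le _ _
      _ ≤ (C + D) * M := by linarith
  zero_mem' := ⟨0, 0, le_rfl, fun φ M _ => by simp⟩
  smul_mem' := by
    rintro c T ⟨C, k, hC, hT⟩
    refine ⟨‖c‖ * C, k, by positivity, fun φ M hM => ?_⟩
    have h1 := mul_le_mul_of_nonneg_left (hT φ M hM) (norm_nonneg c)
    calc ‖c • T φ‖ = ‖c‖ * ‖T φ‖ := norm_smul _ _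
      _ ≤ ‖c‖ * C * M := by linarith

/-- A distribution on the torus is real-valued if it takes real values on real test functions. -/
def TorusIsReal (T : TorusDistribution) : Prop :=
  ∀ φ : TorusTest, (∀ x, ((φ : ℝ → ℂ) x).im = 0) → (T.1 φ).im = 0

/-- The character `x ↦ e^{inx}`. -/
def torusChar (n : ℤ) : TorusTest :=
  ⟨fun x => Complex.exp (Complex.I * n * x), by
    constructor
    · exact (contDiff_const.mul Complex.ofRealCLM.contDiff).cexp
    · intro x
      have h := Complex.exp_int_mul_two_pi_mul_I n
      change Complex.exp (Complex.I * n * ((x + 2 * π : ℝ) : ℂ)) = _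
      rw [show Complex.I * n * ((x + 2 * π : ℝ) : ℂ)
          = Complex.I * n * x + n * (2 * π * Complex.I) by push_cast; ring,
        Complex.exp_add, h, mul_one]⟩

/-- The Fourier coefficient `(1/2π) ⟨T, e^{-inx}⟩`. -/
def torusFourier (T : TorusDistribution) (n : ℤ) : ℂ :=
  (1 / (2 * π) : ℝ) * T.1 (torusChar (-n))

/-- The `H^s(𝕋)` norm `(∑_n ⟨n⟩^{2s} |T̂(n)|²)^{1/2}`, with values in `[0, ∞]`. -/
def torusSobolevNorm (s : ℝ) (T : TorusDistribution) : ℝ≥0∞ :=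
  (∑' n : ℤ, ENNReal.ofReal ((1 + (n : ℝ) ^ 2) ^ s * ‖torusFourier T n‖ ^ 2)) ^ (1 / 2 : ℝ)

/-- `T ∈ H^s(𝕋)`. -/
def TorusMemSobolev (s : ℝ) (T : TorusDistribution) : Prop := torusSobolevNorm s T < ⊤

/-- The pairing `φ ↦ ∫_{0}^{2π} f φ` for integrable `f`, as a distribution on the torus. -/
def torusDistOfIntegrable (f : ℝ → ℝ) (hf : IntervalIntegrable f volume 0 (2 * π)) :
    TorusDistribution :=
  have hint : ∀ φ : TorusTest,
      IntervalIntegrable (fun x => (f x : ℂ) * (φ : ℝ → ℂ) x) volume 0 (2 * π) := fun φ =>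
    IntervalIntegrable.mul_continuousOn (f := fun x => (f x : ℂ)) (by exact ⟨hf.1.ofReal, hf.2.ofReal⟩)
      φ.2.1.continuous.continuousOn
  ⟨{ toFun := fun φ => ∫ x in (0 : ℝ)..(2 * π), (f x : ℂ) * (φ : ℝ → ℂ) x
     map_add' := fun φ ψ => by
      rw [← intervalIntegral.integral_add (hint φ) (hint ψ)]
      simp [mul_add]
     map_smul' := fun c φ => by
      rw [RingHom.id_apply, smul_eq_mul, ← intervalIntegral.integral_const_mul]
      refine intervalIntegral.integral_congr fun x _ => ?_
      simp only [Submodule.coe_smul, Pi.smul_apply, smul_eq_mul]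
      ring },
   by
    have hpi : (0 : ℝ) ≤ 2 * π := by positivity
    refine ⟨∫ x in (0 : ℝ)..(2 * π), |f x|, 0,
      intervalIntegral.integral_nonneg hpi fun x _ => abs_nonneg _, fun φ M hM => ?_⟩
    change ‖∫ x in (0 : ℝ)..(2 * π), (f x : ℂ) * (φ : ℝ → ℂ) x‖ ≤ _
    rw [← intervalIntegral.integral_mul_const]
    refine intervalIntegral.norm_integral_le_of_norm_le hpi ?_ (hf.abs.mul_const M)
    refine Eventually.of_forall fun x _ => ?_
    have h0 := hM 0 le_rfl x
    rw [iteratedDeriv_zero] at h0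
    rw [norm_mul, Complex.norm_real, Real.norm_eq_abs]
    exact mul_le_mul_of_nonneg_left h0 (abs_nonneg _)⟩

open Classical in
/-- The distribution on the torus given by a function `f` integrable over a period
(and `0` if `f` is not integrable). -/
def torusDist (f : ℝ → ℝ) : TorusDistribution :=
  if h : IntervalIntegrable f volume 0 (2 * π) then torusDistOfIntegrable f h else 0

/-- Smooth solutions on the torus: classical `C^∞` solutions that are `2π`-periodic in `x`. -/
structure IsSmoothSolutionTorus (u : ℝ → ℝ → ℝ) : Prop extends IsSmoothSolution u where
  periodic : ∀ t : ℝ, 0 ≤ t → Function.Periodic (u t) (2 * π)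

/-! ### Consistency of the line norm with Mathlib's Sobolev spaces -/

theorem lineWeight_hasTemperateGrowth (s : ℝ) :
    Function.HasTemperateGrowth (lineWeight s) := by
  have h := (Function.hasTemperateGrowth_one_add_norm_sq_rpow ℝ (s / 2)).comp
    ((2 * π) • ContinuousLinearMap.id ℝ ℝ).hasTemperateGrowth
  have e : lineWeight s =
      (fun x : ℝ => (1 + ‖x‖ ^ 2) ^ (s / 2)) ∘ ⇑((2 * π) • ContinuousLinearMap.id ℝ ℝ) := by
    funext η
    simp [lineWeight, mul_pow]
  rw [e]
  exact h

theorem exists_Lp_of_weight {a b r : ℝ → ℝ} (ha : a.HasTemperateGrowth)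
    (hr : r.HasTemperateGrowth) {C : ℝ} (hC : ∀ x, |r x| ≤ C) (hb : ∀ x, b x = a x * r x)
    {f : 𝓢'(ℝ, ℂ)}
    (h : ∃ g : Lp ℂ 2 (volume : Measure ℝ),
      TemperedDistribution.smulLeftCLM ℂ (fun x => (a x : ℂ)) f = (g : 𝓢'(ℝ, ℂ))) :
    ∃ g : Lp ℂ 2 (volume : Measure ℝ),
      TemperedDistribution.smulLeftCLM ℂ (fun x => (b x : ℂ)) f = (g : 𝓢'(ℝ, ℂ)) := by
  obtain ⟨g, hg⟩ := h
  have ha' : Function.HasTemperateGrowth (fun x => (a x : ℂ)) :=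
    by fun_prop
  have hr' : Function.HasTemperateGrowth (fun x => (r x : ℂ)) :=
    by fun_prop
  have hm : MemLp (fun x => (r x : ℂ)) ⊤ (volume : Measure ℝ) :=
    memLp_top_of_bound hr'.1.continuous.aestronglyMeasurable C
      (Eventually.of_forall fun x => by simpa using hC x)
  refine ⟨hm.toLp _ • g, ?_⟩
  rw [Lp.toTemperedDistribution_smul_eq hr' hm, ← hg,
    TemperedDistribution.smulLeftCLM_smulLeftCLM_apply ha' hr']
  congr 2
  funext x
  simp [hb x]

/-- The `H^s(ℝ)` norm is finite exactly on Mathlib's Sobolev space. -/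
theorem lineSobolevNorm_lt_top_iff (s : ℝ) (f : 𝓢'(ℝ, ℂ)) :
    lineSobolevNorm s f < ⊤ ↔ TemperedDistribution.MemSobolev s 2 f := by
  have hq : ∀ η : ℝ, 0 < 1 + ‖η‖ ^ 2 ∧ 1 + ‖η‖ ^ 2 ≤ 1 + (2 * π * η) ^ 2 ∧
      1 + (2 * π * η) ^ 2 ≤ (2 * π) ^ 2 * (1 + ‖η‖ ^ 2) := fun η => by
    have h1 : 1 ≤ (2 * π) ^ 2 := by nlinarith [Real.pi_gt_three]
    rw [Real.norm_eq_abs, sq_abs, mul_pow]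
    refine ⟨by positivity, by nlinarith [sq_nonneg η], by nlinarith [sq_nonneg η]⟩
  have key : ∀ (σ : ℝ) (p q : ℝ), 0 < p → p ≤ q → q ≤ (2 * π) ^ 2 * p →
      q ^ σ * p ^ (-σ) ≤ ((2 * π) ^ 2) ^ |σ| ∧ p ^ σ * q ^ (-σ) ≤ ((2 * π) ^ 2) ^ |σ| := by
    intro σ p q hp hpq hqp
    have hq0 : 0 < q := hp.trans_le hpq
    have h1 : 1 ≤ q / p := (one_le_div hp).2 hpq
    have h2 : q / p ≤ (2 * π) ^ 2 := (div_le_iff₀ hp).2 hqp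
    have e : ∀ τ : ℝ, |τ| = |σ| → (q / p) ^ τ ≤ ((2 * π) ^ 2) ^ |σ| := fun τ hτ =>
      (Real.rpow_le_rpow_of_exponent_le h1 (le_abs_self τ)).trans
        (hτ ▸ Real.rpow_le_rpow (by positivity) h2 (abs_nonneg τ))
    constructor
    · refine le_trans (le_of_eq ?_) (e σ rfl)
      rw [Real.div_rpow hq0.le hp.le, Real.rpow_neg hp.le, div_eq_mul_inv]
    · refine le_trans (le_of_eq ?_) (e (-σ) (abs_neg σ))
      rw [Real.div_rpow hq0.le hp.le, Real.rpow_neg hp.le, Real.rpow_neg hq0.le,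
        div_inv_eq_mul, mul_comm]
  have hm := fun τ : ℝ => Function.hasTemperateGrowth_one_add_norm_sq_rpow ℝ τ
  rw [TemperedDistribution.memSobolev_iff_exists_smulLeftCLM_fourier]
  simp only [lineSobolevNorm, iInf_lt_iff, enorm_lt_top, exists_prop, and_true]
  constructor
  · refine exists_Lp_of_weight (lineWeight_hasTemperateGrowth s)
      ((hm (s / 2)).mul (lineWeight_hasTemperateGrowth (-s)))
      (C := ((2 * π) ^ 2) ^ |s / 2|) (fun x => ?_) (fun x => ?_)
    · obtain ⟨h0, h1, h2⟩ := hq x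
      simp only [Pi.mul_apply, lineWeight]
      rw [abs_of_nonneg (by positivity), neg_div]
      exact (key (s / 2) _ _ h0 h1 h2).2
    · have : (0 : ℝ) < 1 + (2 * π * x) ^ 2 := by positivity
      simp only [Pi.mul_apply, lineWeight]
      rw [neg_div, mul_left_comm, ← Real.rpow_add this]
      simp
  · refine exists_Lp_of_weight (hm (s / 2))
      ((lineWeight_hasTemperateGrowth s).mul (hm (-(s / 2))))
      (C := ((2 * π) ^ 2) ^ |s / 2|) (fun x => ?_) (fun x => ?_)
    · obtain ⟨h0, h1, h2⟩ := hq x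
      simp only [Pi.mul_apply, lineWeight]
      rw [abs_of_nonneg (by positivity)]
      exact (key (s / 2) _ _ h0 h1 h2).1
    · simp only [Pi.mul_apply, lineWeight]
      rw [mul_left_comm, ← Real.rpow_add (hq x).1]
      simp

end BBM

end

/-!
The map from initial values to solutions is so far from continuous on `H^s`, `s < 0`, because two
high frequencies interact to produce a low one, and a high-frequency function may have a large
amplitude while being small in `H^s`.

Write the equation as `∂ₜu = K(u + u² / 2)`, where `K = -∂ₓ(1 - ∂ₓ²)⁻¹` (`bbmOp`) is the convolution
with `sgn(x) e^{-|x|} / 2`. Approximate `u₀` in `H^s` by a real smooth function `φ` (a trigonometric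
polynomial on the torus, a test function on the line) and start from `φ + B² g cos(Nx)`, with `g`
fixed. For fixed `B` the perturbation tends to `0` in `H^s` as `N → ∞`. On the other hand
`(g cos(Nx))² = g² / 2 + g² cos(2Nx) / 2`, so in the first-order expansion
`u(t) = u(0) + t K(u(0) + u(0)² / 2) + O(t² ‖u(0)‖_∞³)` there is a low-frequency term
`t (B²)² K(g²) / 4`. At the time `t = B⁻³` its size is of order `B`, whereas the remainder is of
order `B⁻⁶ B⁶ = 1`, and the other terms are bounded or oscillate. Testing against `(1 - ∂ₓ²)θ`,
which turns `K` into the pairing with `θ'`, shows that a fixed functional, continuous on `H^s`, takes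
a value of order `B` on `u(t)`; `B` is chosen large first and `N` afterwards. This is
`exists_large_pairing`.

Since `K` is bounded on bounded functions (and on functions that are `O(e^{-|x|/2})`), the expansion
needs only elementary sup norm estimates. Solutions are constructed by Picard iteration for a
truncated nonlinearity (`exists_picard`); the truncation is removed by means of the conservation of
`∫ u² + u_x²` (`exists_isMild_line`, `exists_isMild_torus`). As `K` gains a derivative, the
solutions are smooth, and decay like `e^{-|x|/2}` on the line together with all their derivatives
(`IsMild.reg`); there they are Schwartz functions at each time, and continuous in time with values in
every `H^σ` (`Reg.tendsto_sobolevLp`).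
-/

noncomputable section

namespace BBM

/-! ### The resolvent of `1 - ∂ₓ²` -/

/-- The average of `g` over the half line on the side `σ = ±1` of `x`, against `e^{-z} dz`. -/
def expAvg (σ : ℝ) (g : ℝ → ℝ) (x : ℝ) : ℝ := ∫ z in Ioi (0 : ℝ), Real.exp (-z) * g (x + σ * z)

/-- The operator `(1 - ∂ₓ²)⁻¹`, i.e. convolution with `e^{-|x|} / 2`. -/
def resolvent (g : ℝ → ℝ) (x : ℝ) : ℝ := (expAvg (-1) g x + expAvg 1 g x) / 2

/-- The operator `-∂ₓ(1 - ∂ₓ²)⁻¹`, i.e. convolution with `sgn(x) e^{-|x|} / 2`. In terms of it the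
BBM equation reads `∂ₜu = bbmOp (u + u² / 2)`. -/
def bbmOp (g : ℝ → ℝ) (x : ℝ) : ℝ := (expAvg (-1) g x - expAvg 1 g x) / 2

/-- A spatial weight that varies slowly enough to be preserved, up to a constant, by convolution
with `e^{-|x|}`. The two instances used are `1` (periodic functions) and `e^{-|x|/2}`
(functions on the line). -/
structure IsWeight (ρ : ℝ → ℝ) : Prop where
  pos : ∀ x, 0 < ρ x
  le_one : ∀ x, ρ x ≤ 1
  continuous : Continuous ρ
  shift : ∀ x z, ρ (x + z) ≤ Real.exp (|z| / 2) * ρ x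

lemma isWeight_one : IsWeight (fun _ => 1) :=
  ⟨fun _ => one_pos, fun _ => le_rfl, continuous_const,
    fun _ z => by rw [mul_one]; exact Real.one_le_exp (by positivity)⟩

lemma isWeight_exp : IsWeight (fun x => Real.exp (-|x| / 2)) := by
  refine ⟨fun x => Real.exp_pos _, fun x => Real.exp_le_one_iff.2 ?_, by fun_prop, fun x z => ?_⟩
  · have := abs_nonneg x
    linarith
  · rw [← Real.exp_add]
    apply Real.exp_le_exp.2
    have : |x| ≤ |x + z| + |z| := by
      simpa using abs_sub (x + z) z
    linarith

lemma integrableOn_exp_half : IntegrableOn (fun z : ℝ => Real.exp (-z / 2)) (Ioi 0) := by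
  have := exp_neg_integrableOn_Ioi 0 (b := 1 / 2) (by norm_num)
  refine this.congr_fun (fun x _ => ?_) measurableSet_Ioi
  dsimp only
  congr 1; ring

lemma integral_exp_half : ∫ z in Ioi (0 : ℝ), Real.exp (-z / 2) = 2 := by
  have := integral_exp_mul_Ioi (a := -1 / 2) (by norm_num) 0
  rw [show (fun z : ℝ => Real.exp (-z / 2)) = fun z => Real.exp (-1 / 2 * z) by
    funext z; congr 1; ring, this]
  norm_num

lemma norm_exp_mul_le {ρ : ℝ → ℝ} (hρ : IsWeight ρ) {σ : ℝ} (hσ : |σ| = 1) {g : ℝ → ℝ} {C x : ℝ}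
    (hg : ∀ y, |g y| ≤ C * ρ y) {z : ℝ} (hz : 0 < z) :
    ‖Real.exp (-z) * g (x + σ * z)‖ ≤ C * ρ x * Real.exp (-z / 2) := by
  have hC : 0 ≤ C := by
    have := (abs_nonneg _).trans (hg 0)
    exact nonneg_of_mul_nonneg_left this (hρ.pos 0)
  rw [norm_mul, Real.norm_eq_abs, Real.norm_eq_abs, Real.abs_exp]
  have h1 := hρ.shift x (σ * z)
  rw [abs_mul, hσ, one_mul, abs_of_pos hz] at h1
  calc Real.exp (-z) * |g (x + σ * z)|
      ≤ Real.exp (-z) * (C * (Real.exp (z / 2) * ρ x)) := by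
        gcongr
        exact (hg _).trans (by gcongr)
    _ = C * ρ x * (Real.exp (-z) * Real.exp (z / 2)) := by ring
    _ = C * ρ x * Real.exp (-z / 2) := by rw [← Real.exp_add]; congr 2; ring

lemma abs_expAvg_le {ρ : ℝ → ℝ} (hρ : IsWeight ρ) {σ : ℝ} (hσ : |σ| = 1) {g : ℝ → ℝ} {C : ℝ}
    (hg : ∀ y, |g y| ≤ C * ρ y) (x : ℝ) : |expAvg σ g x| ≤ 2 * C * ρ x := by
  have h := norm_integral_le_of_norm_le (μ := volume.restrict (Ioi (0 : ℝ)))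
    (f := fun z => Real.exp (-z) * g (x + σ * z)) (integrableOn_exp_half.const_mul (C * ρ x))
    ((ae_restrict_iff' measurableSet_Ioi).2
      (Eventually.of_forall fun z hz => norm_exp_mul_le hρ hσ hg hz))
  rw [integral_const_mul, integral_exp_half] at h
  calc |expAvg σ g x| ≤ C * ρ x * 2 := h
    _ = _ := by ring

lemma abs_bbmOp_le {ρ : ℝ → ℝ} (hρ : IsWeight ρ) {g : ℝ → ℝ} {C : ℝ}
    (hg : ∀ y, |g y| ≤ C * ρ y) (x : ℝ) : |bbmOp g x| ≤ 2 * C * ρ x := by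
  have h1 := abs_le.1 (abs_expAvg_le hρ (σ := -1) (by simp) hg x)
  have h2 := abs_le.1 (abs_expAvg_le hρ (σ := 1) (by simp) hg x)
  rw [bbmOp, abs_le]
  constructor <;> linarith

lemma integrableOn_exp_mul {σ : ℝ} (hσ : |σ| = 1) {g : ℝ → ℝ} (hc : Continuous g) {C : ℝ}
    (hg : ∀ y, |g y| ≤ C) (x : ℝ) :
    IntegrableOn (fun z => Real.exp (-z) * g (x + σ * z)) (Ioi 0) := by
  refine Integrable.mono' (integrableOn_exp_half.const_mul (C * 1))
    (Continuous.aestronglyMeasurable (by fun_prop)) ?_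
  exact (ae_restrict_iff' measurableSet_Ioi).2 (Eventually.of_forall fun z hz =>
    norm_exp_mul_le isWeight_one hσ (fun y => by simpa using hg y) hz)

lemma expAvg_sub {σ : ℝ} (hσ : |σ| = 1) {g h : ℝ → ℝ} (hgc : Continuous g) (hhc : Continuous h)
    {C D : ℝ} (hg : ∀ y, |g y| ≤ C) (hh : ∀ y, |h y| ≤ D) (x : ℝ) :
    expAvg σ (fun y => g y - h y) x = expAvg σ g x - expAvg σ h x := by
  rw [expAvg, expAvg, expAvg, ← integral_sub (integrableOn_exp_mul hσ hgc hg x)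
    (integrableOn_exp_mul hσ hhc hh x)]
  simp only [mul_sub]

lemma bbmOp_sub {g h : ℝ → ℝ} (hgc : Continuous g) (hhc : Continuous h)
    {C D : ℝ} (hg : ∀ y, |g y| ≤ C) (hh : ∀ y, |h y| ≤ D) (x : ℝ) :
    bbmOp (fun y => g y - h y) x = bbmOp g x - bbmOp h x := by
  rw [bbmOp, bbmOp, bbmOp, expAvg_sub (by simp) hgc hhc hg hh, expAvg_sub (by simp) hgc hhc hg hh]
  ring

lemma hasDerivAt_expAvg_one {g : ℝ → ℝ} (hc : Continuous g) {C : ℝ} (hg : ∀ y, |g y| ≤ C)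
    (x : ℝ) : HasDerivAt (expAvg 1 g) (expAvg 1 g x - g x) x := by
  -- `expAvg 1 g x = e^x ∫_x^∞ e^{-y} g(y) dy`, to which the fundamental theorem applies
  set h : ℝ → ℝ := fun y => Real.exp (-y) * g y with hh
  have hhc : Continuous h := by fun_prop
  have e1 : ∀ x, expAvg 1 g x = Real.exp x * ∫ y in Ioi x, h y := by
    intro x
    have := (measurePreserving_add_left volume x).setIntegral_preimage_emb
      (measurableEmbedding_addLeft x) h (Ioi x)
    rw [← this, ← integral_const_mul, expAvg]
    simp only [preimage_const_add_Ioi, sub_self]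
    refine setIntegral_congr_fun measurableSet_Ioi fun z _ => ?_
    simp only [hh, one_mul]
    rw [neg_add, Real.exp_add, ← mul_assoc, ← mul_assoc, ← Real.exp_add]
    simp
  have hint : ∀ x, IntegrableOn h (Ioi x) := by
    intro x
    refine Integrable.mono' ((exp_neg_integrableOn_Ioi x (b := 1) one_pos).const_mul C)
      hhc.aestronglyMeasurable (Eventually.of_forall fun y => ?_)
    rw [hh, norm_mul, Real.norm_eq_abs, Real.norm_eq_abs, Real.abs_exp, mul_comm, neg_one_mul]
    gcongr
    exact hg y
  have e2 : ∀ x, expAvg 1 g x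
      = Real.exp x * ((∫ y in Ioi (0 : ℝ), h y) - ∫ y in (0 : ℝ)..x, h y) := by
    intro x
    rw [e1, ← intervalIntegral.integral_interval_add_Ioi (hint 0) (hint x)]
    ring
  have d := (Real.hasDerivAt_exp x).mul
    ((hasDerivAt_const x (∫ y in Ioi (0 : ℝ), h y)).sub (hhc.integral_hasStrictDerivAt 0 x).hasDerivAt)
  have d' := d.congr_of_eventuallyEq (f₁ := expAvg 1 g) (Eventually.of_forall e2)
  refine d'.congr_deriv ?_
  have e3 : Real.exp x * h x = g x := by
    rw [hh, ← mul_assoc, ← Real.exp_add]; simp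
  simp only [zero_sub, mul_neg, e3, Pi.sub_apply, e2]
  ring

lemma hasDerivAt_expAvg_neg_one {g : ℝ → ℝ} (hc : Continuous g) {C : ℝ} (hg : ∀ y, |g y| ≤ C)
    (x : ℝ) : HasDerivAt (expAvg (-1) g) (g x - expAvg (-1) g x) x := by
  have e : ∀ x, expAvg (-1) g x = expAvg 1 (fun y => g (-y)) (-x) := fun x => by
    rw [expAvg, expAvg]
    congr 1; funext z; congr 2; ring
  have d := (hasDerivAt_expAvg_one (g := fun y => g (-y)) (by fun_prop)
    (fun y => hg _) (-x)).comp x (hasDerivAt_neg x)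
  have d' := d.congr_of_eventuallyEq (f₁ := expAvg (-1) g) (Eventually.of_forall e)
  refine d'.congr_deriv ?_
  simp [e]

lemma hasDerivAt_resolvent {g : ℝ → ℝ} (hc : Continuous g) {C : ℝ} (hg : ∀ y, |g y| ≤ C)
    (x : ℝ) : HasDerivAt (resolvent g) (-bbmOp g x) x := by
  refine (((hasDerivAt_expAvg_neg_one hc hg x).add
    (hasDerivAt_expAvg_one hc hg x)).div_const 2).congr_deriv ?_
  rw [bbmOp]; ring

lemma hasDerivAt_bbmOp {g : ℝ → ℝ} (hc : Continuous g) {C : ℝ} (hg : ∀ y, |g y| ≤ C)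
    (x : ℝ) : HasDerivAt (bbmOp g) (g x - resolvent g x) x := by
  refine (((hasDerivAt_expAvg_neg_one hc hg x).sub
    (hasDerivAt_expAvg_one hc hg x)).div_const 2).congr_deriv ?_
  rw [resolvent]; ring

/-! ### Functions of time and space with weighted bounds -/

/-- `g t x` is jointly continuous and `O(ρ(x))`, locally uniformly in `t`. -/
structure WBdd (ρ : ℝ → ℝ) (g : ℝ → ℝ → ℝ) : Prop where
  cont : Continuous (Function.uncurry g)
  bdd : ∀ T : ℝ, ∃ C : ℝ, 0 ≤ C ∧ ∀ t x : ℝ, |t| ≤ T → |g t x| ≤ C * ρ x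

/-- The time integral `∫₀ᵗ g(τ, x) dτ`. -/
def timeInt (g : ℝ → ℝ → ℝ) (t x : ℝ) : ℝ := ∫ τ in (0 : ℝ)..t, g τ x

section WBdd
variable {ρ : ℝ → ℝ} {g h : ℝ → ℝ → ℝ}

lemma WBdd.cont_space (hg : WBdd ρ g) (t : ℝ) : Continuous (g t) :=
  hg.cont.comp (Continuous.prodMk_right t)

lemma WBdd.cont_time (hg : WBdd ρ g) (x : ℝ) : Continuous (fun t => g t x) :=
  hg.cont.comp (Continuous.prodMk_left x)

lemma WBdd.exists_bound (hρ : IsWeight ρ) (hg : WBdd ρ g) (T : ℝ) :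
    ∃ C : ℝ, 0 ≤ C ∧ ∀ t x : ℝ, |t| ≤ T → |g t x| ≤ C := by
  obtain ⟨C, hC, h⟩ := hg.bdd T
  exact ⟨C, hC, fun t x ht => (h t x ht).trans (by nlinarith [hρ.le_one x])⟩

lemma WBdd.add (hg : WBdd ρ g) (hh : WBdd ρ h) : WBdd ρ (fun t x => g t x + h t x) := by
  refine ⟨hg.cont.add hh.cont, fun T => ?_⟩
  obtain ⟨C, hC, h1⟩ := hg.bdd T
  obtain ⟨D, hD, h2⟩ := hh.bdd T
  refine ⟨C + D, by positivity, fun t x ht => (abs_add_le _ _).trans ?_⟩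
  rw [add_mul]
  exact add_le_add (h1 t x ht) (h2 t x ht)

lemma WBdd.const_mul (c : ℝ) (hg : WBdd ρ g) : WBdd ρ (fun t x => c * g t x) := by
  refine ⟨hg.cont.const_mul c, fun T => ?_⟩
  obtain ⟨C, hC, h1⟩ := hg.bdd T
  refine ⟨|c| * C, by positivity, fun t x ht => ?_⟩
  rw [abs_mul, mul_assoc]
  exact mul_le_mul_of_nonneg_left (h1 t x ht) (abs_nonneg c)

lemma WBdd.mul (hρ : IsWeight ρ) (hg : WBdd ρ g) (hh : WBdd ρ h) :
    WBdd ρ (fun t x => g t x * h t x) := by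
  refine ⟨hg.cont.mul hh.cont, fun T => ?_⟩
  obtain ⟨C, hC, h1⟩ := hg.exists_bound hρ T
  obtain ⟨D, hD, h2⟩ := hh.bdd T
  refine ⟨C * D, by positivity, fun t x ht => ?_⟩
  rw [abs_mul, mul_assoc]
  exact mul_le_mul (h1 t x ht) (h2 t x ht) (abs_nonneg _) hC

lemma WBdd.expAvg (hρ : IsWeight ρ) {σ : ℝ} (hσ : |σ| = 1) (hg : WBdd ρ g) :
    WBdd ρ (fun t => expAvg σ (g t)) := by
  constructor
  · refine continuous_iff_continuousAt.2 fun p => ?_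
    obtain ⟨C, hC, h1⟩ := hg.exists_bound hρ (|p.1| + 1)
    refine continuousAt_of_dominated (bound := fun z => C * 1 * Real.exp (-z / 2)) ?_ ?_
      (integrableOn_exp_half.const_mul _) ?_
    · refine Eventually.of_forall fun q => Continuous.aestronglyMeasurable ?_
      have := hg.cont_space q.1
      fun_prop
    · have : ∀ᶠ q : ℝ × ℝ in 𝓝 p, |q.1| < |p.1| + 1 :=
        (continuous_fst.abs.tendsto p).eventually (gt_mem_nhds (lt_add_one _))
      filter_upwards [this] with q hq
      refine (ae_restrict_iff' measurableSet_Ioi).2 (Eventually.of_forall fun z hz => ?_)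
      exact norm_exp_mul_le isWeight_one hσ (fun y => by simpa using h1 _ y hq.le) hz
    · refine Eventually.of_forall fun z => Continuous.continuousAt ?_
      have := hg.cont
      exact continuous_const.mul (this.comp (continuous_fst.prodMk
        (continuous_snd.add continuous_const)))
  · intro T
    obtain ⟨C, hC, h1⟩ := hg.bdd T
    exact ⟨2 * C, by positivity, fun t x ht => abs_expAvg_le hρ hσ (fun y => h1 t y ht) x⟩

lemma WBdd.timeInt (hg : WBdd ρ g) : WBdd ρ (timeInt g) := by
  constructor
  · have : Continuous (Function.uncurry fun (p : ℝ × ℝ) (τ : ℝ) => g τ p.2) :=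
      hg.cont.comp (continuous_snd.prodMk (continuous_snd.comp continuous_fst))
    exact intervalIntegral.continuous_parametric_intervalIntegral_of_continuous this continuous_fst
  · intro T
    obtain ⟨C, hC, h1⟩ := hg.bdd T
    refine ⟨C * |T|, by positivity, fun t x ht => ?_⟩
    have h2 : ‖∫ τ in (0 : ℝ)..t, g τ x‖ ≤ C * ρ x * |t - 0| := by
      refine intervalIntegral.norm_integral_le_of_norm_le_const fun τ hτ => h1 τ x (le_trans ?_ ht)
      rcases le_total 0 t with h | h
      · rw [uIoc_of_le h] at hτ
        rw [abs_of_pos hτ.1, abs_of_nonneg h]; exact hτ.2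
      · rw [uIoc_of_ge h] at hτ
        rw [abs_of_nonpos hτ.2, abs_of_nonpos h]; linarith [hτ.1]
    rw [sub_zero] at h2
    have h3 : 0 ≤ C * ρ x := (abs_nonneg _).trans (h1 t x ht)
    calc |BBM.timeInt g t x| ≤ C * ρ x * |t| := h2
      _ ≤ C * ρ x * |T| := by
        have := ht.trans (le_abs_self T)
        gcongr
      _ = _ := by ring

lemma hasDerivAt_expAvg_time (hρ : IsWeight ρ) {σ : ℝ} (hσ : |σ| = 1) (hg : WBdd ρ g)
    (hh : WBdd ρ h) (hd : ∀ t x, HasDerivAt (fun τ => g τ x) (h t x) t) (t x : ℝ) :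
    HasDerivAt (fun τ => expAvg σ (g τ) x) (expAvg σ (h t) x) t := by
  obtain ⟨C, hC, h1⟩ := hh.exists_bound hρ (|t| + 1)
  obtain ⟨D, hD, h2⟩ := hg.exists_bound hρ (|t|)
  have hs : {τ : ℝ | |τ| < |t| + 1} ∈ 𝓝 t :=
    (isOpen_lt continuous_abs continuous_const).mem_nhds (lt_add_one |t|)
  refine (hasDerivAt_integral_of_dominated_loc_of_deriv_le (μ := volume.restrict (Ioi (0 : ℝ)))
    (F := fun τ z => Real.exp (-z) * g τ (x + σ * z))
    (F' := fun τ z => Real.exp (-z) * h τ (x + σ * z))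
    (bound := fun z => C * 1 * Real.exp (-z / 2)) hs ?_
    (integrableOn_exp_mul hσ (hg.cont_space t) (fun y => h2 t y le_rfl) x) ?_ ?_
    (integrableOn_exp_half.const_mul _) ?_).2
  · refine Eventually.of_forall fun τ => Continuous.aestronglyMeasurable ?_
    have := hg.cont_space τ
    fun_prop
  · have := hh.cont_space t
    exact Continuous.aestronglyMeasurable (by fun_prop)
  · refine (ae_restrict_iff' measurableSet_Ioi).2 (Eventually.of_forall fun z hz τ hτ => ?_)
    exact norm_exp_mul_le isWeight_one hσ (fun y => by simpa using h1 τ y (le_of_lt hτ)) hz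
  · exact Eventually.of_forall fun z τ _ => (hd τ _).const_mul _

lemma hasDerivAt_timeInt_time (hg : WBdd ρ g) (t x : ℝ) :
    HasDerivAt (fun τ => timeInt g τ x) (g t x) t :=
  ((hg.cont_time x).integral_hasStrictDerivAt 0 t).hasDerivAt

lemma hasDerivAt_timeInt_space (hρ : IsWeight ρ) (hg : WBdd ρ g) (hh : WBdd ρ h)
    (hd : ∀ t x, HasDerivAt (g t) (h t x) x) (t x : ℝ) :
    HasDerivAt (timeInt g t) (timeInt h t x) x := by
  obtain ⟨C, hC, h1⟩ := hh.exists_bound hρ |t|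
  refine (intervalIntegral.hasDerivAt_integral_of_dominated_loc_of_deriv_le (μ := volume)
    (F := fun y τ => g τ y) (F' := fun y τ => h τ y) (bound := fun _ => C) univ_mem
    (Eventually.of_forall fun y => (hg.cont_time y).aestronglyMeasurable)
    ((hg.cont_time x).intervalIntegrable _ _) (hh.cont_time x).aestronglyMeasurable ?_
    intervalIntegrable_const (Eventually.of_forall fun τ _ y _ => hd τ y)).2
  refine Eventually.of_forall fun τ hτ y _ => h1 τ y ?_
  rcases le_total 0 t with h | h
  · rw [uIoc_of_le h] at hτ
    rw [abs_of_pos hτ.1, abs_of_nonneg h]; exact hτ.2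
  · rw [uIoc_of_ge h] at hτ
    rw [abs_of_nonpos hτ.2, abs_of_nonpos h]; linarith [hτ.1]

end WBdd

/-- `g` has continuous partial derivatives up to order `n`, all of them `O(ρ(x))` locally uniformly
in time. -/
def Reg (ρ : ℝ → ℝ) : ℕ → (ℝ → ℝ → ℝ) → Prop
  | 0, g => WBdd ρ g
  | n + 1, g => WBdd ρ g ∧ ∃ gt gx : ℝ → ℝ → ℝ,
      (∀ t x, HasDerivAt (fun τ => g τ x) (gt t x) t) ∧ (∀ t x, HasDerivAt (g t) (gx t x) x) ∧
      Reg ρ n gt ∧ Reg ρ n gx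

namespace Reg
variable {ρ : ℝ → ℝ} {n : ℕ} {g h : ℝ → ℝ → ℝ}

lemma wBdd (hg : Reg ρ n g) : WBdd ρ g := by
  cases n with
  | zero => exact hg
  | succ n => exact hg.1

lemma of_succ (hg : Reg ρ (n + 1) g) : Reg ρ n g := by
  induction n generalizing g with
  | zero => exact hg.1
  | succ n ih =>
    obtain ⟨h0, gt, gx, h1, h2, h3, h4⟩ := hg
    exact ⟨h0, gt, gx, h1, h2, ih h3, ih h4⟩

lemma add (hg : Reg ρ n g) (hh : Reg ρ n h) : Reg ρ n (fun t x => g t x + h t x) := by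
  induction n generalizing g h with
  | zero => exact WBdd.add hg hh
  | succ n ih =>
    obtain ⟨h0, gt, gx, h1, h2, h3, h4⟩ := hg
    obtain ⟨k0, ht, hx, k1, k2, k3, k4⟩ := hh
    exact ⟨h0.add k0, _, _, fun t x => (h1 t x).add (k1 t x), fun t x => (h2 t x).add (k2 t x),
      ih h3 k3, ih h4 k4⟩

lemma const_mul (c : ℝ) (hg : Reg ρ n g) : Reg ρ n (fun t x => c * g t x) := by
  induction n generalizing g with
  | zero => exact WBdd.const_mul c hg
  | succ n ih =>
    obtain ⟨h0, gt, gx, h1, h2, h3, h4⟩ := hg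
    exact ⟨h0.const_mul c, _, _, fun t x => (h1 t x).const_mul c,
      fun t x => (h2 t x).const_mul c, ih h3, ih h4⟩

lemma sub (hg : Reg ρ n g) (hh : Reg ρ n h) : Reg ρ n (fun t x => g t x - h t x) := by
  simpa [sub_eq_add_neg] using hg.add (hh.const_mul (-1))

lemma mul (hρ : IsWeight ρ) (hg : Reg ρ n g) (hh : Reg ρ n h) :
    Reg ρ n (fun t x => g t x * h t x) := by
  induction n generalizing g h with
  | zero => exact WBdd.mul hρ hg hh
  | succ n ih =>
    have hg' := hg.of_succ
    have hh' := hh.of_succ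
    obtain ⟨h0, gt, gx, h1, h2, h3, h4⟩ := hg
    obtain ⟨k0, ht, hx, k1, k2, k3, k4⟩ := hh
    exact ⟨h0.mul hρ k0, _, _, fun t x => (h1 t x).mul (k1 t x), fun t x => (h2 t x).mul (k2 t x),
      (ih h3 hh').add (ih hg' k3), (ih h4 hh').add (ih hg' k4)⟩

lemma expAvg_one (hρ : IsWeight ρ) (hg : Reg ρ n g) : Reg ρ n (fun t => expAvg 1 (g t)) := by
  induction n generalizing g with
  | zero => exact WBdd.expAvg hρ (by simp) hg
  | succ n ih =>
    have hg' := hg.of_succ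
    obtain ⟨h0, gt, gx, h1, h2, h3, h4⟩ := hg
    refine ⟨h0.expAvg hρ (by simp), _, fun t x => expAvg 1 (g t) x - g t x,
      fun t x => hasDerivAt_expAvg_time hρ (by simp) h0 h3.wBdd h1 t x, fun t x => ?_, ih h3,
      (ih hg').sub hg'⟩
    obtain ⟨C, -, hC⟩ := h0.exists_bound hρ |t|
    exact hasDerivAt_expAvg_one (h0.cont_space t) (fun y => hC t y le_rfl) x

lemma expAvg_neg_one (hρ : IsWeight ρ) (hg : Reg ρ n g) :
    Reg ρ n (fun t => expAvg (-1) (g t)) := by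
  induction n generalizing g with
  | zero => exact WBdd.expAvg hρ (by simp) hg
  | succ n ih =>
    have hg' := hg.of_succ
    obtain ⟨h0, gt, gx, h1, h2, h3, h4⟩ := hg
    refine ⟨h0.expAvg hρ (by simp), _, fun t x => g t x - expAvg (-1) (g t) x,
      fun t x => hasDerivAt_expAvg_time hρ (by simp) h0 h3.wBdd h1 t x, fun t x => ?_, ih h3,
      hg'.sub (ih hg')⟩
    obtain ⟨C, -, hC⟩ := h0.exists_bound hρ |t|
    exact hasDerivAt_expAvg_neg_one (h0.cont_space t) (fun y => hC t y le_rfl) x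

lemma resolvent (hρ : IsWeight ρ) (hg : Reg ρ n g) : Reg ρ n (fun t => resolvent (g t)) := by
  convert ((hg.expAvg_neg_one hρ).add (hg.expAvg_one hρ)).const_mul (1 / 2) using 3
  rw [BBM.resolvent]; ring

lemma bbmOp (hρ : IsWeight ρ) (hg : Reg ρ n g) : Reg ρ n (fun t => bbmOp (g t)) := by
  convert ((hg.expAvg_neg_one hρ).sub (hg.expAvg_one hρ)).const_mul (1 / 2) using 3
  rw [BBM.bbmOp]; ring

lemma timeInt (hρ : IsWeight ρ) (hg : Reg ρ n g) : Reg ρ n (timeInt g) := by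
  induction n generalizing g with
  | zero => exact WBdd.timeInt hg
  | succ n ih =>
    have hg' := hg.of_succ
    obtain ⟨h0, gt, gx, h1, h2, h3, h4⟩ := hg
    exact ⟨h0.timeInt, g, BBM.timeInt gx, fun t x => hasDerivAt_timeInt_time h0 t x,
      hasDerivAt_timeInt_space hρ h0 h4.wBdd h2, hg', ih h4⟩

lemma contDiff (hg : Reg ρ n g) : ContDiff ℝ n (Function.uncurry g) := by
  induction n generalizing g with
  | zero => exact contDiff_zero.2 hg.cont
  | succ n ih =>
    obtain ⟨h0, gt, gx, h1, h2, h3, h4⟩ := hg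
    refine contDiff_succ_iff_hasFDerivAt.2 ⟨fun p =>
      (ContinuousLinearMap.toSpanSingleton ℝ (gt p.1 p.2)).coprod
        (ContinuousLinearMap.toSpanSingleton ℝ (gx p.1 p.2)), ?_, fun p => ?_⟩
    · have e : (fun p : ℝ × ℝ => (ContinuousLinearMap.toSpanSingleton ℝ (gt p.1 p.2)).coprod
          (ContinuousLinearMap.toSpanSingleton ℝ (gx p.1 p.2))) = fun p =>
          Function.uncurry gt p • ContinuousLinearMap.fst ℝ ℝ ℝ
            + Function.uncurry gx p • ContinuousLinearMap.snd ℝ ℝ ℝ := by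
        funext p
        ext <;> simp [Function.uncurry]
      rw [e]
      exact ((ih h3).smul contDiff_const).add ((ih h4).smul contDiff_const)
    · refine (hasStrictFDerivAt_uncurry_coprod (f := g)
        (f₁ := fun t x => ContinuousLinearMap.toSpanSingleton ℝ (gt t x))
        (f₂ := fun t x => ContinuousLinearMap.toSpanSingleton ℝ (gx t x))
        (Eventually.of_forall fun v => (h1 v.1 v.2).hasFDerivAt)
        (Eventually.of_forall fun v => (h2 v.1 v.2).hasFDerivAt) ?_ ?_).hasFDerivAt
      · exact ((ContinuousLinearMap.toSpanSingletonCLE (𝕜 := ℝ) (E := ℝ)).continuous.comp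
          h3.wBdd.cont).continuousAt
      · exact ((ContinuousLinearMap.toSpanSingletonCLE (𝕜 := ℝ) (E := ℝ)).continuous.comp
          h4.wBdd.cont).continuousAt

/-- A smooth function of `x` alone all of whose derivatives are `O(ρ)`. -/
lemma of_space {f : ℝ → ℝ} (hf : ContDiff ℝ ∞ f)
    (hb : ∀ k, ∃ C, 0 ≤ C ∧ ∀ x, |iteratedDeriv k f x| ≤ C * ρ x) (n : ℕ) :
    Reg ρ n (fun _ => f) := by
  induction n generalizing f with
  | zero =>
    obtain ⟨C, hC, h⟩ := hb 0
    exact ⟨hf.continuous.comp continuous_snd, fun T => ⟨C, hC, fun t x _ => by simpa using h x⟩⟩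
  | succ n ih =>
    obtain ⟨C, hC, h⟩ := hb 0
    have hd : ContDiff ℝ ∞ (deriv f) := by
      apply ContDiff.iterate_deriv 1 hf
    refine ⟨⟨hf.continuous.comp continuous_snd, fun T => ⟨C, hC, fun t x _ => by simpa using h x⟩⟩,
      fun _ _ => 0, fun _ => deriv f, fun t x => hasDerivAt_const _ _, fun t x => ?_, ?_, ?_⟩
    · exact (hf.differentiable (by simp) x).hasDerivAt
    · refine ih (f := fun _ => 0) contDiff_const fun k => ⟨0, le_rfl, fun x => ?_⟩
      simp
    · exact ih hd fun k => by simpa only [iteratedDeriv_succ'] using hb (k + 1)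

end Reg

/-! ### Global solutions for a globally Lipschitz nonlinearity -/

lemma expAvg_translate (σ p : ℝ) (g : ℝ → ℝ) (x : ℝ) :
    expAvg σ (fun y => g (y + p)) x = expAvg σ g (x + p) := by
  simp only [expAvg]
  congr 1; funext z; congr 2; ring

lemma bbmOp_translate (p : ℝ) (g : ℝ → ℝ) (x : ℝ) :
    bbmOp (fun y => g (y + p)) x = bbmOp g (x + p) := by
  simp only [bbmOp, expAvg_translate]

lemma abs_integral_exp_le {l : ℝ} (hl : 0 < l) (t : ℝ) :
    |∫ τ in (0 : ℝ)..t, Real.exp (l * |τ|)| ≤ Real.exp (l * |t|) / l := by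
  have key : ∀ s : ℝ, 0 ≤ s → |∫ τ in (0 : ℝ)..s, Real.exp (l * |τ|)| ≤ Real.exp (l * s) / l := by
    intro s hs
    have e : ∫ τ in (0 : ℝ)..s, Real.exp (l * |τ|) = ∫ τ in (0 : ℝ)..s, Real.exp (l * τ) := by
      refine intervalIntegral.integral_congr fun τ hτ => ?_
      rw [uIcc_of_le hs] at hτ
      simp only [abs_of_nonneg hτ.1]
    rw [e, intervalIntegral.integral_comp_mul_left _ hl.ne', integral_exp, smul_eq_mul, mul_zero,
      Real.exp_zero, abs_of_nonneg]
    · rw [inv_mul_eq_div]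
      gcongr
      linarith
    · have : 1 ≤ Real.exp (l * s) := Real.one_le_exp (by positivity)
      have := inv_pos.2 hl
      apply mul_nonneg <;> linarith
  rcases le_total 0 t with h | h
  · rw [abs_of_nonneg h]; exact key t h
  · have := key (-t) (by linarith)
    rw [abs_of_nonpos h]
    refine le_trans (le_of_eq ?_) this
    have e := intervalIntegral.integral_comp_neg (a := 0) (b := t)
      (fun τ => Real.exp (l * |τ|))
    simp only [abs_neg, neg_zero] at e
    rw [e, intervalIntegral.integral_symm, abs_neg]

lemma abs_timeInt_le {ρ : ℝ → ℝ} {l C : ℝ} (hl : 0 < l) {g : ℝ → ℝ → ℝ} {x : ℝ}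
    (hg : ∀ τ, |g τ x| ≤ C * Real.exp (l * |τ|) * ρ x) (t : ℝ) :
    |timeInt g t x| ≤ C / l * Real.exp (l * |t|) * ρ x := by
  have hC : 0 ≤ C * ρ x := by
    have := (abs_nonneg _).trans (hg 0)
    simpa using this
  have h1 := intervalIntegral.norm_integral_le_abs_of_norm_le (a := 0) (b := t) (μ := volume)
    (f := fun τ => g τ x) (g := fun τ => C * ρ x * Real.exp (l * |τ|))
    (Eventually.of_forall fun τ => (hg τ).trans (le_of_eq (by ring)))
    (Continuous.intervalIntegrable (by fun_prop) _ _)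
  rw [intervalIntegral.integral_const_mul, abs_mul, abs_of_nonneg hC] at h1
  calc |timeInt g t x| ≤ C * ρ x * |∫ τ in (0 : ℝ)..t, Real.exp (l * |τ|)| := h1
    _ ≤ C * ρ x * (Real.exp (l * |t|) / l) := by
      gcongr; exact abs_integral_exp_le hl t
    _ = _ := by ring

section Picard
variable {ρ f u₀ : ℝ → ℝ} {L C₀ l : ℝ}

/-- The change of unknown that turns bounded functions on space-time into functions bounded by
`e^{l|t|} ρ(x)`; for large `l` it makes the Picard map a contraction. -/
def unweight (ρ : ℝ → ℝ) (l : ℝ) (v : BoundedContinuousFunction (ℝ × ℝ) ℝ) (t x : ℝ) : ℝ :=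
  Real.exp (l * |t|) * ρ x * v (t, x)

/-- The right-hand side of the integral equation `u = u₀ + ∫₀ᵗ bbmOp (f(u))`. -/
def picardRHS (f u₀ : ℝ → ℝ) (u : ℝ → ℝ → ℝ) (t x : ℝ) : ℝ :=
  u₀ x + timeInt (fun τ => bbmOp (fun y => f (u τ y))) t x

lemma abs_unweight_le (hρ : IsWeight ρ) (v : BoundedContinuousFunction (ℝ × ℝ) ℝ) (t x : ℝ) :
    |unweight ρ l v t x| ≤ ‖v‖ * Real.exp (l * |t|) * ρ x := by
  rw [unweight, abs_mul, abs_mul, Real.abs_exp, abs_of_pos (hρ.pos x)]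
  have h1 := v.norm_coe_le_norm (t, x)
  rw [Real.norm_eq_abs] at h1
  have h2 := (hρ.pos x).le
  calc _ ≤ Real.exp (l * |t|) * ρ x * ‖v‖ := by gcongr
    _ = _ := by ring

lemma wBdd_unweight (hρ : IsWeight ρ) (hl : 0 < l) (v : BoundedContinuousFunction (ℝ × ℝ) ℝ) :
    WBdd ρ (unweight ρ l v) := by
  constructor
  · have h1 := hρ.continuous
    have h2 := v.continuous
    have : Function.uncurry (unweight ρ l v)
        = fun p : ℝ × ℝ => Real.exp (l * |p.1|) * ρ p.2 * v p := by
      funext p; rfl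
    rw [this]
    fun_prop
  · intro T
    refine ⟨‖v‖ * Real.exp (l * T), by positivity, fun t x ht => (abs_unweight_le hρ v t x).trans ?_⟩
    have := (hρ.pos x).le
    gcongr

lemma WBdd.comp_lipschitz {u : ℝ → ℝ → ℝ} (hL : 0 ≤ L) (hf : ∀ r s, |f r - f s| ≤ L * |r - s|)
    (hf0 : f 0 = 0) (hu : WBdd ρ u) : WBdd ρ (fun t x => f (u t x)) := by
  have hfc : Continuous f := by
    refine (LipschitzWith.of_dist_le_mul (K := L.toNNReal) fun r s => ?_).continuous
    rw [Real.dist_eq, Real.dist_eq, Real.coe_toNNReal _ hL]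
    exact hf r s
  refine ⟨hfc.comp hu.cont, fun T => ?_⟩
  obtain ⟨C, hC, h⟩ := hu.bdd T
  refine ⟨L * C, by positivity, fun t x ht => ?_⟩
  have := hf (u t x) 0
  rw [hf0, sub_zero, sub_zero] at this
  calc _ ≤ L * |u t x| := this
    _ ≤ L * (C * ρ x) := by gcongr; exact h t x ht
    _ = _ := by ring

lemma WBdd.bbmOp {u : ℝ → ℝ → ℝ} (hρ : IsWeight ρ) (hu : WBdd ρ u) :
    WBdd ρ (fun t => bbmOp (u t)) :=
  Reg.bbmOp (n := 0) hρ hu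

lemma wBdd_picardRHS {u : ℝ → ℝ → ℝ} (hρ : IsWeight ρ) (hL : 0 ≤ L)
    (hf : ∀ r s, |f r - f s| ≤ L * |r - s|) (hf0 : f 0 = 0) (hu₀ : Continuous u₀)
    (hb : ∀ x, |u₀ x| ≤ C₀ * ρ x) (hC₀ : 0 ≤ C₀) (hu : WBdd ρ u) :
    WBdd ρ (picardRHS f u₀ u) := by
  have h1 : WBdd ρ (fun _ => u₀) := ⟨hu₀.comp continuous_snd, fun T => ⟨C₀, hC₀, fun t x _ => hb x⟩⟩
  exact h1.add (((hu.comp_lipschitz hL hf hf0).bbmOp hρ).timeInt)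

lemma abs_picardRHS_sub_le (hρ : IsWeight ρ) (hl : 0 < l) (hL : 0 ≤ L)
    (hf : ∀ r s, |f r - f s| ≤ L * |r - s|) (hf0 : f 0 = 0)
    (v w : BoundedContinuousFunction (ℝ × ℝ) ℝ) (t x : ℝ) :
    |picardRHS f u₀ (unweight ρ l v) t x - picardRHS f u₀ (unweight ρ l w) t x|
      ≤ 2 * L * ‖v - w‖ / l * Real.exp (l * |t|) * ρ x := by
  have hv := (wBdd_unweight hρ hl v).comp_lipschitz hL hf hf0
  have hw := (wBdd_unweight hρ hl w).comp_lipschitz hL hf hf0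
  have e : picardRHS f u₀ (unweight ρ l v) t x - picardRHS f u₀ (unweight ρ l w) t x
      = timeInt (fun τ => BBM.bbmOp (fun y => f (unweight ρ l v τ y) - f (unweight ρ l w τ y))) t x := by
    simp only [picardRHS, timeInt, add_sub_add_left_eq_sub]
    rw [← intervalIntegral.integral_sub
      (((hv.bbmOp hρ).cont_time x).intervalIntegrable _ _)
      (((hw.bbmOp hρ).cont_time x).intervalIntegrable _ _)]
    refine intervalIntegral.integral_congr fun τ _ => ?_
    obtain ⟨C, -, hC⟩ := hv.exists_bound hρ |τ|
    obtain ⟨D, -, hD⟩ := hw.exists_bound hρ |τ|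
    exact (bbmOp_sub (hv.cont_space τ) (hw.cont_space τ) (fun y => hC τ y le_rfl)
      (fun y => hD τ y le_rfl) x).symm
  rw [e]
  refine abs_timeInt_le hl (fun τ => ?_) t
  have := abs_bbmOp_le hρ (C := L * (‖v - w‖ * Real.exp (l * |τ|)))
    (g := fun y => f (unweight ρ l v τ y) - f (unweight ρ l w τ y)) (fun y => ?_) x
  · exact this.trans (le_of_eq (by ring))
  · refine (hf _ _).trans ?_
    rw [mul_assoc L]
    refine mul_le_mul_of_nonneg_left ?_ hL
    have := abs_unweight_le (l := l) hρ (v - w) τ y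
    refine le_trans (le_of_eq (congrArg _ ?_)) this
    simp only [unweight, BoundedContinuousFunction.coe_sub, Pi.sub_apply]
    ring

/-- Global solutions of the integral equation when the nonlinearity is globally Lipschitz. By
uniqueness of the fixed point, they inherit the periods of the initial value. -/
theorem exists_picard (hρ : IsWeight ρ) (hL : 0 ≤ L) (hf : ∀ r s, |f r - f s| ≤ L * |r - s|)
    (hf0 : f 0 = 0) (hu₀ : Continuous u₀) (hb : ∀ x, |u₀ x| ≤ C₀ * ρ x) (hC₀ : 0 ≤ C₀) :
    ∃ u : ℝ → ℝ → ℝ, WBdd ρ u ∧ (∀ t x, u t x = picardRHS f u₀ u t x) ∧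
      ∀ p, (∀ x, ρ (x + p) = ρ x) → (∀ x, u₀ (x + p) = u₀ x) → ∀ t x, u t (x + p) = u t x := by
  -- the Picard map is Lipschitz with constant `2 * L / l < 1 / 2` after the change of unknown
  set l : ℝ := 4 * L + 1 with hl_def
  have hl : 0 < l := by positivity
  have hcont : ∀ v : BoundedContinuousFunction (ℝ × ℝ) ℝ,
      Continuous (fun q : ℝ × ℝ => Real.exp (-(l * |q.1|)) * (ρ q.2)⁻¹ *
        picardRHS f u₀ (unweight ρ l v) q.1 q.2) := by
    intro v
    have h1 := (wBdd_picardRHS hρ hL hf hf0 hu₀ hb hC₀ (wBdd_unweight hρ hl v)).cont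
    have h2 : Continuous (fun q : ℝ × ℝ => (ρ q.2)⁻¹) :=
      (hρ.continuous.comp continuous_snd).inv₀ fun q => (hρ.pos _).ne'
    exact (Continuous.mul (by fun_prop) h2).mul h1
  have hdist : ∀ (v w : BoundedContinuousFunction (ℝ × ℝ) ℝ) (q : ℝ × ℝ),
      |Real.exp (-(l * |q.1|)) * (ρ q.2)⁻¹ * picardRHS f u₀ (unweight ρ l v) q.1 q.2 -
        Real.exp (-(l * |q.1|)) * (ρ q.2)⁻¹ * picardRHS f u₀ (unweight ρ l w) q.1 q.2|
      ≤ 1 / 2 * ‖v - w‖ := by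
    intro v w q
    have hp := hρ.pos q.2
    have h1 := abs_picardRHS_sub_le (u₀ := u₀) hρ hl hL hf hf0 v w q.1 q.2
    rw [← mul_sub, abs_mul, abs_of_pos (by positivity)]
    calc _ ≤ Real.exp (-(l * |q.1|)) * (ρ q.2)⁻¹ *
          (2 * L * ‖v - w‖ / l * Real.exp (l * |q.1|) * ρ q.2) := by gcongr
      _ = 2 * L / l * ‖v - w‖ := by
        rw [Real.exp_neg]
        field_simp
      _ ≤ 1 / 2 * ‖v - w‖ := by
        refine mul_le_mul_of_nonneg_right ?_ (norm_nonneg _)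
        rw [div_le_div_iff₀ hl two_pos]
        linarith
  have hzero : ∀ q : ℝ × ℝ, |Real.exp (-(l * |q.1|)) * (ρ q.2)⁻¹ *
      picardRHS f u₀ (unweight ρ l 0) q.1 q.2| ≤ C₀ := by
    intro q
    have hp := hρ.pos q.2
    have e : picardRHS f u₀ (unweight ρ l 0) q.1 q.2 = u₀ q.2 := by
      simp [picardRHS, unweight, timeInt, bbmOp, expAvg, hf0]
    rw [e, abs_mul, abs_of_pos (by positivity)]
    have h2 : Real.exp (-(l * |q.1|)) ≤ 1 := Real.exp_le_one_iff.2 (by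
      have := mul_nonneg hl.le (abs_nonneg q.1)
      linarith)
    calc _ ≤ 1 * (ρ q.2)⁻¹ * (C₀ * ρ q.2) := by gcongr; exact hb _
      _ = C₀ := by field_simp
  have hbdd : ∀ (v : BoundedContinuousFunction (ℝ × ℝ) ℝ) (q : ℝ × ℝ),
      ‖Real.exp (-(l * |q.1|)) * (ρ q.2)⁻¹ * picardRHS f u₀ (unweight ρ l v) q.1 q.2‖
        ≤ 1 / 2 * ‖v - 0‖ + C₀ := by
    intro v q
    have h1 := hdist v 0 q
    have h2 := hzero q
    rw [Real.norm_eq_abs]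
    calc _ = |(Real.exp (-(l * |q.1|)) * (ρ q.2)⁻¹ * picardRHS f u₀ (unweight ρ l v) q.1 q.2 -
        Real.exp (-(l * |q.1|)) * (ρ q.2)⁻¹ * picardRHS f u₀ (unweight ρ l 0) q.1 q.2) +
        Real.exp (-(l * |q.1|)) * (ρ q.2)⁻¹ * picardRHS f u₀ (unweight ρ l 0) q.1 q.2| := by
          rw [sub_add_cancel]
      _ ≤ _ := (abs_add_le _ _).trans (add_le_add h1 h2)
  let Φ : BoundedContinuousFunction (ℝ × ℝ) ℝ → BoundedContinuousFunction (ℝ × ℝ) ℝ := fun v =>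
    BoundedContinuousFunction.ofNormedAddCommGroup _ (hcont v) _ (hbdd v)
  have hΦ : ∀ v q, Φ v q = Real.exp (-(l * |q.1|)) * (ρ q.2)⁻¹ *
      picardRHS f u₀ (unweight ρ l v) q.1 q.2 := fun v q => rfl
  have hcontr : ContractingWith (1 / 2) Φ := by
    refine ⟨by norm_num, LipschitzWith.of_dist_le_mul fun v w => ?_⟩
    rw [BoundedContinuousFunction.dist_le (by positivity)]
    intro q
    rw [Real.dist_eq, hΦ, hΦ, dist_eq_norm]
    simpa using hdist v w q
  set v := ContractingWith.fixedPoint Φ hcontr with hv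
  have hfix : Φ v = v := hcontr.fixedPoint_isFixedPt
  refine ⟨unweight ρ l v, wBdd_unweight hρ hl v, fun t x => ?_, fun p hρp hup => ?_⟩
  · have h1 : v (t, x) = _ := (DFunLike.congr_fun hfix (t, x)).symm.trans (hΦ v (t, x))
    have hp := hρ.pos x
    conv_lhs => rw [unweight, h1]
    rw [Real.exp_neg]
    field_simp
  · -- the translate of the fixed point is again a fixed point
    let w : BoundedContinuousFunction (ℝ × ℝ) ℝ :=
      v.compContinuous ⟨fun q : ℝ × ℝ => (q.1, q.2 + p), by fun_prop⟩
    have hw : ∀ q, w q = v (q.1, q.2 + p) := fun q => rfl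
    have huw : ∀ t x, unweight ρ l w t x = unweight ρ l v t (x + p) := fun t x => by
      rw [unweight, unweight, hw, hρp]
    have hfixw : Φ w = w := by
      ext q
      rw [hΦ, hw, ← DFunLike.congr_fun hfix (q.1, q.2 + p), hΦ]
      have e : ∀ τ x, bbmOp (fun y => f (unweight ρ l v τ (y + p))) x
          = bbmOp (fun y => f (unweight ρ l v τ y)) (x + p) := fun τ x =>
        bbmOp_translate p (fun y => f (unweight ρ l v τ y)) x
      simp only [picardRHS, timeInt, huw, hρp, hup, e]
    have hwv : w = v := hcontr.fixedPoint_unique hfixw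
    intro t x
    rw [← huw, hwv]

end Picard

/-! ### Conservation of energy -/

/-- The Sobolev inequality `‖g‖_∞² ≤ 2 ‖g‖_{H¹}²` on intervals of length at least `1`. -/
lemma sq_le_two_mul_integral {g g' : ℝ → ℝ} (hd : ∀ x, HasDerivAt g (g' x) x) (hg' : Continuous g')
    {a b x : ℝ} (hab : 1 ≤ b - a) (hx : x ∈ Icc a b) :
    g x ^ 2 ≤ 2 * ∫ y in a..b, (g y ^ 2 + g' y ^ 2) := by
  have hg : Continuous g := continuous_iff_continuousAt.2 fun x => (hd x).continuousAt
  have hab' : a ≤ b := by linarith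
  set S := ∫ y in a..b, (g y ^ 2 + g' y ^ 2) with hS
  have hS0 : 0 ≤ S := intervalIntegral.integral_nonneg hab' fun y _ => by positivity
  have key : ∀ y ∈ Icc a b, g x ^ 2 - S ≤ g y ^ 2 := by
    intro y hy
    have h1 : ∫ z in y..x, 2 * g z * g' z = g x ^ 2 - g y ^ 2 := by
      refine intervalIntegral.integral_eq_sub_of_hasDerivAt (f := fun z => g z ^ 2)
        (fun z _ => ?_) (Continuous.intervalIntegrable (by fun_prop) _ _)
      exact ((hd z).pow 2).congr_deriv (by simp)
    have hc : Continuous fun z => g z ^ 2 + g' z ^ 2 := by fun_prop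
    have h2 : |∫ z in y..x, 2 * g z * g' z| ≤ |∫ z in y..x, (g z ^ 2 + g' z ^ 2)| := by
      refine intervalIntegral.norm_integral_le_abs_of_norm_le (μ := volume)
        (f := fun z => 2 * g z * g' z) (Eventually.of_forall fun z => ?_)
        (hc.intervalIntegrable _ _)
      rw [Real.norm_eq_abs, abs_le]
      constructor <;> nlinarith [sq_nonneg (g z + g' z), sq_nonneg (g z - g' z)]
    have h3 : |∫ z in y..x, (g z ^ 2 + g' z ^ 2)| ≤ |∫ z in a..b, (g z ^ 2 + g' z ^ 2)| := by
      refine intervalIntegral.abs_integral_mono_interval ?_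
        (Eventually.of_forall fun z => by positivity)
        (Continuous.intervalIntegrable (by fun_prop) _ _)
      rw [uIoc_of_le hab', uIoc]
      exact Ioc_subset_Ioc (le_min hy.1 hx.1) (max_le hy.2 hx.2)
    rw [← hS, abs_of_nonneg hS0] at h3
    have := (le_abs_self _).trans (h2.trans h3)
    linarith
  have h4 : ∫ y in a..b, (g x ^ 2 - S) ≤ S := by
    refine intervalIntegral.integral_mono_on hab' intervalIntegrable_const
      (Continuous.intervalIntegrable (by fun_prop) _ _) fun y hy => ?_
    have := key y hy
    have := sq_nonneg (g' y)
    linarith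
  rw [intervalIntegral.integral_const, smul_eq_mul] at h4
  nlinarith

section Energy
variable {ρ f d u₀ : ℝ → ℝ} {L : ℝ} {u : ℝ → ℝ → ℝ}

lemma lipschitz_of_hasDerivAt (hfd : ∀ r, HasDerivAt f (d r) r) (hdL : ∀ r, |d r| ≤ L) (r s : ℝ) :
    |f r - f s| ≤ L * |r - s| := by
  simpa using Convex.norm_image_sub_le_of_norm_hasDerivWithin_le (f := f) (f' := d) (s := univ)
    (fun x _ => (hfd x).hasDerivWithinAt) (fun x _ => hdL x) convex_univ (mem_univ s) (mem_univ r)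

/-- A solution of `u = u₀ + ∫₀ᵗ bbmOp (f(u))` is differentiable in `x`, with the derivative that
differentiation under the integral gives; the energy `∫ u² + u_x²` over `[a, b]` changes only by
the flux of `2(u u_{xt} - ∫₀ᵘ r f'(r) dr)` through the end points. -/
lemma exists_energy_flux (hρ : IsWeight ρ) (hfd : ∀ r, HasDerivAt f (d r) r) (hdc : Continuous d)
    (hdL : ∀ r, |d r| ≤ L) (hf0 : f 0 = 0) (hu : WBdd ρ u)
    (heq : ∀ t x, u t x = picardRHS f u₀ u t x) {C₁ : ℝ} (hC₁ : 0 ≤ C₁)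
    (hu₀ : ∀ x, HasDerivAt u₀ (deriv u₀ x) x)
    (hu₀c : Continuous (deriv u₀)) (hu₀b : ∀ x, |deriv u₀ x| ≤ C₁ * ρ x) :
    ∃ ux q : ℝ → ℝ → ℝ, WBdd ρ ux ∧ WBdd ρ q ∧ (∀ t x, HasDerivAt (u t) (ux t x) x) ∧
      (∀ x, ux 0 x = deriv u₀ x) ∧
      (∀ p, (∀ t x, u t (x + p) = u t x) → ∀ t x, q t (x + p) = q t x) ∧
      ∀ a b t, HasDerivAt (fun τ => ∫ x in a..b, (u τ x ^ 2 + ux τ x ^ 2)) (q t b - q t a) t := by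
  have hL : 0 ≤ L := (abs_nonneg _).trans (hdL 0)
  have hlip := lipschitz_of_hasDerivAt hfd hdL
  set w : ℝ → ℝ → ℝ := fun t x => f (u t x) with hw_def
  have hw : WBdd ρ w := hu.comp_lipschitz hL hlip hf0
  set y : ℝ → ℝ → ℝ := fun t => bbmOp (w t) with hy_def
  have hy : WBdd ρ y := hw.bbmOp hρ
  have hres : WBdd ρ (fun t => resolvent (w t)) := Reg.resolvent (n := 0) hρ hw
  set z : ℝ → ℝ → ℝ := fun t x => w t x - resolvent (w t) x with hz_def
  have hz : WBdd ρ z := Reg.sub (n := 0) hw hres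
  have hyx : ∀ t x, HasDerivAt (y t) (z t x) x := fun t x => by
    obtain ⟨C, -, hC⟩ := hw.exists_bound hρ |t|
    exact hasDerivAt_bbmOp (hw.cont_space t) (fun r => hC t r le_rfl) x
  have hrx : ∀ t x, HasDerivAt (resolvent (w t)) (-y t x) x := fun t x => by
    obtain ⟨C, -, hC⟩ := hw.exists_bound hρ |t|
    exact hasDerivAt_resolvent (hw.cont_space t) (fun r => hC t r le_rfl) x
  set ux : ℝ → ℝ → ℝ := fun t x => deriv u₀ x + timeInt z t x with hux_def
  have hux : WBdd ρ ux := WBdd.add (g := fun _ => deriv u₀)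
    ⟨hu₀c.comp continuous_snd, fun T => ⟨C₁, hC₁, fun t x _ => hu₀b x⟩⟩ hz.timeInt
  have hut : ∀ t x, HasDerivAt (fun τ => u τ x) (y t x) t := fun t x => by
    have h := (hasDerivAt_timeInt_time hy t x).const_add (u₀ x)
    exact h.congr_of_eventuallyEq (Eventually.of_forall fun τ => heq τ x)
  have hux' : ∀ t x, HasDerivAt (u t) (ux t x) x := fun t x => by
    have h := (hu₀ x).add (hasDerivAt_timeInt_space hρ hy hz hyx t x)
    exact h.congr_of_eventuallyEq (Eventually.of_forall fun x => heq t x)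
  have huxt : ∀ t x, HasDerivAt (fun τ => ux τ x) (z t x) t := fun t x =>
    (hasDerivAt_timeInt_time hz t x).const_add _
  set Φ : ℝ → ℝ := fun r => ∫ s in (0 : ℝ)..r, s * d s with hΦ_def
  have hΦd : ∀ r, HasDerivAt Φ (r * d r) r := fun r =>
    ((continuous_id.mul hdc).integral_hasStrictDerivAt 0 r).hasDerivAt
  have hΦb : ∀ r, |Φ r| ≤ L * |r| * |r| := by
    intro r
    have := intervalIntegral.norm_integral_le_of_norm_le_const (a := 0) (b := r)
      (f := fun s => s * d s) (C := L * |r|) fun s hs => by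
        rw [norm_mul, mul_comm]
        refine mul_le_mul (hdL s) ?_ (norm_nonneg _) hL
        rw [Real.norm_eq_abs]
        rcases le_total 0 r with h | h
        · rw [uIoc_of_le h] at hs
          rw [abs_of_pos hs.1, abs_of_nonneg h]; exact hs.2
        · rw [uIoc_of_ge h] at hs
          rw [abs_of_nonpos hs.2, abs_of_nonpos h]; linarith [hs.1]
    simpa using this
  have hΦu : WBdd ρ (fun t x => Φ (u t x)) := by
    have hΦc : Continuous Φ := continuous_iff_continuousAt.2 fun r => (hΦd r).continuousAt
    refine ⟨hΦc.comp hu.cont, fun T => ?_⟩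
    obtain ⟨C, hC, h1⟩ := hu.bdd T
    obtain ⟨D, hD, h2⟩ := hu.exists_bound hρ T
    refine ⟨L * D * C, by positivity, fun t x ht => (hΦb _).trans ?_⟩
    rw [mul_assoc _ C]
    have := h1 t x ht
    have := h2 t x ht
    gcongr
  set q : ℝ → ℝ → ℝ := fun t x => 2 * (u t x * z t x + (-1) * Φ (u t x)) with hq_def
  have hq : WBdd ρ q := ((hu.mul hρ hz).add (hΦu.const_mul (-1))).const_mul 2
  have hqx : ∀ t x, HasDerivAt (q t) (2 * u t x * y t x + 2 * ux t x * z t x) x := fun t x => by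
    have hwx : HasDerivAt (w t) (d (u t x) * ux t x) x := (hfd (u t x)).comp x (hux' t x)
    have hzx : HasDerivAt (z t) (d (u t x) * ux t x - -y t x) x := hwx.sub (hrx t x)
    have hΦx : HasDerivAt (fun x => Φ (u t x)) (u t x * d (u t x) * ux t x) x :=
      (hΦd (u t x)).comp x (hux' t x)
    refine ((((hux' t x).mul hzx).add (hΦx.const_mul (-1))).const_mul 2).congr_deriv ?_
    ring
  refine ⟨ux, q, hux, hq, hux', fun x => by simp [hux_def, timeInt], fun p hp t x => ?_,
    fun a b t => ?_⟩
  · have hwp : (fun r => w t (r + p)) = w t := by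
      funext r; simp only [hw_def, hp]
    have e1 : resolvent (w t) (x + p) = resolvent (w t) x := by
      conv_rhs => rw [← hwp]
      simp only [resolvent, expAvg_translate]
    simp only [hq_def, hz_def]
    rw [e1, hp, ← congrFun hwp x]
  · obtain ⟨A, hA, h1⟩ := hu.exists_bound hρ (|t| + 1)
    obtain ⟨B, hB, h2⟩ := hux.exists_bound hρ (|t| + 1)
    obtain ⟨A', hA', h3⟩ := hy.exists_bound hρ (|t| + 1)
    obtain ⟨B', hB', h4⟩ := hz.exists_bound hρ (|t| + 1)
    have hs : {τ : ℝ | |τ| < |t| + 1} ∈ 𝓝 t :=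
      (isOpen_lt continuous_abs continuous_const).mem_nhds (lt_add_one |t|)
    have hcu := fun τ => hu.cont_space τ
    have hcux := fun τ => hux.cont_space τ
    have hcy := fun τ => hy.cont_space τ
    have hcz := fun τ => hz.cont_space τ
    have hI : Continuous fun x => 2 * u t x * y t x + 2 * ux t x * z t x := by
      have := hcu t; have := hcux t; have := hcy t; have := hcz t
      fun_prop
    have hD := (intervalIntegral.hasDerivAt_integral_of_dominated_loc_of_deriv_le (μ := volume)
      (a := a) (b := b) (x₀ := t)
      (F := fun τ x => u τ x ^ 2 + ux τ x ^ 2)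
      (F' := fun τ x => 2 * u τ x * y τ x + 2 * ux τ x * z τ x)
      (bound := fun _ => 2 * A * A' + 2 * B * B') hs
      (Eventually.of_forall fun τ => (((hcu τ).pow 2).add ((hcux τ).pow 2)).aestronglyMeasurable)
      ((((hcu t).pow 2).add ((hcux t).pow 2)).intervalIntegrable _ _)
      hI.aestronglyMeasurable
      (Eventually.of_forall fun x _ τ hτ => ?_) intervalIntegrable_const
      (Eventually.of_forall fun x _ τ _ => ?_)).2
    · refine hD.congr_deriv ?_
      exact intervalIntegral.integral_eq_sub_of_hasDerivAt (fun x _ => hqx t x)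
        (hI.intervalIntegrable _ _)
    · have hτ' : |τ| ≤ |t| + 1 := le_of_lt hτ
      refine (norm_add_le _ _).trans ?_
      rw [norm_mul, norm_mul, norm_mul, norm_mul, Real.norm_two]
      simp only [Real.norm_eq_abs]
      have := h1 τ x hτ'; have := h2 τ x hτ'; have := h3 τ x hτ'; have := h4 τ x hτ'
      gcongr
    · refine (((hut τ x).pow 2).add ((huxt τ x).pow 2)).congr_deriv ?_
      simp

/-- Pointwise bound by the initial energy, provided each `x` lies in intervals through whose end
points an arbitrarily small amount of energy flows. -/
lemma sq_le_of_small_flux {ux q : ℝ → ℝ → ℝ} (hux : WBdd ρ ux)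
    (hd : ∀ t x, HasDerivAt (u t) (ux t x) x)
    (hE : ∀ a b t, HasDerivAt (fun τ => ∫ x in a..b, (u τ x ^ 2 + ux τ x ^ 2)) (q t b - q t a) t)
    {E t x : ℝ} (hw : ∀ δ > 0, ∃ a b, 1 ≤ b - a ∧ x ∈ Icc a b ∧
      (∫ y in a..b, (u 0 y ^ 2 + ux 0 y ^ 2)) ≤ E ∧ ∀ τ, |τ| ≤ |t| → |q τ b - q τ a| ≤ δ) :
    u t x ^ 2 ≤ 2 * E := by
  refine le_of_forall_pos_le_add fun δ hδ => ?_
  obtain ⟨a, b, hab, hx, h0, hq⟩ := hw (δ / (2 * (|t| + 1))) (by positivity)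
  have h1 := Convex.norm_image_sub_le_of_norm_hasDerivWithin_le
    (f := fun τ => ∫ x in a..b, (u τ x ^ 2 + ux τ x ^ 2)) (s := Icc (-|t|) |t|)
    (fun τ _ => (hE a b τ).hasDerivWithinAt) (fun τ hτ => hq τ (abs_le.2 hτ)) (convex_Icc _ _)
    (x := 0) (y := t) (by simp) ⟨neg_abs_le t, le_abs_self t⟩
  have h2 := sq_le_two_mul_integral (hd t) (hux.cont_space t) hab hx
  have h3 := (le_abs_self _).trans h1
  have h4 : δ / (2 * (|t| + 1)) * ‖t - 0‖ ≤ δ / 2 := by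
    rw [sub_zero, Real.norm_eq_abs]
    have := abs_nonneg t
    rw [div_mul_eq_mul_div, div_le_div_iff₀ (by positivity) two_pos]
    nlinarith
  linarith

end Energy

/-! ### Global solutions of the BBM equation -/

/-- The derivative `1 + r` of the nonlinearity `r + r² / 2`, frozen outside `[-M, M]`. -/
def truncDeriv (M r : ℝ) : ℝ := 1 + max (-M) (min M r)

/-- A globally Lipschitz `C¹` function that agrees with `r + r² / 2` on `[-M, M]`. -/
def trunc (M r : ℝ) : ℝ := ∫ s in (0 : ℝ)..r, truncDeriv M s

lemma continuous_truncDeriv (M : ℝ) : Continuous (truncDeriv M) := by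
  unfold truncDeriv; fun_prop

lemma abs_truncDeriv_le {M : ℝ} (hM : 0 ≤ M) (r : ℝ) : |truncDeriv M r| ≤ 1 + M := by
  have h1 : max (-M) (min M r) ≤ M := max_le (by linarith) (min_le_left _ _)
  have h2 : -M ≤ max (-M) (min M r) := le_max_left _ _
  rw [truncDeriv, abs_le]
  constructor <;> linarith

lemma hasDerivAt_trunc (M r : ℝ) : HasDerivAt (trunc M) (truncDeriv M r) r :=
  ((continuous_truncDeriv M).integral_hasStrictDerivAt 0 r).hasDerivAt

lemma trunc_zero (M : ℝ) : trunc M 0 = 0 := by simp [trunc]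

lemma trunc_eq {M r : ℝ} (hr : |r| ≤ M) : trunc M r = r + r ^ 2 / 2 := by
  have e : trunc M r = ∫ s in (0 : ℝ)..r, (1 + s) := by
    refine intervalIntegral.integral_congr fun s hs => ?_
    have hs' : |s| ≤ M := by
      refine le_trans ?_ hr
      simpa using abs_sub_left_of_mem_uIcc hs
    obtain ⟨h1, h2⟩ := abs_le.1 hs'
    simp only [truncDeriv, min_eq_right h2, max_eq_right h1]
  rw [e, intervalIntegral.integral_add (f := fun _ => (1 : ℝ)) (g := fun s => s)
    intervalIntegrable_const (continuous_id.intervalIntegrable _ _), integral_id]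
  simp

/-- `u` is a global mild solution of the BBM equation with initial value `u₀` and spatial
weight `ρ`. -/
structure IsMild (ρ u₀ : ℝ → ℝ) (u : ℝ → ℝ → ℝ) : Prop where
  wBdd : WBdd ρ u
  eq : ∀ t x, u t x = picardRHS (fun r => r + r ^ 2 / 2) u₀ u t x

lemma integrable_exp_neg_abs_half : Integrable (fun x : ℝ => Real.exp (-|x| / 2)) := by
  rw [← integrableOn_univ, ← Iic_union_Ioi (a := (0 : ℝ))]
  refine IntegrableOn.union ?_ ?_
  · refine (integrableOn_exp_mul_Iic (a := 1 / 2) (by norm_num) 0).congr_fun (fun x hx => ?_)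
      measurableSet_Iic
    simp only [abs_of_nonpos (mem_Iic.1 hx)]
    congr 1; ring
  · refine integrableOn_exp_half.congr_fun (fun x hx => ?_) measurableSet_Ioi
    simp only [abs_of_pos (mem_Ioi.1 hx)]

/-- Global solutions on the line. A solution for the truncated nonlinearity satisfies an a priori
bound below the level of truncation, by conservation of energy, so it solves the original
equation. -/
theorem exists_isMild_line {u₀ : ℝ → ℝ} (h₀ : ContDiff ℝ 1 u₀) {C : ℝ}
    (hb : ∀ x, |u₀ x| ≤ C * Real.exp (-|x| / 2))
    (hb' : ∀ x, |deriv u₀ x| ≤ C * Real.exp (-|x| / 2)) :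
    ∃ u, IsMild (fun x => Real.exp (-|x| / 2)) u₀ u := by
  have hC : 0 ≤ C := by simpa using (abs_nonneg _).trans (hb 0)
  have hρ := isWeight_exp
  set ρ : ℝ → ℝ := fun x => Real.exp (-|x| / 2) with hρ_def
  set E : ℝ := 2 * C ^ 2 * ∫ x, ρ x with hE_def
  have hE0 : 0 ≤ E := mul_nonneg (by positivity) (integral_nonneg fun x => (hρ.pos x).le)
  -- the energy bound will be `u² ≤ 2 * E`, and `2 * E ≤ M ^ 2`
  set M : ℝ := 2 * E + 1 with hM_def
  have hM : 0 ≤ M := by positivity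
  have hd := abs_truncDeriv_le hM
  obtain ⟨u, hu, heq, -⟩ := exists_picard (C₀ := C) hρ (by positivity)
    (lipschitz_of_hasDerivAt (hasDerivAt_trunc M) hd) (trunc_zero M) h₀.continuous hb hC
  have hdc : Continuous (deriv u₀) := h₀.continuous_deriv le_rfl
  have hdd : ∀ x, HasDerivAt u₀ (deriv u₀ x) x := fun x =>
    (h₀.differentiable one_ne_zero x).hasDerivAt
  obtain ⟨ux, q, hux, hq, hd1, hux0, -, hE⟩ := exists_energy_flux hρ (hasDerivAt_trunc M)
    (continuous_truncDeriv M) hd (trunc_zero M) hu heq hC hdd hdc hb'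
  have hu0 : ∀ x, u 0 x = u₀ x := fun x => by rw [heq]; simp [picardRHS, timeInt]
  have hbound : ∀ t x, |u t x| ≤ M := by
    intro t x
    have h1 : u t x ^ 2 ≤ 2 * E := by
      refine sq_le_of_small_flux hux hd1 hE fun δ hδ => ?_
      -- the flux is `O(e^{-n/2})` through the ends of `[-n, n]`
      obtain ⟨D, hD, hq1⟩ := hq.bdd |t|
      have hlim : Tendsto (fun n : ℝ => D * Real.exp (-n / 2) + D * Real.exp (-n / 2)) atTop
          (𝓝 (D * 0 + D * 0)) := by
        have : Tendsto (fun n : ℝ => Real.exp (-n / 2)) atTop (𝓝 0) := by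
          refine Real.tendsto_exp_atBot.comp ?_
          exact tendsto_neg_atTop_atBot.atBot_div_const two_pos
        exact (this.const_mul D).add (this.const_mul D)
      rw [mul_zero, add_zero] at hlim
      obtain ⟨n, hn1, hn2, hn3⟩ := ((hlim.eventually (gt_mem_nhds hδ)).and
        ((eventually_ge_atTop 1).and (eventually_ge_atTop |x|))).exists
      have hn0 : |n| = n := abs_of_nonneg (by linarith)
      refine ⟨-n, n, by linarith, abs_le.1 hn3, ?_, fun τ hτ => ?_⟩
      · rw [intervalIntegral.integral_of_le (by linarith), hE_def, ← integral_const_mul]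
        refine (setIntegral_mono_on ?_ (integrable_exp_neg_abs_half.const_mul _).integrableOn
          measurableSet_Ioc (g := fun x => 2 * C ^ 2 * ρ x) fun y _ => ?_).trans
          (setIntegral_le_integral (integrable_exp_neg_abs_half.const_mul _)
            (Eventually.of_forall fun y => mul_nonneg (by positivity) (hρ.pos y).le))
        · exact ((((hu.cont_space 0).pow 2).add ((hux.cont_space 0).pow 2)).integrableOn_Icc).mono_set
            Ioc_subset_Icc_self
        · have h1 := hρ.pos y
          have h2 := hρ.le_one y
          have key : ∀ r, |r| ≤ C * ρ y → r ^ 2 ≤ C ^ 2 * ρ y := fun r hr => by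
            rw [← sq_abs]
            calc |r| ^ 2 ≤ (C * ρ y) ^ 2 := by gcongr
              _ = C ^ 2 * (ρ y * ρ y) := by ring
              _ ≤ C ^ 2 * (ρ y * 1) := by gcongr
              _ = _ := by ring
          rw [hu0, hux0]
          linarith [key _ (hb y), key _ (hb' y)]
      · refine (abs_sub _ _).trans (le_trans (add_le_add (hq1 τ n hτ) (hq1 τ (-n) hτ)) ?_)
        simpa [hρ_def, hn0] using hn1.le
    refine abs_le_of_sq_le_sq (h1.trans ?_) hM
    nlinarith
  refine ⟨u, hu, fun t x => ?_⟩
  rw [heq]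
  simp only [picardRHS, trunc_eq (hbound _ _)]

/-- Global solutions on the torus, by the argument of `exists_isMild_line`. -/
theorem exists_isMild_torus {u₀ : ℝ → ℝ} (h₀ : ContDiff ℝ 1 u₀)
    (hper : Function.Periodic u₀ (2 * π)) {C : ℝ}
    (hb : ∀ x, |u₀ x| ≤ C) (hb' : ∀ x, |deriv u₀ x| ≤ C) :
    ∃ u, IsMild (fun _ => 1) u₀ u ∧ ∀ t, Function.Periodic (u t) (2 * π) := by
  have hC : 0 ≤ C := (abs_nonneg _).trans (hb 0)
  have hρ := isWeight_one
  have hpi : 1 ≤ 2 * π := by linarith [Real.pi_gt_three]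
  set E : ℝ := 2 * C ^ 2 * (2 * π) with hE_def
  have hE0 : 0 ≤ E := by positivity
  -- the energy bound will be `u² ≤ 2 * E`, and `2 * E ≤ M ^ 2`
  set M : ℝ := 2 * E + 1 with hM_def
  have hM : 0 ≤ M := by positivity
  have hd := abs_truncDeriv_le hM
  obtain ⟨u, hu, heq, hp⟩ := exists_picard (C₀ := C) hρ (by positivity)
    (lipschitz_of_hasDerivAt (hasDerivAt_trunc M) hd) (trunc_zero M) h₀.continuous
    (fun x => by simpa using hb x) hC
  have hp' := hp (2 * π) (fun _ => rfl) hper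
  have hdc : Continuous (deriv u₀) := h₀.continuous_deriv le_rfl
  have hdd : ∀ x, HasDerivAt u₀ (deriv u₀ x) x := fun x =>
    (h₀.differentiable one_ne_zero x).hasDerivAt
  obtain ⟨ux, q, hux, hq, hd1, hux0, hqp, hE⟩ := exists_energy_flux hρ (hasDerivAt_trunc M)
    (continuous_truncDeriv M) hd (trunc_zero M) hu heq hC hdd hdc (fun x => by simpa using hb' x)
  have hu0 : ∀ x, u 0 x = u₀ x := fun x => by rw [heq]; simp [picardRHS, timeInt]
  have hbound : ∀ t x, |u t x| ≤ M := by
    intro t x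
    have h1 : u t x ^ 2 ≤ 2 * E := by
      refine sq_le_of_small_flux hux hd1 hE fun δ hδ => ?_
      -- over a full period the fluxes through the two ends cancel
      refine ⟨x, x + 2 * π, by linarith, ⟨le_rfl, by linarith⟩, ?_, fun τ _ => ?_⟩
      · have key : ∀ r, |r| ≤ C → r ^ 2 ≤ C ^ 2 := fun r hr => by
          rw [← sq_abs]; gcongr
        calc _ ≤ ∫ y in x..(x + 2 * π), 2 * C ^ 2 := by
              refine intervalIntegral.integral_mono_on (by linarith)
                ((((hu.cont_space 0).pow 2).add ((hux.cont_space 0).pow 2)).intervalIntegrable _ _)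
                intervalIntegrable_const fun y _ => ?_
              rw [hu0, hux0]
              linarith [key _ (hb y), key _ (hb' y)]
          _ = E := by rw [intervalIntegral.integral_const, smul_eq_mul]; ring
      · rw [hqp _ hp', sub_self, abs_zero]
        exact hδ.le
    refine abs_le_of_sq_le_sq (h1.trans ?_) hM
    nlinarith
  refine ⟨u, ⟨hu, fun t x => ?_⟩, hp'⟩
  rw [heq]
  simp only [picardRHS, trunc_eq (hbound _ _)]

/-! ### Regularity of the solutions -/

section Mild
variable {ρ u₀ : ℝ → ℝ} {u : ℝ → ℝ → ℝ}

/-- The flux density `u + u² / 2`. -/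
def flux (u : ℝ → ℝ → ℝ) (t x : ℝ) : ℝ := u t x + u t x ^ 2 / 2

lemma IsMild.eq_flux (hu : IsMild ρ u₀ u) (t x : ℝ) :
    u t x = u₀ x + timeInt (fun τ => bbmOp (flux u τ)) t x := hu.eq t x

lemma IsMild.zero (hu : IsMild ρ u₀ u) (x : ℝ) : u 0 x = u₀ x := by
  rw [hu.eq_flux]; simp [timeInt]

lemma Reg.flux (hρ : IsWeight ρ) {n : ℕ} (hu : Reg ρ n u) : Reg ρ n (flux u) := by
  convert hu.add ((hu.mul hρ hu).const_mul (1 / 2)) using 3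
  rw [BBM.flux]; ring

lemma Reg.exists_hasDerivAt_space {n : ℕ} {g : ℝ → ℝ → ℝ} (hg : Reg ρ (n + 1) g) :
    ∃ gx, (∀ t x, HasDerivAt (g t) (gx t x) x) ∧ Reg ρ n gx := by
  obtain ⟨-, -, gx, -, h2, -, h4⟩ := hg
  exact ⟨gx, h2, h4⟩

/-- The time derivative of a mild solution. -/
lemma IsMild.hasDerivAt_time (hρ : IsWeight ρ) (hu : IsMild ρ u₀ u) (t x : ℝ) :
    HasDerivAt (fun τ => u τ x) (bbmOp (BBM.flux u t) x) t := by
  have hw : WBdd ρ (BBM.flux u) := Reg.flux (n := 0) hρ hu.wBdd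
  exact ((hasDerivAt_timeInt_time (hw.bbmOp hρ) t x).const_add (u₀ x)).congr_of_eventuallyEq
    (Eventually.of_forall fun τ => hu.eq_flux τ x)

lemma hasDerivAt_bbmOp_space (hρ : IsWeight ρ) {w : ℝ → ℝ → ℝ} (hw : WBdd ρ w) (t x : ℝ) :
    HasDerivAt (bbmOp (w t)) (w t x - resolvent (w t) x) x := by
  obtain ⟨C, -, hC⟩ := hw.exists_bound hρ |t|
  exact hasDerivAt_bbmOp (hw.cont_space t) (fun r => hC t r le_rfl) x

lemma hasDerivAt_resolvent_space (hρ : IsWeight ρ) {w : ℝ → ℝ → ℝ} (hw : WBdd ρ w) (t x : ℝ) :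
    HasDerivAt (resolvent (w t)) (-bbmOp (w t) x) x := by
  obtain ⟨C, -, hC⟩ := hw.exists_bound hρ |t|
  exact hasDerivAt_resolvent (hw.cont_space t) (fun r => hC t r le_rfl) x

/-- The space derivative of a mild solution. -/
lemma IsMild.hasDerivAt_space (hρ : IsWeight ρ) (hu : IsMild ρ u₀ u)
    (h₀ : ContDiff ℝ ∞ u₀) (t x : ℝ) :
    HasDerivAt (u t)
      (deriv u₀ x + timeInt (fun τ x => BBM.flux u τ x - resolvent (BBM.flux u τ) x) t x) x := by
  have hw : WBdd ρ (BBM.flux u) := Reg.flux (n := 0) hρ hu.wBdd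
  have hz : WBdd ρ (fun τ x => BBM.flux u τ x - resolvent (BBM.flux u τ) x) :=
    Reg.sub (n := 0) hw (Reg.resolvent (n := 0) hρ hw)
  exact (((h₀.differentiable (by simp)) x).hasDerivAt.add
    (hasDerivAt_timeInt_space hρ (hw.bbmOp hρ) hz (hasDerivAt_bbmOp_space hρ hw) t x)
    ).congr_of_eventuallyEq (Eventually.of_forall fun x => hu.eq_flux t x)

/-- Since `bbmOp` gains a derivative, a mild solution is as regular as its initial value. -/
lemma IsMild.reg (hρ : IsWeight ρ) (hu : IsMild ρ u₀ u) (h₀ : ContDiff ℝ ∞ u₀)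
    (hb : ∀ k, ∃ C, 0 ≤ C ∧ ∀ x, |iteratedDeriv k u₀ x| ≤ C * ρ x) (n : ℕ) : Reg ρ n u := by
  induction n with
  | zero => exact hu.wBdd
  | succ n ih =>
    have hw : Reg ρ n (BBM.flux u) := ih.flux hρ
    have h1 : Reg ρ n (fun _ => deriv u₀) := by
      have hd : ContDiff ℝ ∞ (deriv u₀) := ContDiff.iterate_deriv 1 h₀
      refine Reg.of_space hd (fun k => ?_) n
      simpa only [iteratedDeriv_succ'] using hb (k + 1)
    exact ⟨hu.wBdd, _, _, hu.hasDerivAt_time hρ, hu.hasDerivAt_space hρ h₀, hw.bbmOp hρ,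
      h1.add ((hw.sub (hw.resolvent hρ)).timeInt hρ)⟩

/-- Mild solutions with smooth initial values are classical solutions. -/
theorem IsMild.isSmoothSolution (hρ : IsWeight ρ) (hu : IsMild ρ u₀ u) (h₀ : ContDiff ℝ ∞ u₀)
    (hb : ∀ k, ∃ C, 0 ≤ C ∧ ∀ x, |iteratedDeriv k u₀ x| ≤ C * ρ x) : IsSmoothSolution u := by
  have hreg := hu.reg hρ h₀ hb
  refine ⟨(contDiff_infty.2 fun n => (hreg n).contDiff).contDiffOn, fun t _ x => ?_⟩
  have hw : WBdd ρ (BBM.flux u) := (Reg.flux hρ (hreg 0))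
  obtain ⟨ux, hux, -⟩ := (hreg 1).exists_hasDerivAt_space
  have hwx : ∀ t x, HasDerivAt (BBM.flux u t) (ux t x + u t x * ux t x) x := fun t x => by
    refine ((hux t x).add (((hux t x).pow 2).div_const 2)).congr_deriv ?_
    simp; ring
  have hzx : ∀ t x, HasDerivAt (fun x => BBM.flux u t x - resolvent (BBM.flux u t) x)
      (ux t x + u t x * ux t x + bbmOp (BBM.flux u t) x) x := fun t x =>
    ((hwx t x).sub (hasDerivAt_resolvent_space hρ hw t x)).congr_deriv (by ring)
  have hz : WBdd ρ (fun τ x => BBM.flux u τ x - resolvent (BBM.flux u τ) x) :=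
    Reg.sub (n := 0) hw (Reg.resolvent (n := 0) hρ hw)
  have hz' : WBdd ρ (fun t x => ux t x + u t x * ux t x + bbmOp (BBM.flux u t) x) := by
    obtain ⟨zx, h1, h2⟩ := (Reg.sub (Reg.flux hρ (hreg 1))
      (Reg.resolvent hρ (Reg.flux hρ (hreg 1)))).exists_hasDerivAt_space
    have : zx = fun t x => ux t x + u t x * ux t x + bbmOp (BBM.flux u t) x := by
      funext t x
      exact (h1 t x).unique (hzx t x)
    exact this ▸ h2.wBdd
  have hd : ContDiff ℝ ∞ (deriv u₀) := ContDiff.iterate_deriv 1 h₀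
  have h2 : ∀ τ, iteratedDeriv 2 (fun y => u τ y) x = deriv (deriv u₀) x
      + timeInt (fun t x => ux t x + u t x * ux t x + bbmOp (BBM.flux u t) x) τ x := by
    intro τ
    have e : deriv (fun y => u τ y) = fun x => deriv u₀ x
        + timeInt (fun τ x => BBM.flux u τ x - resolvent (BBM.flux u τ) x) τ x := by
      funext x
      exact (hu.hasDerivAt_space hρ h₀ τ x).deriv
    rw [iteratedDeriv_succ, iteratedDeriv_one, e]
    exact ((hd.differentiable (by simp) x).hasDerivAt.add
      (hasDerivAt_timeInt_space hρ hz hz' hzx τ x)).deriv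
  have h3 := (hasDerivAt_timeInt_time hz' t x).const_add (deriv (deriv u₀) x)
  have h4 : HasDerivAt (fun y => u t y ^ 2) (2 * u t x * ux t x) x :=
    ((hux t x).pow 2).congr_deriv (by simp)
  rw [(hu.hasDerivAt_time hρ t x).deriv, funext h2, h3.deriv, h4.deriv,
    show deriv (fun y => u t y) x = ux t x from (hux t x).deriv]
  ring

/-! ### The solution for short times -/

lemma IsMild.sub_eq_integral (hρ : IsWeight ρ) (hu : IsMild ρ u₀ u) (s t x : ℝ) :
    u t x - u s x = ∫ τ in s..t, bbmOp (BBM.flux u τ) x := by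
  have hw : WBdd ρ (BBM.flux u) := Reg.flux (n := 0) hρ hu.wBdd
  exact (intervalIntegral.integral_eq_sub_of_hasDerivAt
    (fun τ _ => hu.hasDerivAt_time hρ τ x)
    (((hw.bbmOp hρ).cont_time x).intervalIntegrable _ _)).symm

lemma abs_bbmOp_le_const {g : ℝ → ℝ} {C : ℝ} (hg : ∀ y, |g y| ≤ C) (x : ℝ) :
    |bbmOp g x| ≤ 2 * C := by
  simpa using abs_bbmOp_le isWeight_one (C := C) (fun y => by simpa using hg y) x

lemma abs_flux_le {D t x : ℝ} (hD : 1 ≤ D) (h : |u t x| ≤ 2 * D) :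
    |BBM.flux u t x| ≤ 4 * D ^ 2 := by
  have h1 : u t x ^ 2 ≤ (2 * D) ^ 2 := by rw [← sq_abs]; gcongr
  rw [BBM.flux]
  refine (abs_add_le _ _).trans ?_
  rw [abs_of_nonneg (a := u t x ^ 2 / 2) (by positivity)]
  nlinarith

lemma IsMild.abs_sub_le_of_bound (hρ : IsWeight ρ) (hu : IsMild ρ u₀ u) {D t : ℝ} (hD : 1 ≤ D)
    (ht : 0 ≤ t) (h : ∀ τ x, 0 ≤ τ → τ ≤ t → |u τ x| ≤ 2 * D) (x : ℝ) :
    |u t x - u₀ x| ≤ 8 * D ^ 2 * t := by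
  have h1 := intervalIntegral.norm_integral_le_of_norm_le_const (a := 0) (b := t)
    (f := fun τ => bbmOp (BBM.flux u τ) x) (C := 2 * (4 * D ^ 2)) fun τ hτ => by
      rw [uIoc_of_le ht] at hτ
      exact abs_bbmOp_le_const (fun y => abs_flux_le hD (h τ y hτ.1.le hτ.2)) x
  rw [← hu.sub_eq_integral hρ, hu.zero, sub_zero, abs_of_nonneg ht] at h1
  exact h1.trans (le_of_eq (by ring))

/-- In sup norm the solution at most doubles up to a time inversely proportional to the size of the
initial value. -/
lemma IsMild.abs_le_short_time (hρ : IsWeight ρ) (hu : IsMild ρ u₀ u) {D : ℝ} (hD : 1 ≤ D)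
    (h₀ : ∀ x, |u₀ x| ≤ D) {t : ℝ} (ht : 0 ≤ t) (htD : t * (16 * D) ≤ 1) (x : ℝ) :
    |u t x| ≤ 2 * D := by
  have hw : WBdd ρ (BBM.flux u) := Reg.flux (n := 0) hρ hu.wBdd
  obtain ⟨C, hC, hCb⟩ := (hw.bbmOp hρ).exists_bound hρ 1
  set h : ℝ := D / (2 * (C + 1)) with hh
  have hpos : 0 < h := by positivity
  have hCh : C * h ≤ D / 2 := by
    rw [hh, ← mul_div_assoc, div_le_div_iff₀ (by positivity) two_pos]
    nlinarith
  -- continuous induction, in steps of length `h`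
  have key : ∀ n : ℕ, ∀ t, 0 ≤ t → t * (16 * D) ≤ 1 → t ≤ n * h → ∀ x, |u t x| ≤ 2 * D := by
    intro n
    induction n with
    | zero =>
      intro t ht _ htn x
      have : t = 0 := le_antisymm (by simpa using htn) ht
      rw [this, hu.zero]
      linarith [h₀ x]
    | succ n ih =>
      intro t ht htD htn x
      have ht1 : t ≤ 1 := by nlinarith
      set s : ℝ := max (t - h) 0 with hs
      have hs0 : 0 ≤ s := le_max_right _ _
      have hst : s ≤ t := max_le (by linarith) ht
      have hsn : s ≤ n * h := max_le (by push_cast at htn; linarith) (by positivity)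
      have h1 := hu.abs_sub_le_of_bound hρ hD hs0 (fun τ y h0 hτ => ih τ h0
        (le_trans (by gcongr; linarith) htD) (hτ.trans hsn) y) x
      have h2 : 8 * D ^ 2 * s ≤ D / 2 := by nlinarith
      have h3 := intervalIntegral.norm_integral_le_of_norm_le_const (a := s) (b := t)
        (f := fun τ => bbmOp (BBM.flux u τ) x) (C := C) fun τ hτ => by
          rw [uIoc_of_le hst] at hτ
          exact hCb τ x (abs_le.2 ⟨by linarith [hτ.1], by linarith [hτ.2]⟩)
      rw [← hu.sub_eq_integral hρ, abs_of_nonneg (by linarith)] at h3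
      have h4 : C * (t - s) ≤ C * h := by
        gcongr
        linarith [le_max_left (t - h) 0]
      have h5 := h₀ x
      rw [Real.norm_eq_abs] at h3
      rw [abs_le] at *
      constructor <;> linarith [h1.1, h1.2, h3.1, h3.2, h5.1, h5.2]
  obtain ⟨n, hn⟩ := exists_nat_ge (t / h)
  exact key n t ht htD ((div_le_iff₀ hpos).1 hn) x

/-- First-order expansion in time: the quadratic remainder carries three powers of the
amplitude. -/
lemma IsMild.abs_sub_first_order_le (hρ : IsWeight ρ) (hu : IsMild ρ u₀ u) {D : ℝ} (hD : 1 ≤ D)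
    (h₀ : ∀ x, |u₀ x| ≤ D) {t : ℝ} (ht : 0 ≤ t) (htD : t * (16 * D) ≤ 1) (x : ℝ) :
    |u t x - u₀ x - t * bbmOp (fun x => u₀ x + u₀ x ^ 2 / 2) x| ≤ 40 * D ^ 3 * t ^ 2 := by
  have hw : WBdd ρ (BBM.flux u) := Reg.flux (n := 0) hρ hu.wBdd
  have hflux0 : (fun x => u₀ x + u₀ x ^ 2 / 2) = BBM.flux u 0 := by
    funext x; rw [BBM.flux, hu.zero]
  have hb : ∀ τ x, 0 ≤ τ → τ ≤ t → |u τ x| ≤ 2 * D := fun τ x h0 hτ =>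
    hu.abs_le_short_time hρ hD h₀ h0 (le_trans (by gcongr) htD) x
  have e : u t x - u₀ x - t * bbmOp (BBM.flux u 0) x
      = ∫ τ in (0 : ℝ)..t, (bbmOp (BBM.flux u τ) x - bbmOp (BBM.flux u 0) x) := by
    rw [intervalIntegral.integral_sub (((hw.bbmOp hρ).cont_time x).intervalIntegrable _ _)
      intervalIntegrable_const, ← hu.sub_eq_integral hρ, hu.zero, intervalIntegral.integral_const,
      sub_zero, smul_eq_mul]
  have h1 := intervalIntegral.norm_integral_le_of_norm_le_const (a := 0) (b := t)
    (f := fun τ => bbmOp (BBM.flux u τ) x - bbmOp (BBM.flux u 0) x)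
    (C := 2 * (20 * D ^ 3 * t)) fun τ hτ => by
      rw [uIoc_of_le ht] at hτ
      obtain ⟨A, -, hA⟩ := hw.exists_bound hρ |τ|
      have hs := bbmOp_sub (hw.cont_space τ) (hw.cont_space 0) (fun y => hA τ y le_rfl)
        (fun y => hA 0 y (by simp)) x
      rw [Real.norm_eq_abs, ← hs]
      refine abs_bbmOp_le_const (fun y => ?_) x
      have h2 := hu.abs_sub_le_of_bound hρ hD hτ.1.le (fun σ z h0 hσ => hb σ z h0 (hσ.trans hτ.2)) y
      have h3 := hb τ y hτ.1.le hτ.2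
      have h4 := h₀ y
      have h5 : BBM.flux u τ y - BBM.flux u 0 y = (u τ y - u₀ y) * (1 + (u τ y + u₀ y) / 2) := by
        rw [BBM.flux, BBM.flux, hu.zero]; ring
      have h6 : |1 + (u τ y + u₀ y) / 2| ≤ 5 / 2 * D := by
        rw [abs_le] at *
        constructor <;> linarith [h3.1, h3.2, h4.1, h4.2]
      rw [h5, abs_mul]
      have := hτ.1.le
      calc _ ≤ 8 * D ^ 2 * τ * (5 / 2 * D) := by gcongr
        _ = 20 * D ^ 3 * τ := by ring
        _ ≤ 20 * D ^ 3 * t := by gcongr; exact hτ.2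
  rw [hflux0, e]
  rw [sub_zero, abs_of_nonneg ht] at h1
  exact h1.trans (le_of_eq (by ring))

end Mild

/-! ### High-frequency data produce a large low-frequency output -/

/-- The Riemann–Lebesgue lemma on an interval. -/
lemma tendsto_integral_mul_cos {h : ℝ → ℝ} (hc : Continuous h) (a b : ℝ) {k : ℝ} (hk : 0 < k) :
    Tendsto (fun N : ℕ => ∫ x in a..b, h x * Real.cos (k * N * x)) atTop (𝓝 0) := by
  wlog hab : a ≤ b generalizing a b
  · have := (this b a (by linarith)).neg
    rw [neg_zero] at this
    refine this.congr fun N => ?_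
    rw [intervalIntegral.integral_symm, neg_neg]
  have h1 := Real.tendsto_integral_exp_smul_cocompact
    (fun x => (indicator (Ioc a b) (fun x => (h x : ℂ)) x))
  have h2 : Tendsto (fun N : ℕ => k * N / (2 * π)) atTop (cocompact ℝ) := by
    refine Tendsto.mono_right ?_ atTop_le_cocompact
    exact (tendsto_natCast_atTop_atTop.const_mul_atTop hk).atTop_div_const (by positivity)
  have h3 := (Complex.continuous_re.tendsto 0).comp (h1.comp h2)
  rw [Complex.zero_re] at h3
  refine h3.congr fun N => ?_
  have hp := Real.pi_pos
  have e : ∀ x : ℝ, Real.fourierChar (-(x * (k * N / (2 * π)))) • (indicator (Ioc a b) (fun x => (h x : ℂ)) x)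
      = indicator (Ioc a b) (fun x => Complex.exp (((-(k * N * x) : ℝ) : ℂ) * Complex.I) * (h x : ℂ)) x := by
    intro x
    by_cases hx : x ∈ Ioc a b
    · rw [indicator_of_mem hx, indicator_of_mem hx, Circle.smul_def, Real.fourierChar_apply, smul_eq_mul]
      congr 4
      field_simp
    · rw [indicator_of_notMem hx, indicator_of_notMem hx, smul_zero]
  simp only [Function.comp_apply, e]
  rw [integral_indicator measurableSet_Ioc, intervalIntegral.integral_of_le hab]
  have hint : IntegrableOn (fun x => Complex.exp (((-(k * N * x) : ℝ) : ℂ) * Complex.I) * (h x : ℂ))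
      (Ioc a b) := by
    refine (Continuous.integrableOn_Icc ?_).mono_set Ioc_subset_Icc_self
    fun_prop
  rw [show Complex.re (∫ x in Ioc a b, Complex.exp (((-(k * N * x) : ℝ) : ℂ) * Complex.I) * (h x : ℂ))
    = _ from (integral_re hint).symm]
  refine integral_congr_ae (Eventually.of_forall fun x => ?_)
  simp only [RCLike.re_eq_complex_re, Complex.re_mul_ofReal, Complex.exp_ofReal_mul_I_re, Real.cos_neg]
  ring

lemma exists_abs_integral_mul_cos_le {h : ℝ → ℝ} (hc : Continuous h) (a b : ℝ) {k δ : ℝ}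
    (hk : 0 < k) (hδ : 0 < δ) :
    ∀ᶠ N : ℕ in atTop, |∫ x in a..b, h x * Real.cos (k * N * x)| ≤ δ := by
  have := (tendsto_integral_mul_cos hc a b hk).abs
  rw [abs_zero] at this
  exact (this.eventually (gt_mem_nhds hδ)).mono fun N hN => hN.le

/-- Integration by parts: `bbmOp = -∂ₓ(1 - ∂ₓ²)⁻¹` tested against `(1 - ∂ₓ²)θ`. -/
lemma integral_bbmOp_mul {w θ θ' θ'' : ℝ → ℝ} (hw : Continuous w) {C : ℝ} (hC : ∀ x, |w x| ≤ C)
    (hθ : ∀ x, HasDerivAt θ (θ' x) x) (hθ' : ∀ x, HasDerivAt θ' (θ'' x) x) (hθc : Continuous θ'')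
    {a b : ℝ} (hab : bbmOp w a * θ' a + resolvent w a * θ a = bbmOp w b * θ' b + resolvent w b * θ b) :
    ∫ x in a..b, bbmOp w x * (θ x - θ'' x) = ∫ x in a..b, w x * θ' x := by
  have c1 : Continuous θ := continuous_iff_continuousAt.2 fun x => (hθ x).continuousAt
  have c2 : Continuous θ' := continuous_iff_continuousAt.2 fun x => (hθ' x).continuousAt
  have hK := hasDerivAt_bbmOp hw hC
  have hG := hasDerivAt_resolvent hw hC
  have c3 : Continuous (bbmOp w) := continuous_iff_continuousAt.2 fun x => (hK x).continuousAt
  have hd : ∀ x, HasDerivAt (fun x => bbmOp w x * θ' x + resolvent w x * θ x)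
      (w x * θ' x - bbmOp w x * (θ x - θ'' x)) x := fun x =>
    (((hK x).mul (hθ' x)).add ((hG x).mul (hθ x))).congr_deriv (by ring)
  have h1 := intervalIntegral.integral_eq_sub_of_hasDerivAt (a := a) (b := b) (fun x _ => hd x)
    (Continuous.intervalIntegrable (by fun_prop) _ _)
  rw [intervalIntegral.integral_sub (Continuous.intervalIntegrable (by fun_prop) _ _)
    (Continuous.intervalIntegrable (by fun_prop) _ _)] at h1
  linarith

/-- The initial values: a profile `φ` perturbed by a large multiple of a modulated profile `g`. -/
def inflData (φ g : ℝ → ℝ) (B : ℝ) (N : ℕ) (x : ℝ) : ℝ := φ x + B ^ 2 * (g x * Real.cos (N * x))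

/-- The arithmetic of `pairing_lower_bound`: `P` is the pairing with `u(t)`, the `J`'s are the
pairings with `u(0)` and with oscillating terms, the `I`'s are fixed, `K` bounds the remainder. -/
lemma main_term_le {t B c J₀ J₁ J₂ J₃ I₁ I₂ S K P : ℝ} (ht : 0 < t) (ht1 : t ≤ 1)
    (hBt : t * B ^ 3 = 1) (h0 : |t * J₀| ≤ S) (h1 : |B ^ 2 * J₁| ≤ 1) (h2 : |B ^ 2 * J₂| ≤ 1)
    (h3 : |B ^ 4 / 4 * J₃| ≤ 1)
    (h : -K ≤ P - (I₁ + B ^ 2 * J₁)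
      - t * (J₀ + I₂ / 2 + B ^ 2 * J₂ + B ^ 4 / 4 * c + B ^ 4 / 4 * J₃)) :
    B * c / 4 - (K + |I₁| + 1 + S + |I₂| + 1 + 1) ≤ P := by
  have tmul : ∀ r s : ℝ, |r| ≤ s → -s ≤ t * r := fun r s hr => by
    have hs : 0 ≤ s := (abs_nonneg _).trans hr
    have := neg_le_of_abs_le hr
    nlinarith
  have b2 : t * (B ^ 4 / 4 * c) = B * c / 4 := by
    calc _ = t * B ^ 3 * (B * c / 4) := by ring
      _ = _ := by rw [hBt, one_mul]
  have b3 : t * (J₀ + I₂ / 2 + B ^ 2 * J₂ + B ^ 4 / 4 * c + B ^ 4 / 4 * J₃)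
      = t * J₀ + t * (I₂ / 2) + t * (B ^ 2 * J₂) + t * (B ^ 4 / 4 * c) + t * (B ^ 4 / 4 * J₃) := by
    ring
  have b4 : -|I₂| ≤ t * (I₂ / 2) := tmul _ _ (by
    rw [abs_div, abs_two]; linarith [abs_nonneg I₂])
  have b5 := tmul _ _ h2
  have b6 := tmul _ _ h3
  have b7 := neg_le_of_abs_le h0
  have b8 := neg_le_of_abs_le h1
  have b9 := neg_abs_le I₁
  rw [b3, b2] at h
  linarith

/-- With amplitude `B²` at frequency `N ≫ 1`, the solution at time `t = B⁻³` has size `≳ B` when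
tested against `(1 - ∂ₓ²)θ`: the quadratic interaction contributes `t (B²)² / 4 = B / 4` times
`∫ g² θ'`, while everything else stays bounded. -/
lemma pairing_lower_bound {φ g θ θ' θ'' : ℝ → ℝ} (hφ : Continuous φ) (hg : Continuous g)
    {Cφ Cg m : ℝ} (hφb : ∀ x, |φ x| ≤ Cφ) (hgb : ∀ x, |g x| ≤ Cg) (hm : m = Cφ + Cg + 1)
    (c1 : Continuous θ) (c2 : Continuous θ') (hθc : Continuous θ'') {a b : ℝ} (hab : a ≤ b)
    {B t : ℝ} (hB0 : 1 ≤ B) (hB1 : 16 * m ≤ B) (htp : 0 < t) (ht1 : t ≤ 1) (hBt : t * B ^ 3 = 1)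
    {N : ℕ}
    (hparts : ∫ x in a..b, bbmOp (fun y => inflData φ g B N y + inflData φ g B N y ^ 2 / 2) x
      * (θ x - θ'' x) = ∫ x in a..b, (inflData φ g B N x + inflData φ g B N x ^ 2 / 2) * θ' x)
    (h1 : |∫ x in a..b, g x * (θ x - θ'' x) * Real.cos (1 * N * x)| ≤ 1 / B ^ 2)
    (h2 : |∫ x in a..b, φ x * g x * θ' x * Real.cos (1 * N * x)| ≤ 1 / B ^ 2)
    (h3 : |∫ x in a..b, g x ^ 2 * θ' x * Real.cos (2 * N * x)| ≤ 1 / B ^ 4)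
    {ρ : ℝ → ℝ} {u : ℝ → ℝ → ℝ} (hρ : IsWeight ρ) (hu : IsMild ρ (inflData φ g B N) u) :
    B * (∫ x in a..b, g x ^ 2 * θ' x) / 4 -
      (40 * m ^ 3 * (∫ x in a..b, |θ x - θ'' x|) + |∫ x in a..b, φ x * (θ x - θ'' x)| + 1
        + m * (∫ x in a..b, |θ' x|) + |∫ x in a..b, φ x ^ 2 * θ' x| + 1 + 1)
      ≤ ∫ x in a..b, u t x * (θ x - θ'' x) := by
  set ψ : ℝ → ℝ := fun x => θ x - θ'' x with hψ
  have cψ : Continuous ψ := by fun_prop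
  have hCφ : 0 ≤ Cφ := (abs_nonneg _).trans (hφb 0)
  have hCg : 0 ≤ Cg := (abs_nonneg _).trans (hgb 0)
  have hm1 : 1 ≤ m := by linarith
  have hBp : 0 < B := by linarith
  obtain ⟨c, hc⟩ : ∃ r : ℝ, r = ∫ x in a..b, g x ^ 2 * θ' x := ⟨_, rfl⟩
  obtain ⟨Iψ, hIψ⟩ : ∃ r : ℝ, r = ∫ x in a..b, |ψ x| := ⟨_, rfl⟩
  obtain ⟨Iθ, hIθ⟩ : ∃ r : ℝ, r = ∫ x in a..b, |θ' x| := ⟨_, rfl⟩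
  have hIθ0 : 0 ≤ Iθ := hIθ ▸ intervalIntegral.integral_nonneg hab fun _ _ => abs_nonneg _
  obtain ⟨I₁, hI₁⟩ : ∃ r : ℝ, r = ∫ x in a..b, φ x * ψ x := ⟨_, rfl⟩
  obtain ⟨I₂, hI₂⟩ : ∃ r : ℝ, r = ∫ x in a..b, φ x ^ 2 * θ' x := ⟨_, rfl⟩
  rw [← hc, ← hIψ, ← hIθ, ← hI₁, ← hI₂]
  set u₀ := inflData φ g B N with hu₀
  have hu₀c : Continuous u₀ := by
    have : u₀ = fun x => φ x + B ^ 2 * (g x * Real.cos (N * x)) := rfl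
    rw [this]; fun_prop
  obtain ⟨D, hD⟩ : ∃ r : ℝ, r = m * B ^ 2 := ⟨_, rfl⟩
  have hB2' : 1 ≤ B ^ 2 := one_le_pow₀ hB0
  have hD1 : 1 ≤ D := by nlinarith
  have hu₀b : ∀ x, |u₀ x| ≤ D := by
    intro x
    have e1 : |g x * Real.cos (N * x)| ≤ Cg := by
      rw [abs_mul]
      calc _ ≤ Cg * 1 := mul_le_mul (hgb x) (Real.abs_cos_le_one _) (abs_nonneg _) hCg
        _ = Cg := mul_one _
    calc |u₀ x| ≤ |φ x| + |B ^ 2 * (g x * Real.cos (N * x))| := abs_add_le _ _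
      _ ≤ Cφ + B ^ 2 * Cg := by
        rw [abs_mul, abs_of_nonneg (by positivity : (0 : ℝ) ≤ B ^ 2)]
        gcongr
        exact hφb x
      _ ≤ D := by nlinarith
  -- `t` lies in the range of the short-time expansion because `B ≥ 16 * m`
  have htD : t * (16 * D) ≤ 1 := by
    have : t * (16 * D) * B = 16 * m := by
      calc _ = 16 * m * (t * B ^ 3) := by rw [hD]; ring
        _ = 16 * m := by rw [hBt, mul_one]
    nlinarith
  have hfirst := hu.abs_sub_first_order_le hρ hD1 hu₀b htp.le htD
  set w₀ : ℝ → ℝ := fun x => u₀ x + u₀ x ^ 2 / 2 with hw₀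
  have hw₀c : Continuous w₀ := by fun_prop
  have hw₀b : ∀ x, |w₀ x| ≤ D + D ^ 2 / 2 := fun x => by
    have e1 : u₀ x ^ 2 ≤ D ^ 2 := by
      rw [← sq_abs]; have := hu₀b x; gcongr
    refine (abs_add_le _ _).trans ?_
    rw [abs_of_nonneg (a := u₀ x ^ 2 / 2) (by positivity)]
    linarith [hu₀b x]
  have hKc : Continuous (bbmOp w₀) :=
    continuous_iff_continuousAt.2 fun x => (hasDerivAt_bbmOp hw₀c hw₀b x).continuousAt
  have huc : Continuous (u t) := hu.wBdd.cont_space t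
  have ii : ∀ {f : ℝ → ℝ}, Continuous f → IntervalIntegrable f volume a b := fun hf =>
    hf.intervalIntegrable _ _
  -- the remainder of the expansion in time contributes `O(1)`
  have k1 : |∫ x in a..b, (u t x - u₀ x - t * bbmOp w₀ x) * ψ x| ≤ 40 * m ^ 3 * Iψ := by
    have hbd : 40 * D ^ 3 * t ^ 2 = 40 * m ^ 3 := by
      calc _ = 40 * m ^ 3 * (t * B ^ 3) ^ 2 := by rw [hD]; ring
        _ = _ := by rw [hBt]; ring
    rw [hIψ, ← intervalIntegral.integral_const_mul]
    refine intervalIntegral.norm_integral_le_of_norm_le hab (f := fun x => (u t x - u₀ x - t * bbmOp w₀ x) * ψ x)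
      (Eventually.of_forall fun x _ => ?_)
      (ii (by fun_prop))
    rw [norm_mul, ← hbd]
    exact mul_le_mul_of_nonneg_right (hfirst x) (norm_nonneg _)
  have k2 : ∫ x in a..b, (u t x - u₀ x - t * bbmOp w₀ x) * ψ x
      = (∫ x in a..b, u t x * ψ x) - (∫ x in a..b, u₀ x * ψ x) - t * ∫ x in a..b, w₀ x * θ' x := by
    rw [← hparts, ← intervalIntegral.integral_const_mul, ← intervalIntegral.integral_sub
      (ii (by fun_prop)) (ii (by fun_prop)), ← intervalIntegral.integral_sub (ii (by fun_prop))
      (ii (by fun_prop))]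
    refine intervalIntegral.integral_congr fun x _ => ?_
    ring
  have k3 : ∫ x in a..b, u₀ x * ψ x
      = I₁ + B ^ 2 * ∫ x in a..b, g x * ψ x * Real.cos (1 * N * x) := by
    rw [hI₁, ← intervalIntegral.integral_const_mul, ← intervalIntegral.integral_add
      (ii (by fun_prop)) (ii (by fun_prop))]
    refine intervalIntegral.integral_congr fun x _ => ?_
    simp only [hu₀, inflData, one_mul]
    ring
  -- `cos² = (1 + cos(2 ·)) / 2` splits the square of the perturbation into its low-frequency part,
  -- the source of the growth, and an oscillating one
  have k4 : ∫ x in a..b, w₀ x * θ' x = (∫ x in a..b, u₀ x * θ' x) + I₂ / 2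
      + B ^ 2 * (∫ x in a..b, φ x * g x * θ' x * Real.cos (1 * N * x))
      + B ^ 4 / 4 * c + B ^ 4 / 4 * ∫ x in a..b, g x ^ 2 * θ' x * Real.cos (2 * N * x) := by
    rw [hI₂, hc, ← intervalIntegral.integral_const_mul, ← intervalIntegral.integral_const_mul,
      ← intervalIntegral.integral_const_mul, ← intervalIntegral.integral_div,
      ← intervalIntegral.integral_add (ii (by fun_prop)) (ii (by fun_prop)),
      ← intervalIntegral.integral_add (ii (by fun_prop)) (ii (by fun_prop)),
      ← intervalIntegral.integral_add (ii (by fun_prop)) (ii (by fun_prop)),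
      ← intervalIntegral.integral_add (ii (by fun_prop)) (ii (by fun_prop))]
    refine intervalIntegral.integral_congr fun x _ => ?_
    have : Real.cos (2 * N * x) = 2 * Real.cos (N * x) ^ 2 - 1 := by
      rw [← Real.cos_two_mul]; congr 1; ring
    simp only [hw₀, hu₀, inflData, one_mul, this]
    ring
  have k5 : |∫ x in a..b, u₀ x * θ' x| ≤ D * Iθ := by
    rw [hIθ, ← intervalIntegral.integral_const_mul]
    refine intervalIntegral.norm_integral_le_of_norm_le hab (f := fun x => u₀ x * θ' x)
      (Eventually.of_forall fun x _ => ?_) (ii (by fun_prop))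
    rw [norm_mul]
    exact mul_le_mul_of_nonneg_right (hu₀b x) (norm_nonneg _)
  have b1 := neg_le_of_abs_le k1
  rw [k2, k3, k4] at b1
  refine main_term_le htp ht1 hBt ?_ ?_ ?_ ?_ b1
  · rw [abs_mul, abs_of_pos htp]
    have e1 : t * B ^ 2 * B = 1 := by rw [← hBt]; ring
    have e2 : 0 ≤ t * B ^ 2 := by positivity
    have e3 : t * B ^ 2 ≤ 1 := by nlinarith
    calc _ ≤ t * (D * Iθ) := by gcongr
      _ = t * B ^ 2 * (m * Iθ) := by rw [hD]; ring
      _ ≤ 1 * (m * Iθ) := by gcongr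
      _ = m * Iθ := one_mul _
  · rw [abs_mul, abs_of_nonneg (by positivity : (0 : ℝ) ≤ B ^ 2)]
    calc _ ≤ B ^ 2 * (1 / B ^ 2) := by gcongr
      _ = 1 := by field_simp
  · rw [abs_mul, abs_of_nonneg (by positivity : (0 : ℝ) ≤ B ^ 2)]
    calc _ ≤ B ^ 2 * (1 / B ^ 2) := by gcongr
      _ = 1 := by field_simp
  · rw [abs_mul, abs_of_nonneg (by positivity : (0 : ℝ) ≤ B ^ 4 / 4)]
    calc _ ≤ B ^ 4 / 4 * (1 / B ^ 4) := by gcongr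
      _ = 1 / 4 := by field_simp
      _ ≤ 1 := by norm_num

/-- The solution with initial value `inflData φ g B N` becomes large, when tested against a fixed
function, within an arbitrarily short time. -/
theorem exists_large_pairing {φ g θ θ' θ'' : ℝ → ℝ} (hφ : Continuous φ) (hg : Continuous g)
    {Cφ Cg : ℝ} (hφb : ∀ x, |φ x| ≤ Cφ) (hgb : ∀ x, |g x| ≤ Cg)
    (hθ : ∀ x, HasDerivAt θ (θ' x) x) (hθ' : ∀ x, HasDerivAt θ' (θ'' x) x) (hθc : Continuous θ'')
    {a b : ℝ} (hab : a ≤ b) (hpos : 0 < ∫ x in a..b, g x ^ 2 * θ' x)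
    (hparts : ∀ B N, ∫ x in a..b, bbmOp (fun y => inflData φ g B N y + inflData φ g B N y ^ 2 / 2) x
      * (θ x - θ'' x) = ∫ x in a..b, (inflData φ g B N x + inflData φ g B N x ^ 2 / 2) * θ' x)
    {R ε : ℝ} (hε : 0 < ε) :
    ∃ B t : ℝ, 0 < t ∧ t < ε ∧ ∀ᶠ N : ℕ in atTop, ∀ ρ u, IsWeight ρ →
      IsMild ρ (inflData φ g B N) u → R < ∫ x in a..b, u t x * (θ x - θ'' x) := by
  have c1 : Continuous θ := continuous_iff_continuousAt.2 fun x => (hθ x).continuousAt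
  have c2 : Continuous θ' := continuous_iff_continuousAt.2 fun x => (hθ' x).continuousAt
  obtain ⟨m, hm⟩ : ∃ r : ℝ, r = Cφ + Cg + 1 := ⟨_, rfl⟩
  obtain ⟨E, hE⟩ : ∃ r : ℝ, r = 40 * m ^ 3 * (∫ x in a..b, |θ x - θ'' x|)
    + |∫ x in a..b, φ x * (θ x - θ'' x)| + 1 + m * (∫ x in a..b, |θ' x|)
    + |∫ x in a..b, φ x ^ 2 * θ' x| + 1 + 1 := ⟨_, rfl⟩
  obtain ⟨c, hc⟩ : ∃ r : ℝ, r = ∫ x in a..b, g x ^ 2 * θ' x := ⟨_, rfl⟩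
  rw [← hc] at hpos
  obtain ⟨B, hB1, hB2, hB3, hB0⟩ : ∃ B : ℝ, 16 * m ≤ B ∧ 1 / ε + 1 ≤ B ∧
      4 * (|R| + E + 1) / c ≤ B ∧ 1 ≤ B :=
    ((eventually_ge_atTop _).and ((eventually_ge_atTop _).and ((eventually_ge_atTop _).and
      (eventually_ge_atTop _)))).exists
  have hBp : 0 < B := by linarith
  obtain ⟨t, ht⟩ : ∃ r : ℝ, r = 1 / B ^ 3 := ⟨_, rfl⟩
  have htp : 0 < t := by rw [ht]; positivity
  have ht1 : t ≤ 1 / B := by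
    rw [ht]
    exact one_div_le_one_div_of_le hBp (le_self_pow₀ hB0 (by norm_num))
  have ht2 : t ≤ 1 := ht1.trans ((div_le_one hBp).2 hB0)
  have htε : t < ε := by
    refine ht1.trans_lt ?_
    rw [div_lt_iff₀ hBp]
    have : 1 / ε < B := by linarith
    rw [div_lt_iff₀ hε] at this
    linarith
  have hBt : t * B ^ 3 = 1 := by rw [ht]; field_simp
  refine ⟨B, t, htp, htε, ?_⟩
  have hδ1 : 0 < 1 / B ^ 2 := by positivity
  have hδ2 : 0 < 1 / B ^ 4 := by positivity
  have f1 := exists_abs_integral_mul_cos_le (h := fun x => g x * (θ x - θ'' x)) (by fun_prop) a b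
    one_pos hδ1
  have f2 := exists_abs_integral_mul_cos_le (h := fun x => φ x * g x * θ' x) (by fun_prop) a b
    one_pos hδ1
  have f3 := exists_abs_integral_mul_cos_le (h := fun x => g x ^ 2 * θ' x) (by fun_prop) a b
    two_pos hδ2
  filter_upwards [f1, f2, f3] with N h1 h2 h3 ρ u hρ hu
  have key := pairing_lower_bound hφ hg hφb hgb hm c1 c2 hθc hab hB0 hB1 htp ht2 hBt (hparts B N)
    h1 h2 h3 hρ hu
  rw [← hc, ← hE] at key
  rw [div_le_iff₀ hpos] at hB3
  linarith [le_abs_self R]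

/-! ### Sobolev norms and Fourier coefficients on the torus -/

lemma torusFourier_torusDist {f : ℝ → ℝ} (hf : Continuous f) (n : ℤ) :
    torusFourier (torusDist f) n
      = fourierCoeffOn (by positivity : (0 : ℝ) < 2 * π) (fun x => (f x : ℂ)) n := by
  have h : IntervalIntegrable f volume 0 (2 * π) := hf.intervalIntegrable _ _
  rw [fourierCoeffOn_eq_integral, torusFourier, torusDist, dif_pos h, sub_zero,
    ← Complex.real_smul]
  congr 1
  change ∫ x in (0 : ℝ)..(2 * π), (f x : ℂ) * (torusChar (-n) : ℝ → ℂ) x = _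
  refine intervalIntegral.integral_congr fun x _ => ?_
  simp only [fourier_coe_apply, torusChar, smul_eq_mul]
  rw [mul_comm]
  congr 2
  have : (π : ℂ) ≠ 0 := by exact_mod_cast Real.pi_ne_zero
  push_cast
  field_simp

lemma torusFourier_torusDist_eq_integral {f : ℝ → ℝ} (hf : Continuous f) (n : ℤ) :
    torusFourier (torusDist f) n = (1 / (2 * π) : ℝ) *
      ∫ x in (0 : ℝ)..(2 * π), (f x : ℂ) * Complex.exp (Complex.I * ((-n : ℤ) : ℂ) * x) := by
  have h : IntervalIntegrable f volume 0 (2 * π) := hf.intervalIntegrable _ _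
  rw [torusFourier, torusDist, dif_pos h]
  rfl

/-- The square of the `H^s(𝕋)` norm. -/
def torusSq (s : ℝ) (T : TorusDistribution) : ℝ≥0∞ :=
  ∑' n : ℤ, ENNReal.ofReal ((1 + (n : ℝ) ^ 2) ^ s * ‖torusFourier T n‖ ^ 2)

lemma torusSobolevNorm_lt {s ε : ℝ} (hε : 0 < ε) {T : TorusDistribution}
    (h : torusSq s T < ENNReal.ofReal (ε ^ 2)) : torusSobolevNorm s T < ENNReal.ofReal ε := by
  have h1 := ENNReal.rpow_lt_rpow h (z := 1 / 2) (by norm_num)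
  rwa [ENNReal.ofReal_rpow_of_nonneg (by positivity) (by norm_num), ← Real.sqrt_eq_rpow,
    Real.sqrt_sq hε.le] at h1

/-- A single Fourier coefficient bounds the norm from below. -/
lemma lt_torusSobolevNorm {s R : ℝ} (hR : 0 ≤ R) {T : TorusDistribution} (n : ℤ)
    (h : R ^ 2 < (1 + (n : ℝ) ^ 2) ^ s * ‖torusFourier T n‖ ^ 2) :
    ENNReal.ofReal R < torusSobolevNorm s T := by
  have h0 : ENNReal.ofReal (R ^ 2) < torusSq s T :=
    ((ENNReal.ofReal_lt_ofReal_iff_of_nonneg (by positivity)).2 h).trans_le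
      (ENNReal.le_tsum (f := fun n : ℤ =>
        ENNReal.ofReal ((1 + (n : ℝ) ^ 2) ^ s * ‖torusFourier T n‖ ^ 2)) n)
  have h1 := ENNReal.rpow_lt_rpow h0 (z := 1 / 2) (by norm_num)
  rwa [ENNReal.ofReal_rpow_of_nonneg (by positivity) (by norm_num), ← Real.sqrt_eq_rpow,
    Real.sqrt_sq hR] at h1

lemma one_add_sq_rpow_le_one {s : ℝ} (hs : s < 0) (n : ℝ) : (1 + n ^ 2) ^ s ≤ 1 :=
  Real.rpow_le_one_of_one_le_of_nonpos (by nlinarith [sq_nonneg n]) hs.le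

lemma torusSobolevNorm_torusDist_lt_top {s : ℝ} (hs : s < 0) {f : ℝ → ℝ} (hf : Continuous f) :
    torusSobolevNorm s (torusDist f) < ⊤ := by
  refine ENNReal.rpow_lt_top_of_nonneg (by norm_num) (ne_of_lt ?_)
  have hL2 : MemLp (fun x => (f x : ℂ)) 2 (volume.restrict (Ioc 0 (2 * π))) := by
    have hc : Continuous (fun x => (f x : ℂ)) := by fun_prop
    obtain ⟨C, hC⟩ := isCompact_Icc.exists_bound_of_continuousOn (s := Icc 0 (2 * π)) hc.continuousOn
    refine MemLp.of_bound hc.aestronglyMeasurable C ?_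
    exact (ae_restrict_iff' measurableSet_Ioc).2
      (Eventually.of_forall fun x hx => hC x (Ioc_subset_Icc_self hx))
  have hsum := (hasSum_sq_fourierCoeffOn (by positivity : (0 : ℝ) < 2 * π) hL2).summable
  refine lt_of_le_of_lt (ENNReal.tsum_le_tsum fun n => ?_)
    (lt_top_iff_ne_top.2 hsum.tsum_ofReal_ne_top)
  rw [torusFourier_torusDist hf]
  refine ENNReal.ofReal_le_ofReal ?_
  have := one_add_sq_rpow_le_one hs n
  exact mul_le_of_le_one_left (by positivity) this

/-! ### Trigonometric polynomials -/

/-- The real part of the trigonometric polynomial with coefficients `c` on `S`. -/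
def trigPoly (S : Finset ℤ) (c : ℤ → ℂ) (x : ℝ) : ℝ :=
  (∑ k ∈ S, c k * Complex.exp (Complex.I * k * x)).re

lemma contDiff_trigPoly (S : Finset ℤ) (c : ℤ → ℂ) : ContDiff ℝ ∞ (trigPoly S c) := by
  refine Complex.reCLM.contDiff.comp (ContDiff.sum fun k _ => ?_)
  exact contDiff_const.mul (contDiff_const.mul Complex.ofRealCLM.contDiff).cexp

lemma periodic_trigPoly (S : Finset ℤ) (c : ℤ → ℂ) : Function.Periodic (trigPoly S c) (2 * π) := by
  intro x
  simp only [trigPoly]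
  congr 1
  refine Finset.sum_congr rfl fun k _ => ?_
  have := (torusChar k).2.2 x
  exact congrArg _ this

lemma ofReal_trigPoly {S : Finset ℤ} (hS : ∀ k ∈ S, -k ∈ S) {c : ℤ → ℂ}
    (hc : ∀ k, c (-k) = starRingEnd ℂ (c k)) (x : ℝ) :
    (trigPoly S c x : ℂ) = ∑ k ∈ S, c k * Complex.exp (Complex.I * k * x) := by
  rw [trigPoly]
  refine Complex.conj_eq_iff_re.1 ?_
  rw [map_sum]
  refine Finset.sum_nbij' (fun k => -k) (fun k => -k) hS hS (fun _ _ => neg_neg _)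
    (fun _ _ => neg_neg _) fun k _ => ?_
  rw [map_mul, ← hc, ← Complex.exp_conj]
  congr 2
  simp

lemma integral_exp_int (m : ℤ) :
    ∫ x in (0 : ℝ)..(2 * π), Complex.exp (Complex.I * m * x) = if m = 0 then (2 * π : ℂ) else 0 := by
  split_ifs with h
  · simp [h]
  · have h1 : Complex.I * (m : ℂ) ≠ 0 := by simp [h]
    rw [integral_exp_mul_complex h1]
    have h2 := Complex.exp_int_mul_two_pi_mul_I m
    rw [show Complex.I * (m : ℂ) * ((2 * π : ℝ) : ℂ) = m * (2 * π * Complex.I) by push_cast; ring, h2]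
    simp

lemma torusFourier_trigPoly {S : Finset ℤ} (hS : ∀ k ∈ S, -k ∈ S) {c : ℤ → ℂ}
    (hc : ∀ k, c (-k) = starRingEnd ℂ (c k)) (n : ℤ) :
    torusFourier (torusDist (trigPoly S c)) n = if n ∈ S then c n else 0 := by
  rw [torusFourier_torusDist_eq_integral (contDiff_trigPoly S c).continuous]
  have e : ∀ x : ℝ, (trigPoly S c x : ℂ) * Complex.exp (Complex.I * ((-n : ℤ) : ℂ) * x)
      = ∑ k ∈ S, c k * Complex.exp (Complex.I * ((k - n : ℤ) : ℂ) * x) := by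
    intro x
    rw [ofReal_trigPoly hS hc, Finset.sum_mul]
    refine Finset.sum_congr rfl fun k _ => ?_
    rw [mul_assoc, ← Complex.exp_add]
    congr 2
    push_cast; ring
  simp only [e]
  rw [intervalIntegral.integral_finsetSum fun k _ =>
    Continuous.intervalIntegrable (by fun_prop) _ _]
  simp only [intervalIntegral.integral_const_mul, integral_exp_int, sub_eq_zero, mul_ite, mul_zero]
  rw [Finset.sum_ite_eq']
  have : (π : ℂ) ≠ 0 := by exact_mod_cast Real.pi_ne_zero
  split_ifs
  · push_cast; field_simp
  · simp

/-- The Fourier coefficients of a real distribution are Hermitian. -/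
lemma torusFourier_neg {T : TorusDistribution} (hT : TorusIsReal T) (n : ℤ) :
    torusFourier T (-n) = starRingEnd ℂ (torusFourier T n) := by
  -- the real and imaginary parts of the characters are real test functions
  have h1 := hT ((1 / 2 : ℂ) • (torusChar n + torusChar (-n))) fun x => by
    change ((1 / 2 : ℂ) * (Complex.exp (Complex.I * n * x)
      + Complex.exp (Complex.I * ((-n : ℤ) : ℂ) * x))).im = 0
    have e1 : Complex.I * (n : ℂ) * x = ((n * x : ℝ) : ℂ) * Complex.I := by push_cast; ring
    have e2 : Complex.I * ((-n : ℤ) : ℂ) * x = ((-(n * x) : ℝ) : ℂ) * Complex.I := by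
      push_cast; ring
    rw [e1, e2, show (1 / 2 : ℂ) = ((1 / 2 : ℝ) : ℂ) by push_cast; rfl, Complex.im_ofReal_mul,
      Complex.add_im, Complex.exp_ofReal_mul_I_im, Complex.exp_ofReal_mul_I_im, Real.sin_neg]
    ring
  have h2 := hT ((-Complex.I / 2 : ℂ) • (torusChar n - torusChar (-n))) fun x => by
    change ((-Complex.I / 2 : ℂ) * (Complex.exp (Complex.I * n * x)
      - Complex.exp (Complex.I * ((-n : ℤ) : ℂ) * x))).im = 0
    have e1 : Complex.I * (n : ℂ) * x = ((n * x : ℝ) : ℂ) * Complex.I := by push_cast; ring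
    have e2 : Complex.I * ((-n : ℤ) : ℂ) * x = ((-(n * x) : ℝ) : ℂ) * Complex.I := by
      push_cast; ring
    rw [e1, e2, Complex.mul_im, Complex.sub_im, Complex.sub_re, Complex.exp_ofReal_mul_I_re,
      Complex.exp_ofReal_mul_I_re, Real.cos_neg]
    simp
  rw [map_smul, map_add, smul_eq_mul] at h1
  rw [map_smul, map_sub, smul_eq_mul] at h2
  have h3 : T.1 (torusChar n) = starRingEnd ℂ (T.1 (torusChar (-n))) := by
    apply Complex.ext
    · simp [Complex.mul_im] at h2
      rw [Complex.conj_re]; linarith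
    · simp [Complex.mul_im] at h1
      rw [Complex.conj_im]; linarith
  rw [torusFourier, torusFourier, neg_neg, h3, map_mul, Complex.conj_ofReal]

lemma torusFourier_sub (S T : TorusDistribution) (n : ℤ) :
    torusFourier (S - T) n = torusFourier S n - torusFourier T n := by
  simp only [torusFourier]
  rw [← mul_sub]; rfl

/-- Trigonometric polynomials are dense in `H^s(𝕋)`. -/
lemma exists_trigPoly_close {s : ℝ} {T : TorusDistribution} (hT : TorusIsReal T)
    (hm : TorusMemSobolev s T) {δ : ℝ} (hδ : 0 < δ) :
    ∃ S : Finset ℤ, torusSq s (torusDist (trigPoly S (torusFourier T)) - T)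
      < ENNReal.ofReal δ := by
  have hfin : torusSq s T ≠ ⊤ := by
    intro h
    rw [TorusMemSobolev, torusSobolevNorm, show (∑' n : ℤ, _) = torusSq s T from rfl, h] at hm
    simp at hm
  have h1 := (ENNReal.tendsto_tsum_compl_atTop_zero hfin).eventually
    (gt_mem_nhds (ENNReal.ofReal_pos.2 hδ))
  obtain ⟨S₀, hS₀⟩ := eventually_atTop.1 h1
  -- a symmetric set of frequencies gives a real trigonometric polynomial
  set S := S₀ ∪ S₀.image (fun k => -k) with hS_def
  have hS : ∀ k ∈ S, -k ∈ S := by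
    intro k hk
    rw [hS_def, Finset.mem_union, Finset.mem_image] at *
    rcases hk with h | ⟨j, h, rfl⟩
    · exact Or.inr ⟨k, h, rfl⟩
    · exact Or.inl (by simpa using h)
  refine ⟨S, lt_of_eq_of_lt ?_ (hS₀ S Finset.subset_union_left)⟩
  rw [torusSq, show (∑' b : {x // x ∉ S}, ENNReal.ofReal ((1 + ((b : ℤ) : ℝ) ^ 2) ^ s *
    ‖torusFourier T b‖ ^ 2)) = ∑' b : ({x | x ∉ S} : Set ℤ), ENNReal.ofReal
      ((1 + ((b : ℤ) : ℝ) ^ 2) ^ s * ‖torusFourier T b‖ ^ 2) from rfl,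
    tsum_subtype (f := fun n : ℤ => ENNReal.ofReal ((1 + (n : ℝ) ^ 2) ^ s * ‖torusFourier T n‖ ^ 2))]
  refine tsum_congr fun n => ?_
  rw [torusFourier_sub, torusFourier_trigPoly hS (torusFourier_neg hT)]
  by_cases hn : n ∈ S
  · simp [hn]
  · simp [hn]

/-- The coefficients of `cos x cos (N x)`. -/
lemma torusFourier_cos_mul_cos {N : ℕ} (hN : 2 ≤ N) (n : ℤ) :
    torusFourier (torusDist (fun x => Real.cos x * Real.cos (N * x))) n
      = if n ∈ ({(N : ℤ) + 1, (N : ℤ) - 1, -((N : ℤ) + 1), -((N : ℤ) - 1)} : Finset ℤ)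
        then 1 / 4 else 0 := by
  have hS : ∀ k ∈ ({(N : ℤ) + 1, (N : ℤ) - 1, -((N : ℤ) + 1), -((N : ℤ) - 1)} : Finset ℤ),
      -k ∈ ({(N : ℤ) + 1, (N : ℤ) - 1, -((N : ℤ) + 1), -((N : ℤ) - 1)} : Finset ℤ) := by
    intro k hk
    simp only [Finset.mem_insert, Finset.mem_singleton] at *
    omega
  rw [← torusFourier_trigPoly hS (c := fun _ => 1 / 4) (fun _ => by
    rw [show (1 / 4 : ℂ) = ((1 / 4 : ℝ) : ℂ) by push_cast; rfl, Complex.conj_ofReal])]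
  congr 2
  funext x
  rw [trigPoly, Finset.sum_insert (by simp; omega), Finset.sum_insert (by simp; omega),
    Finset.sum_insert (by simp; omega), Finset.sum_singleton]
  have e : ∀ k : ℤ, ((1 / 4 : ℂ) * Complex.exp (Complex.I * k * x)).re
      = 1 / 4 * Real.cos (k * x) := fun k => by
    rw [show Complex.I * (k : ℂ) * x = ((k * x : ℝ) : ℂ) * Complex.I by push_cast; ring,
      show (1 / 4 : ℂ) = ((1 / 4 : ℝ) : ℂ) by push_cast; rfl, Complex.re_ofReal_mul,
      Complex.exp_ofReal_mul_I_re]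
  simp only [Complex.add_re, e]
  push_cast
  rw [show -((N : ℝ) + 1) * x = -(((N : ℝ) + 1) * x) by ring,
    show -((N : ℝ) - 1) * x = -(((N : ℝ) - 1) * x) by ring, Real.cos_neg, Real.cos_neg,
    show ((N : ℝ) + 1) * x = N * x + x by ring, show ((N : ℝ) - 1) * x = N * x - x by ring,
    Real.cos_add, Real.cos_sub]
  ring

lemma tendsto_torusSq_cos_mul_cos {s : ℝ} (hs : s < 0) :
    Tendsto (fun N : ℕ => torusSq s (torusDist (fun x => Real.cos x * Real.cos (N * x)))) atTop
      (𝓝 0) := by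
  have hlim : Tendsto (fun N : ℕ => 4 * ENNReal.ofReal ((1 + ((N : ℝ) - 1) ^ 2) ^ s)) atTop (𝓝 0) := by
    have h1 : Tendsto (fun N : ℕ => 1 + ((N : ℝ) - 1) ^ 2) atTop atTop := by
      refine tendsto_atTop_add_const_left _ _ ?_
      refine (tendsto_pow_atTop two_ne_zero).comp ?_
      exact tendsto_atTop_add_const_right _ _ tendsto_natCast_atTop_atTop
    have h2 : Tendsto (fun N : ℕ => (1 + ((N : ℝ) - 1) ^ 2) ^ s) atTop (𝓝 0) := by
      have := (tendsto_rpow_neg_atTop (y := -s) (by linarith)).comp h1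
      simpa [Function.comp_def] using this
    have h3 := ENNReal.Tendsto.const_mul (a := 4) (ENNReal.tendsto_ofReal h2) (Or.inr (by simp))
    simpa using h3
  refine tendsto_of_tendsto_of_tendsto_of_le_of_le' tendsto_const_nhds hlim
    (Eventually.of_forall fun _ => zero_le) ?_
  filter_upwards [eventually_ge_atTop 2] with N hN
  set S : Finset ℤ := {(N : ℤ) + 1, (N : ℤ) - 1, -((N : ℤ) + 1), -((N : ℤ) - 1)} with hS
  have hcard : S.card ≤ 4 := Finset.card_le_four
  rw [torusSq, tsum_eq_sum (s := S) fun n hn => by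
    rw [torusFourier_cos_mul_cos hN, if_neg hn]; simp]
  calc _ ≤ ∑ n ∈ S, ENNReal.ofReal ((1 + ((N : ℝ) - 1) ^ 2) ^ s) := by
        refine Finset.sum_le_sum fun n hn => ENNReal.ofReal_le_ofReal ?_
        rw [torusFourier_cos_mul_cos hN, if_pos hn]
        have h1 : (1 + (n : ℝ) ^ 2) ^ s ≤ (1 + ((N : ℝ) - 1) ^ 2) ^ s := by
          refine Real.rpow_le_rpow_of_nonpos (by positivity) ?_ hs.le
          have hN' : (2 : ℝ) ≤ N := by exact_mod_cast hN
          simp only [hS, Finset.mem_insert, Finset.mem_singleton] at hn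
          rcases hn with rfl | rfl | rfl | rfl <;> push_cast <;> nlinarith
        have h2 : ‖(1 / 4 : ℂ)‖ ^ 2 ≤ 1 := by norm_num
        calc _ ≤ (1 + (n : ℝ) ^ 2) ^ s * 1 := by gcongr
          _ ≤ _ := by rw [mul_one]; exact h1
    _ = S.card • ENNReal.ofReal ((1 + ((N : ℝ) - 1) ^ 2) ^ s) := Finset.sum_const _
    _ ≤ _ := by
      rw [nsmul_eq_mul]
      gcongr
      exact_mod_cast hcard

/-! ### Norm inflation on the torus -/

lemma exists_bound_iteratedDeriv_of_periodic {f : ℝ → ℝ} (hf : ContDiff ℝ ∞ f) {p : ℝ}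
    (hp : Function.Periodic f p) (hp0 : p ≠ 0) (k : ℕ) :
    ∃ C, 0 ≤ C ∧ ∀ x, |iteratedDeriv k f x| ≤ C := by
  have h1 : Function.Periodic (iteratedDeriv k f) p := fun x => by
    have := congrFun (iteratedDeriv_comp_add_const k f p) x
    rw [← this, show (fun z => f (z + p)) = f from funext hp]
  have h2 : Continuous (iteratedDeriv k f) := hf.continuous_iteratedDeriv k (by exact_mod_cast le_top)
  obtain ⟨C, hC⟩ := (h1.isBounded_of_continuous hp0 h2).exists_norm_le
  exact ⟨C, (norm_nonneg _).trans (hC _ (mem_range_self 0)), fun x => hC _ (mem_range_self x)⟩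

lemma torusSq_inflData_le {s : ℝ} {φ g : ℝ → ℝ} (hφ : Continuous φ) (hg : Continuous g) (B : ℝ)
    (N : ℕ) (T : TorusDistribution) :
    torusSq s (torusDist (inflData φ g B N) - T) ≤ 2 * torusSq s (torusDist φ - T)
      + ENNReal.ofReal (2 * B ^ 4) * torusSq s (torusDist (fun x => g x * Real.cos (N * x))) := by
  have hc : Continuous (inflData φ g B N) := by
    unfold inflData; fun_prop
  have hgc : Continuous (fun x => g x * Real.cos (N * x)) := by fun_prop
  rw [torusSq, torusSq, torusSq, ← ENNReal.tsum_mul_left, ← ENNReal.tsum_mul_left,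
    ← ENNReal.tsum_add]
  refine ENNReal.tsum_le_tsum fun n => ?_
  have e : torusFourier (torusDist (inflData φ g B N)) n = torusFourier (torusDist φ) n
      + (B ^ 2 : ℝ) * torusFourier (torusDist (fun x => g x * Real.cos (N * x))) n := by
    rw [torusFourier_torusDist_eq_integral hc, torusFourier_torusDist_eq_integral hφ,
      torusFourier_torusDist_eq_integral hgc, mul_left_comm, ← mul_add]
    congr 1
    rw [← intervalIntegral.integral_const_mul, ← intervalIntegral.integral_add
      (Continuous.intervalIntegrable (by fun_prop) _ _)
      (Continuous.intervalIntegrable (by fun_prop) _ _)]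
    refine intervalIntegral.integral_congr fun x _ => ?_
    simp only [inflData]
    push_cast
    ring
  rw [torusFourier_sub, torusFourier_sub, e]
  set x := torusFourier (torusDist φ) n - torusFourier T n
  set y := torusFourier (torusDist (fun x => g x * Real.cos (N * x))) n
  rw [show torusFourier (torusDist φ) n + (B ^ 2 : ℝ) * y - torusFourier T n
    = x + (B ^ 2 : ℝ) * y by ring]
  rw [show (2 : ℝ≥0∞) = ENNReal.ofReal 2 by simp, ← ENNReal.ofReal_mul (by norm_num),
    ← ENNReal.ofReal_mul (by positivity), ← ENNReal.ofReal_add (by positivity) (by positivity)]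
  refine ENNReal.ofReal_le_ofReal ?_
  have h1 : ‖x + (B ^ 2 : ℝ) * y‖ ≤ ‖x‖ + B ^ 2 * ‖y‖ := by
    refine (norm_add_le _ _).trans (le_of_eq ?_)
    rw [norm_mul, Complex.norm_real, Real.norm_eq_abs, abs_of_nonneg (by positivity)]
  have h2 : ‖x + (B ^ 2 : ℝ) * y‖ ^ 2 ≤ 2 * ‖x‖ ^ 2 + 2 * B ^ 4 * ‖y‖ ^ 2 := by
    calc _ ≤ (‖x‖ + B ^ 2 * ‖y‖) ^ 2 := by gcongr
      _ ≤ _ := by nlinarith [sq_nonneg (‖x‖ - B ^ 2 * ‖y‖)]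
  calc _ ≤ (1 + (n : ℝ) ^ 2) ^ s * (2 * ‖x‖ ^ 2 + 2 * B ^ 4 * ‖y‖ ^ 2) := by gcongr
    _ = _ := by ring

lemma integral_cos_sq_mul_pos :
    0 < ∫ x in (0 : ℝ)..(2 * π), Real.cos x ^ 2 * (2 * Real.cos (2 * x)) := by
  have hd : ∀ x : ℝ, HasDerivAt (fun x : ℝ => Real.sin (2 * x) / 2 + x / 2 + Real.sin (4 * x) / 8)
      (Real.cos x ^ 2 * (2 * Real.cos (2 * x))) x := fun x => by
    have h1 : ∀ c : ℝ, HasDerivAt (fun x : ℝ => Real.sin (c * x)) (Real.cos (c * x) * c) x := fun c =>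
      (Real.hasDerivAt_sin _).comp x (by simpa using (hasDerivAt_id x).const_mul c)
    refine ((((h1 2).div_const 2).add ((hasDerivAt_id x).div_const 2)).add
      ((h1 4).div_const 8)).congr_deriv ?_
    rw [show (4 : ℝ) * x = 2 * (2 * x) by ring, Real.cos_two_mul (2 * x), Real.cos_two_mul x]
    ring
  rw [intervalIntegral.integral_eq_sub_of_hasDerivAt (fun x _ => hd x)
    (Continuous.intervalIntegrable (by fun_prop) _ _)]
  have h2 : Real.sin (2 * (2 * π)) = 0 := by simpa using Real.sin_nat_mul_pi 4 ▸ (by ring_nf)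
  have h4 : Real.sin (4 * (2 * π)) = 0 := by simpa using Real.sin_nat_mul_pi 8 ▸ (by ring_nf)
  simp [h2, h4, Real.pi_pos]

lemma abs_integral_mul_sin_le {f : ℝ → ℝ} (hf : Continuous f) :
    |∫ x in (0 : ℝ)..(2 * π), f x * Real.sin (2 * x)|
      ≤ 2 * π * ‖torusFourier (torusDist f) 2‖ := by
  rw [torusFourier_torusDist_eq_integral hf, norm_mul, Complex.norm_real, Real.norm_eq_abs,
    abs_of_nonneg (a := 1 / (2 * π)) (by positivity), ← mul_assoc, mul_one_div_cancel (by positivity), one_mul]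
  have e : (∫ x in (0 : ℝ)..(2 * π), f x * Real.sin (2 * x)) = -(∫ x in (0 : ℝ)..(2 * π),
      (f x : ℂ) * Complex.exp (Complex.I * ((-2 : ℤ) : ℂ) * x)).im := by
    have h1 : IntervalIntegrable (fun x : ℝ => (f x : ℂ) *
        Complex.exp (Complex.I * ((-2 : ℤ) : ℂ) * x)) volume 0 (2 * π) :=
      Continuous.intervalIntegrable (by fun_prop) _ _
    have h2 := (Complex.imCLM.intervalIntegral_comp_comm h1).symm
    simp only [Complex.imCLM_apply] at h2
    rw [h2, ← intervalIntegral.integral_neg]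
    refine intervalIntegral.integral_congr fun x _ => ?_
    rw [show Complex.I * ((-2 : ℤ) : ℂ) * (x : ℂ) = ((-(2 * x) : ℝ) : ℂ) * Complex.I by
      push_cast; ring, Complex.im_ofReal_mul, Complex.exp_ofReal_mul_I_im, Real.sin_neg]
    ring
  rw [e, abs_neg]
  exact Complex.abs_im_le_norm _

/-- Norm inflation on the torus, with the modulated profile `cos x` and the test function
`θ = sin(2x)`, so that the growth takes place in the Fourier coefficients `±2`. -/
theorem torus_inflation {s : ℝ} (hs : s < 0) {T : TorusDistribution} (hT : TorusIsReal T)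
    (hm : TorusMemSobolev s T) {ε : ℝ} (hε : 0 < ε) :
    ∃ (u : ℝ → ℝ → ℝ) (t : ℝ), IsSmoothSolutionTorus u ∧ 0 < t ∧ t < ε ∧
      torusSobolevNorm s (torusDist (u 0) - T) < ENNReal.ofReal ε ∧
      ENNReal.ofReal ε⁻¹ < torusSobolevNorm s (torusDist (u t)) ∧
      torusSobolevNorm s (torusDist (u t)) < ⊤ := by
  have h2π : (2 * π : ℝ) ≠ 0 := by positivity
  obtain ⟨S, hS⟩ := exists_trigPoly_close hT hm (δ := ε ^ 2 / 4) (by positivity)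
  set φ := trigPoly S (torusFourier T) with hφ_def
  have hφ : ContDiff ℝ ∞ φ := contDiff_trigPoly _ _
  have hφp : Function.Periodic φ (2 * π) := periodic_trigPoly _ _
  have hdata : ∀ B N, ContDiff ℝ ∞ (inflData φ Real.cos B N) := fun B N => by
    unfold inflData
    exact hφ.add (contDiff_const.mul (Real.contDiff_cos.mul
      (Real.contDiff_cos.comp (contDiff_const.mul contDiff_id))))
  have hdatap : ∀ B N, Function.Periodic (inflData φ Real.cos B N) (2 * π) := fun B N x => by
    have : Real.cos (N * (x + 2 * π)) = Real.cos (N * x) := by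
      rw [mul_add]; exact Real.cos_add_nat_mul_two_pi _ _
    simp only [inflData, hφp x, Real.cos_add_two_pi, this]
  have hdatab := fun B N => exists_bound_iteratedDeriv_of_periodic (hdata B N) (hdatap B N) h2π
  obtain ⟨Cφ, -, hCφ⟩ := exists_bound_iteratedDeriv_of_periodic hφ hφp h2π 0
  simp only [iteratedDeriv_zero] at hCφ
  have hlin : ∀ x : ℝ, HasDerivAt (fun x : ℝ => 2 * x) 2 x := fun x => by
    simpa using (hasDerivAt_id x).const_mul (2 : ℝ)
  have hs1 : ∀ x : ℝ, HasDerivAt (fun x => Real.sin (2 * x)) (2 * Real.cos (2 * x)) x :=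
    fun x => ((hlin x).sin).congr_deriv (by ring)
  have hs2 : ∀ x : ℝ, HasDerivAt (fun x => 2 * Real.cos (2 * x)) (-4 * Real.sin (2 * x)) x :=
    fun x => (((hlin x).cos).const_mul 2).congr_deriv (by ring)
  have h5 : (0 : ℝ) < (1 + ((2 : ℤ) : ℝ) ^ 2) ^ (s / 2) := by positivity
  have hparts : ∀ B N, ∫ x in (0 : ℝ)..(2 * π),
      bbmOp (fun y => inflData φ Real.cos B N y + inflData φ Real.cos B N y ^ 2 / 2) x
        * (Real.sin (2 * x) - -4 * Real.sin (2 * x))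
      = ∫ x in (0 : ℝ)..(2 * π), (inflData φ Real.cos B N x + inflData φ Real.cos B N x ^ 2 / 2)
        * (2 * Real.cos (2 * x)) := fun B N => by
    obtain ⟨C, hC0, hC⟩ := hdatab B N 0
    simp only [iteratedDeriv_zero] at hC
    have hper : ∀ x, (fun y => inflData φ Real.cos B N y + inflData φ Real.cos B N y ^ 2 / 2) (x + 2 * π)
        = (fun y => inflData φ Real.cos B N y + inflData φ Real.cos B N y ^ 2 / 2) x := fun x => by
      simp only [hdatap B N x]
    set w := fun y => inflData φ Real.cos B N y + inflData φ Real.cos B N y ^ 2 / 2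
    have hwc : Continuous w := by
      have := (hdata B N).continuous
      fun_prop
    have hwb : ∀ x, |w x| ≤ C + C ^ 2 / 2 := fun x => by
      refine (abs_add_le _ _).trans (add_le_add (hC x) ?_)
      rw [abs_of_nonneg (by positivity), ← sq_abs]
      have := hC x
      gcongr
    have e1 : bbmOp w (2 * π) = bbmOp w 0 := by
      have := bbmOp_translate (2 * π) w 0
      rw [zero_add] at this
      rw [← this, funext hper]
    have e2 : resolvent w (2 * π) = resolvent w 0 := by
      have h1 := expAvg_translate (-1) (2 * π) w 0
      have h2 := expAvg_translate 1 (2 * π) w 0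
      rw [zero_add, funext hper] at h1 h2
      rw [resolvent, resolvent, h1, h2]
    refine integral_bbmOp_mul hwc hwb
      (θ := fun x => Real.sin (2 * x)) (θ' := fun x => 2 * Real.cos (2 * x))
      (θ'' := fun x => -4 * Real.sin (2 * x)) hs1 hs2
      (by fun_prop) ?_
    have h3 : Real.sin (2 * (2 * π)) = Real.sin (2 * 0) := by
      have := Real.sin_nat_mul_pi 4
      rw [mul_zero, Real.sin_zero, ← this]; congr 1; push_cast; ring
    have h4 : Real.cos (2 * (2 * π)) = Real.cos (2 * 0) := by
      have := Real.cos_nat_mul_two_pi 2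
      rw [mul_zero, Real.cos_zero, ← this]; congr 1
    simp only [e1, e2, h3, h4]
  obtain ⟨B, t, ht0, htε, hev⟩ := exists_large_pairing (g := Real.cos) (Cg := 1)
    (θ := fun x => Real.sin (2 * x)) (θ' := fun x => 2 * Real.cos (2 * x))
    (θ'' := fun x => -4 * Real.sin (2 * x)) hφ.continuous Real.continuous_cos hCφ
    Real.abs_cos_le_one
    hs1 hs2
    (by fun_prop) (a := 0) (b := 2 * π) (by positivity) integral_cos_sq_mul_pos hparts
    (R := 10 * π * (ε⁻¹ / (1 + ((2 : ℤ) : ℝ) ^ 2) ^ (s / 2))) hε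
  have hsmall : ∀ᶠ N : ℕ in atTop, ENNReal.ofReal (2 * B ^ 4) *
      torusSq s (torusDist (fun x => Real.cos x * Real.cos (N * x)))
        < ENNReal.ofReal (ε ^ 2 / 4) := by
    have := ENNReal.Tendsto.const_mul (a := ENNReal.ofReal (2 * B ^ 4))
      (tendsto_torusSq_cos_mul_cos hs) (Or.inr ENNReal.ofReal_ne_top)
    rw [mul_zero] at this
    exact this.eventually (gt_mem_nhds (ENNReal.ofReal_pos.2 (by positivity)))
  obtain ⟨N, hN1, hN2⟩ := (hev.and hsmall).exists
  obtain ⟨C0, hC00, hC0⟩ := hdatab B N 0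
  obtain ⟨C1, hC10, hC1⟩ := hdatab B N 1
  simp only [iteratedDeriv_zero, iteratedDeriv_one] at hC0 hC1
  obtain ⟨u, hu, hup⟩ := exists_isMild_torus (C := C0 + C1) ((hdata B N).of_le (by simp))
    (hdatap B N) (fun x => (hC0 x).trans (by linarith)) (fun x => (hC1 x).trans (by linarith))
  have hcont : Continuous (u t) := hu.wBdd.cont_space t
  refine ⟨u, t, ⟨hu.isSmoothSolution isWeight_one (hdata B N) fun k => ?_, fun t _ => hup t⟩,
    ht0, htε, torusSobolevNorm_lt hε ?_, ?_, torusSobolevNorm_torusDist_lt_top hs hcont⟩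
  · obtain ⟨C, h1, h2⟩ := hdatab B N k
    exact ⟨C, h1, fun x => by simpa using h2 x⟩
  · rw [show u 0 = inflData φ Real.cos B N from funext hu.zero]
    refine (torusSq_inflData_le hφ.continuous Real.continuous_cos B N T).trans_lt ?_
    calc _ < ENNReal.ofReal (ε ^ 2 / 2) + ENNReal.ofReal (ε ^ 2 / 4) := by
          refine ENNReal.add_lt_add ?_ hN2
          rw [show ε ^ 2 / 2 = 2 * (ε ^ 2 / 4) by ring, ENNReal.ofReal_mul (by norm_num),
            ENNReal.ofReal_ofNat]
          exact (ENNReal.mul_lt_mul_iff_right (by simp) (by simp)).2 hS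
      _ ≤ _ := by
        rw [← ENNReal.ofReal_add (by positivity) (by positivity)]
        exact ENNReal.ofReal_le_ofReal (by nlinarith [sq_nonneg ε])
  · refine lt_torusSobolevNorm (by positivity) 2 ?_
    have h1 := hN1 _ u isWeight_one hu
    have h2 := abs_integral_mul_sin_le hcont
    have h3 : ∫ x in (0 : ℝ)..(2 * π), u t x * (Real.sin (2 * x) - -4 * Real.sin (2 * x))
        = 5 * ∫ x in (0 : ℝ)..(2 * π), u t x * Real.sin (2 * x) := by
      rw [← intervalIntegral.integral_const_mul]
      refine intervalIntegral.integral_congr fun x _ => ?_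
      ring
    rw [h3] at h1
    have h4 : ε⁻¹ / (1 + ((2 : ℤ) : ℝ) ^ 2) ^ (s / 2) < ‖torusFourier (torusDist (u t)) 2‖ := by
      have h6 := h1.trans_le (mul_le_mul_of_nonneg_left ((le_abs_self _).trans h2)
        (by norm_num : (0 : ℝ) ≤ 5))
      have hp := Real.pi_pos
      nlinarith
    rw [div_lt_iff₀ h5] at h4
    have h6 : (1 + ((2 : ℤ) : ℝ) ^ 2) ^ s = ((1 + ((2 : ℤ) : ℝ) ^ 2) ^ (s / 2)) ^ 2 := by
      rw [← Real.rpow_mul_natCast (by positivity)]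
      congr 1; push_cast; ring
    rw [h6, ← mul_pow, mul_comm]
    exact pow_lt_pow_left₀ h4 (by positivity) two_ne_zero

/-! ### Sobolev norms on the line -/

lemma lineWeight_ofReal_hasTemperateGrowth (σ : ℝ) :
    Function.HasTemperateGrowth (fun η : ℝ => (lineWeight σ η : ℂ)) := by
  have := lineWeight_hasTemperateGrowth σ
  fun_prop

lemma lineWeight_pos (σ η : ℝ) : 0 < lineWeight σ η := Real.rpow_pos_of_pos (by positivity) _

lemma lineWeight_add (σ τ η : ℝ) : lineWeight (σ + τ) η = lineWeight σ η * lineWeight τ η := by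
  rw [lineWeight, lineWeight, lineWeight, ← Real.rpow_add (by positivity), add_div]

lemma lineWeight_neg_mul (σ η : ℝ) : lineWeight (-σ) η * lineWeight σ η = 1 := by
  rw [← lineWeight_add, neg_add_cancel, lineWeight]
  simp

lemma lineWeight_le_one {σ : ℝ} (hσ : σ ≤ 0) (η : ℝ) : lineWeight σ η ≤ 1 :=
  Real.rpow_le_one_of_one_le_of_nonpos (by nlinarith [sq_nonneg (2 * π * η)]) (by linarith)

lemma lineWeight_even (σ η : ℝ) : lineWeight σ (-η) = lineWeight σ η := by
  simp [lineWeight]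

lemma continuous_lineWeight (σ : ℝ) : Continuous (lineWeight σ) :=
  (lineWeight_hasTemperateGrowth σ).1.continuous

/-- Multiplication of a Schwartz function by `⟨ξ⟩^σ`. -/
def weightMul (σ : ℝ) : 𝓢(ℝ, ℂ) →L[ℂ] 𝓢(ℝ, ℂ) :=
  SchwartzMap.smulLeftCLM ℂ (fun η : ℝ => (lineWeight σ η : ℂ))

@[simp] lemma weightMul_apply (σ : ℝ) (F : 𝓢(ℝ, ℂ)) (η : ℝ) :
    weightMul σ F η = lineWeight σ η * F η := by
  rw [weightMul, SchwartzMap.smulLeftCLM_apply_apply (lineWeight_ofReal_hasTemperateGrowth σ),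
    smul_eq_mul]

lemma weightMul_neg_weightMul (σ : ℝ) (F : 𝓢(ℝ, ℂ)) : weightMul σ (weightMul (-σ) F) = F := by
  ext η
  rw [weightMul_apply, weightMul_apply, ← mul_assoc, ← Complex.ofReal_mul, mul_comm (lineWeight _ _),
    lineWeight_neg_mul, Complex.ofReal_one, one_mul]

/-- The function `⟨ξ⟩^σ 𝓕F` in `L²`, for a Schwartz function `F`. -/
def sobolevLp (σ : ℝ) (F : 𝓢(ℝ, ℂ)) : Lp ℂ 2 (volume : Measure ℝ) :=
  (weightMul σ (𝓕 F)).toLp 2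

lemma smulLeftCLM_fourier_coe (σ : ℝ) (F : 𝓢(ℝ, ℂ)) :
    TemperedDistribution.smulLeftCLM ℂ (fun η : ℝ => (lineWeight σ η : ℂ)) (𝓕 (F : 𝓢'(ℝ, ℂ)))
      = (sobolevLp σ F : 𝓢'(ℝ, ℂ)) := by
  rw [TemperedDistribution.fourier_toTemperedDistributionCLM_eq, sobolevLp,
    Lp.toTemperedDistribution_toLp_eq]
  ext ψ
  rw [TemperedDistribution.smulLeftCLM_apply_apply, SchwartzMap.coe_apply, SchwartzMap.coe_apply]
  congr 1; funext η
  rw [SchwartzMap.smulLeftCLM_apply_apply (lineWeight_ofReal_hasTemperateGrowth σ), weightMul_apply]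
  simp only [smul_eq_mul]; ring

lemma lineSobolevNorm_le {σ : ℝ} {T : 𝓢'(ℝ, ℂ)} {g : Lp ℂ 2 (volume : Measure ℝ)}
    (h : TemperedDistribution.smulLeftCLM ℂ (fun η : ℝ => (lineWeight σ η : ℂ)) (𝓕 T)
      = (g : 𝓢'(ℝ, ℂ))) : lineSobolevNorm σ T ≤ ‖g‖ₑ :=
  iInf₂_le g h

/-- Equality holds as well, but is not needed: upper bounds come from this representative, lower
bounds from `exists_enorm_apply_le`. -/
lemma lineSobolevNorm_coe_le (σ : ℝ) (F : 𝓢(ℝ, ℂ)) :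
    lineSobolevNorm σ (F : 𝓢'(ℝ, ℂ)) ≤ ‖sobolevLp σ F‖ₑ :=
  lineSobolevNorm_le (smulLeftCLM_fourier_coe σ F)

lemma lineSobolevNorm_coe_lt_top (σ : ℝ) (F : 𝓢(ℝ, ℂ)) :
    lineSobolevNorm σ (F : 𝓢'(ℝ, ℂ)) < ⊤ :=
  (lineSobolevNorm_coe_le σ F).trans_lt enorm_lt_top

lemma enorm_toLp (F : 𝓢(ℝ, ℂ)) : ‖F.toLp 2 (volume : Measure ℝ)‖ₑ = eLpNorm F 2 volume := by
  rw [Lp.enorm_def, eLpNorm_congr_ae (F.coeFn_toLp 2 volume)]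

lemma enorm_sobolevLp (σ : ℝ) (F : 𝓢(ℝ, ℂ)) :
    ‖sobolevLp σ F‖ₑ = eLpNorm (fun η => lineWeight σ η * 𝓕 F η) 2 volume := by
  rw [sobolevLp, enorm_toLp]
  congr 1; funext η
  exact weightMul_apply σ _ η

lemma eLpNorm_fourier (F : 𝓢(ℝ, ℂ)) :
    eLpNorm (𝓕 F : 𝓢(ℝ, ℂ)) 2 volume = eLpNorm F 2 volume := by
  rw [← enorm_toLp, ← enorm_toLp, ← ofReal_norm, ← ofReal_norm, SchwartzMap.norm_fourier_toL2_eq]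

lemma enorm_sobolevLp_le {σ : ℝ} (hσ : σ ≤ 0) (F : 𝓢(ℝ, ℂ)) :
    ‖sobolevLp σ F‖ₑ ≤ eLpNorm F 2 volume := by
  rw [enorm_sobolevLp, ← eLpNorm_fourier F]
  refine eLpNorm_mono fun η => ?_
  rw [norm_mul, Complex.norm_real, Real.norm_of_nonneg (lineWeight_pos σ η).le]
  exact mul_le_of_le_one_left (norm_nonneg _) (lineWeight_le_one hσ η)

lemma enorm_toTemperedDistribution_apply_le (g : Lp ℂ 2 (volume : Measure ℝ)) (χ : 𝓢(ℝ, ℂ)) :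
    ‖(g : 𝓢'(ℝ, ℂ)) χ‖ₑ ≤ ‖g‖ₑ * eLpNorm χ 2 volume := by
  have h := eLpNorm_smul_le_mul_eLpNorm (p := 2) (q := 2) (r := 1) (Lp.aestronglyMeasurable g)
    (χ.continuous.aestronglyMeasurable (μ := volume))
  rw [Lp.toTemperedDistribution_apply, Lp.enorm_def, mul_comm]
  refine (enorm_integral_le_lintegral_enorm (fun x => χ x • g x)).trans ?_
  rwa [eLpNorm_one_eq_lintegral_enorm] at h

/-- Lower bounds for the `H^σ` norm come from duality with `H^{-σ}`. -/
lemma exists_enorm_apply_le (σ : ℝ) (ψ : 𝓢(ℝ, ℂ)) : ∃ C : ℝ, 0 < C ∧ ∀ T : 𝓢'(ℝ, ℂ),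
    ‖T ψ‖ₑ ≤ lineSobolevNorm σ T * ENNReal.ofReal C := by
  obtain ⟨χ, hχ⟩ : ∃ χ : 𝓢(ℝ, ℂ), 𝓕 (weightMul σ χ) = ψ :=
    ⟨weightMul (-σ) (𝓕⁻ ψ), by
      rw [weightMul_neg_weightMul]
      exact FourierTransform.fourier_fourierInv_eq ψ⟩
  have hfin : eLpNorm χ 2 volume ≠ ⊤ := (χ.eLpNorm_lt_top 2 volume).ne
  have hle : eLpNorm χ 2 volume ≤ ENNReal.ofReal ((eLpNorm χ 2 volume).toReal + 1) := by
    refine (ENNReal.ofReal_toReal hfin).symm.le.trans (ENNReal.ofReal_le_ofReal (by linarith))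
  generalize (eLpNorm χ 2 volume).toReal + 1 = C at hle
  refine ⟨max C 1, by positivity, fun T => ?_⟩
  replace hle := hle.trans (ENNReal.ofReal_le_ofReal (le_max_left C 1))
  have hCne : ENNReal.ofReal (max C 1) ≠ 0 := (ENNReal.ofReal_pos.2 (by positivity)).ne'
  rw [lineSobolevNorm, ENNReal.iInf_mul_of_ne hCne ENNReal.ofReal_ne_top]
  refine le_iInf fun g => ?_
  rw [ENNReal.iInf_mul_of_ne hCne ENNReal.ofReal_ne_top]
  refine le_iInf fun hg => ?_
  have h1 : T ψ = (g : 𝓢'(ℝ, ℂ)) χ := by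
    rw [← hg, TemperedDistribution.smulLeftCLM_apply_apply, TemperedDistribution.fourier_apply, ← hχ]
    rfl
  rw [h1]
  refine (enorm_toTemperedDistribution_apply_le g χ).trans ?_
  gcongr

/-! ### Real test functions are dense in `H^s` of the line for `s < 0` -/

lemma lineDist_eq {f : ℝ → ℝ} {F : 𝓢(ℝ, ℂ)} (h : ∀ x, F x = f x) :
    MemLp (fun x => (f x : ℂ)) 2 (volume : Measure ℝ) ∧ lineDist f = (F : 𝓢'(ℝ, ℂ)) := by
  have e : (fun x => (f x : ℂ)) = F := funext fun x => (h x).symm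
  have hm : MemLp (fun x => (f x : ℂ)) 2 (volume : Measure ℝ) := by
    rw [e]; exact F.memLp 2 volume
  refine ⟨hm, ?_⟩
  rw [lineDist, dif_pos hm, ← Lp.toTemperedDistribution_toLp_eq (p := 2)]
  congr 1
  exact MemLp.toLp_congr _ _ (Eventually.of_forall fun x => (h x).symm)

lemma sobolevLp_add (σ : ℝ) (F G : 𝓢(ℝ, ℂ)) : sobolevLp σ (F + G) = sobolevLp σ F + sobolevLp σ G := by
  rw [sobolevLp, FourierTransform.fourier_add, map_add]
  rfl

lemma sobolevLp_sub (σ : ℝ) (F G : 𝓢(ℝ, ℂ)) : sobolevLp σ (F - G) = sobolevLp σ F - sobolevLp σ G := by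
  rw [eq_sub_iff_add_eq, ← sobolevLp_add, sub_add_cancel]

lemma lineSobolevNorm_coe_sub_le {σ : ℝ} {T : 𝓢'(ℝ, ℂ)} {g : Lp ℂ 2 (volume : Measure ℝ)}
    (h : TemperedDistribution.smulLeftCLM ℂ (fun η : ℝ => (lineWeight σ η : ℂ)) (𝓕 T)
      = (g : 𝓢'(ℝ, ℂ))) (F : 𝓢(ℝ, ℂ)) :
    lineSobolevNorm σ ((F : 𝓢'(ℝ, ℂ)) - T) ≤ ‖sobolevLp σ F - g‖ₑ := by
  refine lineSobolevNorm_le ?_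
  have e : ((sobolevLp σ F - g : Lp ℂ 2 (volume : Measure ℝ)) : 𝓢'(ℝ, ℂ))
      = (sobolevLp σ F : 𝓢'(ℝ, ℂ)) - (g : 𝓢'(ℝ, ℂ)) :=
    map_sub (Lp.toTemperedDistributionCLM ℂ (volume : Measure ℝ) 2) _ _
  have e2 : 𝓕 ((F : 𝓢'(ℝ, ℂ)) - T) = 𝓕 (F : 𝓢'(ℝ, ℂ)) - 𝓕 T :=
    map_sub (FourierTransform.fourierCLM ℂ 𝓢'(ℝ, ℂ)) _ _
  rw [e, e2, map_sub, smulLeftCLM_fourier_coe, h]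

open ComplexConjugate in
/-- The Fourier transform of `conj K(-x)` is the conjugate of that of `K`. -/
lemma fourier_eq_conj {K K' : 𝓢(ℝ, ℂ)} (h : ∀ x, K' x = conj (K (-x))) (ξ : ℝ) :
    𝓕 K' ξ = conj (𝓕 K ξ) := by
  rw [SchwartzMap.fourier_coe, SchwartzMap.fourier_coe, Real.fourier_real_eq_integral_exp_smul,
    Real.fourier_real_eq_integral_exp_smul, ← integral_conj, ← integral_neg_eq_self]
  congr 1; funext x
  rw [h, neg_neg, smul_eq_mul, smul_eq_mul, map_mul, ← Complex.exp_conj]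
  congr 2
  simp [Complex.conj_ofNat]

lemma exists_schwartz_of_hasCompactSupport {f : ℝ → ℂ} (hf : ContDiff ℝ ∞ f)
    (hc : HasCompactSupport f) : ∃ F : 𝓢(ℝ, ℂ), ∀ x, F x = f x :=
  ⟨hc.toSchwartzMap hf, fun _ => rfl⟩

open ComplexConjugate in
/-- The Fourier transform of a real distribution is Hermitian. For a real test function `ψ` and its
reflection `ψ'`, the Fourier transforms of `⟨ξ⟩^s (ψ + ψ')` and of `i ⟨ξ⟩^s (ψ - ψ')` are real. -/
lemma hermitian_of_lineIsReal {s : ℝ} {T : 𝓢'(ℝ, ℂ)} (hT : LineIsReal T)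
    {g : Lp ℂ 2 (volume : Measure ℝ)}
    (hg : TemperedDistribution.smulLeftCLM ℂ (fun η : ℝ => (lineWeight s η : ℂ)) (𝓕 T)
      = (g : 𝓢'(ℝ, ℂ))) : ∀ᵐ η : ℝ, g η = conj (g (-η)) := by
  have hg2 : MemLp g 2 volume := Lp.memLp g
  have hg3 : MemLp (fun η => conj (g (-η))) 2 volume := by
    have := (hg2.comp_measurePreserving (Measure.measurePreserving_neg (volume : Measure ℝ))).star
    exact this
  have hl : LocallyIntegrable (fun η => g η - conj (g (-η))) volume :=
    (hg2.sub hg3).locallyIntegrable (by norm_num)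
  suffices h : ∀ᵐ η : ℝ, g η - conj (g (-η)) = 0 by
    filter_upwards [h] with η hη using sub_eq_zero.1 hη
  refine ae_eq_zero_of_integral_contDiff_smul_eq_zero hl fun ψ hψ hψc => ?_
  have hψC : ContDiff ℝ ∞ (fun x => (ψ x : ℂ)) := Complex.ofRealCLM.contDiff.comp hψ
  have hψcC : HasCompactSupport (fun x => (ψ x : ℂ)) := hψc.comp_left (g := fun r : ℝ => (r : ℂ)) rfl
  obtain ⟨Ψ, hΨ⟩ := exists_schwartz_of_hasCompactSupport hψC hψcC
  obtain ⟨Ψ', hΨ'⟩ := exists_schwartz_of_hasCompactSupport (f := fun x => (ψ (-x) : ℂ))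
    (hψC.comp contDiff_neg) (hψcC.comp_homeomorph (Homeomorph.neg ℝ))
  have hconj : ∀ ξ, 𝓕 (weightMul s Ψ') ξ = conj (𝓕 (weightMul s Ψ) ξ) := fourier_eq_conj fun x => by
    rw [weightMul_apply, weightMul_apply, hΨ, hΨ', lineWeight_even, map_mul, Complex.conj_ofReal,
      Complex.conj_ofReal]
  have hT' : ∀ χ : 𝓢(ℝ, ℂ), T (𝓕 (weightMul s χ)) = ∫ η, χ η • g η := fun χ => by
    rw [← Lp.toTemperedDistribution_apply, ← hg]
    rfl
  have h1 := hT (𝓕 (weightMul s Ψ) + 𝓕 (weightMul s Ψ')) fun x => by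
    rw [add_apply, hconj]; simp
  have h2 := hT (Complex.I • (𝓕 (weightMul s Ψ) - 𝓕 (weightMul s Ψ'))) fun x => by
    rw [smul_apply, sub_apply, hconj]; simp
  rw [map_add, hT', hT'] at h1
  rw [map_smul, map_sub, hT', hT'] at h2
  simp only [hΨ, hΨ'] at h1 h2
  have e1 : (∫ η, (ψ (-η) : ℂ) • g η) = conj (∫ η, ψ η • conj (g (-η))) := by
    rw [← integral_conj, ← integral_neg_eq_self]
    congr 1; funext η
    simp
  have e2 : (∫ η, (ψ η : ℂ) • g η) = ∫ η, ψ η • g η := by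
    congr 1
  rw [e1, e2] at h1 h2
  have i1 : Integrable (fun η => ψ η • g η) :=
    (hg2.locallyIntegrable (by norm_num)).integrable_smul_left_of_hasCompactSupport
      hψ.continuous hψc
  have i2 : Integrable (fun η => ψ η • conj (g (-η))) :=
    (hg3.locallyIntegrable (by norm_num)).integrable_smul_left_of_hasCompactSupport
      hψ.continuous hψc
  simp only [smul_sub]
  rw [integral_sub i1 i2]
  refine Complex.ext ?_ ?_
  · simp at h2 ⊢
    linarith
  · simp at h1 ⊢
    linarith

open ComplexConjugate in
/-- A smooth approximation of a Hermitian function, averaged with its reflected conjugate. -/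
lemma exists_hermitian_schwartz_close {g : ℝ → ℂ} (hg : MemLp g 2 (volume : Measure ℝ))
    (hh : ∀ᵐ η : ℝ, g η = conj (g (-η))) {δ : ℝ} (hδ : 0 < δ) :
    ∃ h : 𝓢(ℝ, ℂ), (∀ η, h η = conj (h (-η))) ∧
      eLpNorm (fun η => h η - g η) 2 volume ≤ ENNReal.ofReal δ := by
  obtain ⟨h₀, hc, hd, hle⟩ := hg.exist_eLpNorm_sub_le (by norm_num) (by norm_num) hδ
  have hd' : ContDiff ℝ ∞ (fun η => conj (h₀ (-η))) :=
    Complex.conjCLE.contDiff.comp (hd.comp contDiff_neg)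
  have hc' : HasCompactSupport (fun η => conj (h₀ (-η))) :=
    HasCompactSupport.comp_left (hc.comp_homeomorph (Homeomorph.neg ℝ)) (map_zero conj)
  obtain ⟨h, hh'⟩ := exists_schwartz_of_hasCompactSupport
    (f := fun η => (2⁻¹ : ℂ) * (h₀ η + conj (h₀ (-η))))
    (contDiff_const.mul (hd.add hd')) ((hc.add hc').mul_left)
  refine ⟨h, fun η => ?_, ?_⟩
  · rw [hh', hh', neg_neg, map_mul, map_add, Complex.conj_conj, add_comm]
    simp [Complex.conj_ofNat]
  · have m1 : AEStronglyMeasurable (g - h₀) volume := hg.1.sub hd.continuous.aestronglyMeasurable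
    have mp := Measure.measurePreserving_neg (volume : Measure ℝ)
    have m2 : AEStronglyMeasurable (fun η => (g - h₀) (-η)) volume :=
      m1.comp_measurePreserving mp
    have e : (fun η => h η - g η) =ᵐ[volume]
        (-2⁻¹ : ℂ) • ((g - h₀) + fun η => conj ((g - h₀) (-η))) := by
      filter_upwards [hh] with η hη
      simp only [hh', Pi.smul_apply, Pi.add_apply, Pi.sub_apply, smul_eq_mul, map_sub]
      rw [← hη]; ring
    rw [eLpNorm_congr_ae e, eLpNorm_const_smul]
    have l2 : eLpNorm (fun η => conj ((g - h₀) (-η))) 2 volume ≤ ENNReal.ofReal δ := by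
      rw [eLpNorm_congr_norm_ae (g := fun η => (g - h₀) (-η))
        (Eventually.of_forall fun η => RCLike.norm_conj _)]
      exact (eLpNorm_comp_measurePreserving m1 mp).trans_le hle
    have m3 : AEStronglyMeasurable (fun η => conj ((g - h₀) (-η))) volume :=
      Complex.continuous_conj.comp_aestronglyMeasurable m2
    calc _ ≤ ‖(-2⁻¹ : ℂ)‖ₑ * (ENNReal.ofReal δ + ENNReal.ofReal δ) := by
          gcongr
          exact (eLpNorm_add_le m1 m3 (by norm_num)).trans (add_le_add hle l2)
      _ = ENNReal.ofReal δ := by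
          rw [← ofReal_norm, ← ENNReal.ofReal_add hδ.le hδ.le, ← ENNReal.ofReal_mul (norm_nonneg _)]
          congr 1
          norm_num
          ring

/-- Real test functions are dense in the real part of `H^s`, `s < 0`. The distance is measured on
the Fourier side. -/
theorem exists_testFunction_close {s : ℝ} (hs : s < 0) {T : 𝓢'(ℝ, ℂ)} (hT : LineIsReal T)
    {g : Lp ℂ 2 (volume : Measure ℝ)}
    (hg : TemperedDistribution.smulLeftCLM ℂ (fun η : ℝ => (lineWeight s η : ℂ)) (𝓕 T)
      = (g : 𝓢'(ℝ, ℂ))) {δ : ℝ} (hδ : 0 < δ) :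
    ∃ (φ : ℝ → ℝ) (F : 𝓢(ℝ, ℂ)), ContDiff ℝ ∞ φ ∧ HasCompactSupport φ ∧ (∀ x, F x = φ x) ∧
      ‖sobolevLp s F - g‖ₑ ≤ ENNReal.ofReal δ := by
  -- `G` is real, rapidly decreasing and close to `T`; it remains to cut it off, which is done in `L²`
  obtain ⟨h, hh, hle⟩ := exists_hermitian_schwartz_close (Lp.memLp g)
    (hermitian_of_lineIsReal hT hg) (half_pos hδ)
  obtain ⟨G, hG⟩ : ∃ G : 𝓢(ℝ, ℂ), G = 𝓕⁻ (weightMul (-s) h) := ⟨_, rfl⟩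
  have hGF : 𝓕 G = weightMul (-s) h := by
    rw [hG]; exact FourierTransform.fourier_fourierInv_eq _
  have hGs : sobolevLp s G = h.toLp 2 := by rw [sobolevLp, hGF, weightMul_neg_weightMul]
  have hGr : ∀ x, G x = ((G x).re : ℂ) := fun x => by
    have h1 : G x = 𝓕 (weightMul (-s) h) (-x) := by
      rw [hG, SchwartzMap.fourierInv_coe, SchwartzMap.fourier_coe, Real.fourierInv_eq_fourier_neg]
    have h2 := fourier_eq_conj (K := weightMul (-s) h) (K' := weightMul (-s) h) (fun x => by
      rw [weightMul_apply, weightMul_apply, lineWeight_even, map_mul, Complex.conj_ofReal, ← hh]) (-x)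
    rw [← h1] at h2
    exact (Complex.conj_eq_iff_re.1 h2.symm).symm
  have hGm : MemLp (fun x => (G x).re) 2 (volume : Measure ℝ) := (G.memLp 2 volume).re
  obtain ⟨φ, hc, hd, hφ⟩ := hGm.exist_eLpNorm_sub_le (by norm_num) (by norm_num) (half_pos hδ)
  obtain ⟨F, hF⟩ := exists_schwartz_of_hasCompactSupport (f := fun x => (φ x : ℂ))
    (Complex.ofRealCLM.contDiff.comp hd) (hc.comp_left (g := fun r : ℝ => (r : ℂ)) rfl)
  refine ⟨φ, F, hd, hc, hF, ?_⟩
  have l1 : ‖sobolevLp s (F - G)‖ₑ ≤ ENNReal.ofReal (δ / 2) := by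
    refine (enorm_sobolevLp_le hs.le _).trans (le_trans (eLpNorm_mono fun x => ?_) hφ)
    rw [sub_apply, hF, hGr, ← Complex.ofReal_sub, Complex.norm_real, Pi.sub_apply,
      norm_sub_rev]
  have l2 : ‖h.toLp 2 volume - g‖ₑ ≤ ENNReal.ofReal (δ / 2) := by
    rw [Lp.enorm_def]
    refine (eLpNorm_congr_ae ?_).trans_le hle
    filter_upwards [Lp.coeFn_sub (h.toLp 2 volume) g, h.coeFn_toLp 2 volume] with η h1 h2
    rw [h1, Pi.sub_apply, h2]
  have e : sobolevLp s F - g = sobolevLp s (F - G) + (h.toLp 2 volume - g) := by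
    rw [sobolevLp_sub, hGs]; abel
  rw [e, show δ = δ / 2 + δ / 2 by ring, ENNReal.ofReal_add (by positivity) (by positivity)]
  exact (enorm_add_le _ _).trans (add_le_add l1 l2)

/-! ### Oscillating data are small in `H^s` of the line for `s < 0` -/

/-- Dominated convergence in `L²`. -/
lemma tendsto_eLpNorm_zero_of_dominated {ι : Type*} {l : Filter ι} [l.IsCountablyGenerated]
    {f : ι → ℝ → ℂ} {b : ℝ → ℝ} (hf : ∀ i, Continuous (f i)) (hb : MemLp b 2 volume)
    (hfb : ∀ᶠ i in l, ∀ x, ‖f i x‖ ≤ b x) (h : ∀ x, Tendsto (fun i => f i x) l (𝓝 0)) :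
    Tendsto (fun i => eLpNorm (f i) 2 volume) l (𝓝 0) := by
  have e : ∀ i, eLpNorm (f i) 2 volume = (∫⁻ x, ‖f i x‖ₑ ^ (2 : ℝ)) ^ (1 / 2 : ℝ) := fun i => by
    rw [eLpNorm_eq_lintegral_rpow_enorm_toReal (by norm_num) (by norm_num)]
    simp
  have h1 : Tendsto (fun i => ∫⁻ x, ‖f i x‖ₑ ^ (2 : ℝ)) l (𝓝 (∫⁻ _ : ℝ, 0)) := by
    refine tendsto_lintegral_filter_of_dominated_convergence (fun x => ‖b x‖ₑ ^ (2 : ℝ))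
      (Eventually.of_forall fun i => by have := hf i; fun_prop) ?_ ?_
      (Eventually.of_forall fun x => ?_)
    · filter_upwards [hfb] with i hi
      refine Eventually.of_forall fun x => ?_
      gcongr
      exact enorm_le_iff_norm_le.2 ((hi x).trans (le_abs_self _))
    · have := lintegral_rpow_enorm_lt_top_of_eLpNorm_lt_top (by norm_num) (by norm_num) hb.2
      simpa using this.ne
    · have h2 : Tendsto (fun i => ‖f i x‖ₑ) l (𝓝 0) := by
        rw [← enorm_zero (E := ℂ)]
        exact (continuous_enorm.tendsto _).comp (h x)
      have h3 := (ENNReal.continuous_rpow_const (y := 2)).tendsto (0 : ℝ≥0∞)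
      rw [ENNReal.zero_rpow_of_pos (by norm_num)] at h3
      exact h3.comp h2
  rw [lintegral_zero] at h1
  have h3 := (ENNReal.continuous_rpow_const (y := 1 / 2)).tendsto (0 : ℝ≥0∞)
  rw [ENNReal.zero_rpow_of_pos (by norm_num)] at h3
  simp only [e]
  exact h3.comp h1

lemma tendsto_lineWeight_atTop {s : ℝ} (hs : s < 0) {l : Filter ℝ} (hl : Tendsto (|·|) l atTop) :
    Tendsto (lineWeight s) l (𝓝 0) := by
  have h1 : Tendsto (fun η : ℝ => 1 + (2 * π * η) ^ 2) l atTop := by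
    refine tendsto_atTop_mono (fun η => ?_) hl
    have := Real.pi_gt_three
    rw [mul_pow, ← sq_abs η]
    nlinarith [sq_nonneg (|η| - 1), abs_nonneg η, sq_nonneg (π - 1), sq_nonneg (|η|)]
  have h2 := (tendsto_rpow_neg_atTop (y := -(s / 2)) (by linarith)).comp h1
  rw [neg_neg] at h2
  exact h2

/-- A Fourier transform translated to infinity is small in the negative order Sobolev norm. -/
lemma tendsto_eLpNorm_lineWeight_mul_translate {s : ℝ} (hs : s < 0) (G : 𝓢(ℝ, ℂ)) {a : ℕ → ℝ}
    (ha : Tendsto (fun n => |a n|) atTop atTop) :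
    Tendsto (fun n => eLpNorm (fun η => lineWeight s η * G (η + a n)) 2 volume) atTop (𝓝 0) := by
  have e : ∀ n, eLpNorm (fun η => lineWeight s η * G (η + a n)) 2 volume
      = eLpNorm (fun η => lineWeight s (η - a n) * G η) 2 volume := fun n => by
    have hm : AEStronglyMeasurable (fun η => (lineWeight s (η - a n) : ℂ) * G η) volume := by
      have h1 := continuous_lineWeight s
      have h2 := G.continuous
      exact Continuous.aestronglyMeasurable (by fun_prop)
    rw [← eLpNorm_comp_measurePreserving hm (measurePreserving_add_right volume (a n))]
    congr 1; funext η
    simp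
  simp only [e]
  refine tendsto_eLpNorm_zero_of_dominated (fun n => ?_) (G.memLp 2 volume).norm
    (Eventually.of_forall fun n η => ?_) fun η => ?_
  · have h1 := continuous_lineWeight s
    have h2 := G.continuous
    fun_prop
  · rw [norm_mul, Complex.norm_real, Real.norm_of_nonneg (lineWeight_pos _ _).le]
    exact mul_le_of_le_one_left (norm_nonneg _) (lineWeight_le_one hs.le _)
  · have h1 : Tendsto (fun n => |η - a n|) atTop atTop := by
      refine tendsto_atTop_mono (fun n => ?_) (tendsto_atTop_add_const_left _ (-|η|) ha)
      have := abs_sub_abs_le_abs_sub (a n) η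
      rw [abs_sub_comm] at this
      linarith
    have h2 := tendsto_lineWeight_atTop hs (l := Filter.map (fun n => η - a n) atTop)
      (tendsto_map'_iff.2 h1)
    have h3 : Tendsto (fun n => (lineWeight s (η - a n) : ℂ)) atTop (𝓝 ((0 : ℝ) : ℂ)) :=
      (Complex.continuous_ofReal.tendsto 0).comp (tendsto_map'_iff.1 h2)
    simpa using h3.mul_const (G η)

lemma fourier_mul_cos {G F : 𝓢(ℝ, ℂ)} {N : ℝ} (h : ∀ x, F x = G x * Real.cos (N * x)) (ξ : ℝ) :
    𝓕 F ξ = 2⁻¹ * 𝓕 G (ξ + -(N / (2 * π))) + 2⁻¹ * 𝓕 G (ξ + N / (2 * π)) := by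
  have hi : ∀ ζ : ℝ, Integrable (fun v : ℝ => Complex.exp (↑(-2 * π * v * ζ) * Complex.I) • G v) :=
    fun ζ => by
      have h1 := G.continuous
      refine G.integrable.mono (Continuous.aestronglyMeasurable (by fun_prop))
        (Eventually.of_forall fun v => ?_)
      rw [norm_smul, Complex.norm_exp_ofReal_mul_I, one_mul]
  rw [SchwartzMap.fourier_coe, SchwartzMap.fourier_coe, Real.fourier_real_eq_integral_exp_smul,
    Real.fourier_real_eq_integral_exp_smul, Real.fourier_real_eq_integral_exp_smul,
    ← integral_const_mul, ← integral_const_mul, ← integral_add ((hi _).const_mul _)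
      ((hi _).const_mul _)]
  congr 1; funext v
  rw [h, Complex.ofReal_cos, Complex.cos, smul_eq_mul, smul_eq_mul, smul_eq_mul]
  have e1 : Complex.exp (↑(-2 * π * v * (ξ + -(N / (2 * π)))) * Complex.I)
      = Complex.exp (↑(-2 * π * v * ξ) * Complex.I) * Complex.exp (↑(N * v) * Complex.I) := by
    rw [← Complex.exp_add, ← add_mul, ← Complex.ofReal_add]
    congr 3
    field_simp
    ring
  have e2 : Complex.exp (↑(-2 * π * v * (ξ + N / (2 * π))) * Complex.I)
      = Complex.exp (↑(-2 * π * v * ξ) * Complex.I) * Complex.exp (-↑(N * v) * Complex.I) := by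
    rw [← Complex.exp_add, ← add_mul, ← Complex.ofReal_neg, ← Complex.ofReal_add]
    congr 3
    field_simp
    ring
  rw [e1, e2]
  ring

/-- `g(x) cos(Nx) → 0` in `H^s`, `s < 0`, as `N → ∞`. -/
lemma tendsto_sobolevLp_mul_cos {s : ℝ} (hs : s < 0) {G : 𝓢(ℝ, ℂ)} {F : ℕ → 𝓢(ℝ, ℂ)}
    (h : ∀ (N : ℕ) x, F N x = G x * Real.cos (N * x)) :
    Tendsto (fun N => ‖sobolevLp s (F N)‖ₑ) atTop (𝓝 0) := by
  have h0 : Tendsto (fun N : ℕ => (N : ℝ) / (2 * π)) atTop atTop :=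
    tendsto_natCast_atTop_atTop.atTop_div_const (by positivity)
  have ha : Tendsto (fun N : ℕ => |(N : ℝ) / (2 * π)|) atTop atTop :=
    tendsto_abs_atTop_atTop.comp h0
  have hb : Tendsto (fun N : ℕ => |-((N : ℝ) / (2 * π))|) atTop atTop := by
    simpa only [abs_neg] using ha
  have t1 := tendsto_eLpNorm_lineWeight_mul_translate hs (𝓕 G) hb
  have t2 := tendsto_eLpNorm_lineWeight_mul_translate hs (𝓕 G) ha
  have t3 := (t1.add t2)
  rw [add_zero] at t3
  refine tendsto_of_tendsto_of_tendsto_of_le_of_le tendsto_const_nhds t3 (fun _ => bot_le)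
    fun N => ?_
  have hc : ∀ c : ℝ, AEStronglyMeasurable
      (fun η => (lineWeight s η : ℂ) * (𝓕 G : 𝓢(ℝ, ℂ)) (η + c)) volume := fun c => by
    have h1 := continuous_lineWeight s
    have h2 := (𝓕 G : 𝓢(ℝ, ℂ)).continuous
    exact Continuous.aestronglyMeasurable (by fun_prop)
  have e : (fun η => (lineWeight s η : ℂ) * (𝓕 (F N) : 𝓢(ℝ, ℂ)) η)
      = (2⁻¹ : ℂ) • ((fun η => (lineWeight s η : ℂ) * (𝓕 G : 𝓢(ℝ, ℂ)) (η + -((N : ℝ) / (2 * π))))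
        + fun η => (lineWeight s η : ℂ) * (𝓕 G : 𝓢(ℝ, ℂ)) (η + (N : ℝ) / (2 * π))) := by
    funext η
    rw [fourier_mul_cos (h N)]
    simp only [Pi.smul_apply, Pi.add_apply, smul_eq_mul]
    ring
  rw [enorm_sobolevLp, e, eLpNorm_const_smul]
  refine le_trans (mul_le_of_le_one_left bot_le ?_) (eLpNorm_add_le (hc _) (hc _) (by norm_num))
  rw [← ofReal_norm, ENNReal.ofReal_le_one]
  norm_num

/-! ### Continuity in time of the Sobolev norms on the line -/

/-- A smooth function all of whose derivatives are `O(e^{-|x|/2})`, as a Schwartz function. -/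
lemma exists_schwartz_of_exp_decay {f : ℝ → ℝ} (hf : ContDiff ℝ ∞ f)
    (hb : ∀ k, ∃ C, 0 ≤ C ∧ ∀ x, |iteratedDeriv k f x| ≤ C * Real.exp (-|x| / 2)) :
    ∃ F : 𝓢(ℝ, ℂ), ∀ x, F x = f x := by
  refine ⟨{ toFun := fun x => (f x : ℂ)
            smooth' := Complex.ofRealCLM.contDiff.comp hf
            decay' := fun k n => ?_ }, fun x => rfl⟩
  obtain ⟨C, hC, h⟩ := hb n
  refine ⟨C * (2 ^ k * k.factorial), fun x => ?_⟩
  have e : ‖iteratedFDeriv ℝ n (fun x => (f x : ℂ)) x‖ = |iteratedDeriv n f x| := by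
    rw [← Real.norm_eq_abs, ← norm_iteratedFDeriv_eq_norm_iteratedDeriv]
    exact Complex.ofRealLI.norm_iteratedFDeriv_comp_left hf.contDiffAt (by exact_mod_cast le_top)
  rw [e, Real.norm_eq_abs]
  have h1 : (|x| / 2) ^ k / k.factorial ≤ Real.exp (|x| / 2) :=
    Real.pow_div_factorial_le_exp _ (by positivity) k
  have h2 : |x| ^ k ≤ 2 ^ k * k.factorial * Real.exp (|x| / 2) := by
    rw [div_le_iff₀ (by positivity), div_pow, div_le_iff₀ (by positivity)] at h1
    linarith
  calc |x| ^ k * |iteratedDeriv n f x|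
      ≤ (2 ^ k * k.factorial * Real.exp (|x| / 2)) * (C * Real.exp (-|x| / 2)) := by
        gcongr
        exact h x
    _ = C * (2 ^ k * k.factorial) * Real.exp (|x| / 2 + -|x| / 2) := by rw [Real.exp_add]; ring
    _ = _ := by rw [show |x| / 2 + -|x| / 2 = 0 by ring, Real.exp_zero, mul_one]

/-- `(1 - ∂ₓ²)` maps `H^{σ+2}` isometrically to `H^σ`. -/
lemma sobolevLp_add_two (σ : ℝ) (F : 𝓢(ℝ, ℂ)) : sobolevLp (σ + 2) F
    = sobolevLp σ (F - SchwartzMap.derivCLM ℂ ℂ (SchwartzMap.derivCLM ℂ ℂ F)) := by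
  have hd : ∀ (H : 𝓢(ℝ, ℂ)) (η : ℝ),
      𝓕 (SchwartzMap.derivCLM ℂ ℂ H) η = 2 * π * Complex.I * η * 𝓕 H η := fun H η => by
    have e : (SchwartzMap.derivCLM ℂ ℂ H : ℝ → ℂ) = deriv H := rfl
    rw [SchwartzMap.fourier_coe, SchwartzMap.fourier_coe, e, Real.fourier_deriv H.integrable
      H.differentiable (e ▸ (SchwartzMap.derivCLM ℂ ℂ H).integrable)]
    rfl
  rw [sobolevLp, sobolevLp]
  congr 1
  ext η
  have e : ∀ H : 𝓢(ℝ, ℂ), 𝓕 (F - H) = 𝓕 F - 𝓕 H := fun H =>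
    map_sub (FourierTransform.fourierCLM ℂ 𝓢(ℝ, ℂ)) F H
  rw [weightMul_apply, weightMul_apply, e, sub_apply, hd, hd,
    lineWeight_add]
  have : lineWeight 2 η = 1 + (2 * π * η) ^ 2 := by simp [lineWeight]
  rw [this]
  push_cast
  linear_combination (lineWeight σ η : ℂ) * (2 * π * η) ^ 2 * 𝓕 F η * Complex.I_sq

lemma Reg.deriv_space {ρ : ℝ → ℝ} {g : ℝ → ℝ → ℝ} (hg : ∀ n, Reg ρ n g) (n : ℕ) :
    Reg ρ n (fun t => deriv (g t)) := by
  obtain ⟨gx, h1, h2⟩ := (hg (n + 1)).exists_hasDerivAt_space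
  have e : (fun t => deriv (g t)) = gx := by
    funext t x
    exact (h1 t x).deriv
  rwa [e]

lemma Reg.exists_iteratedDeriv_bound {ρ : ℝ → ℝ} {g : ℝ → ℝ → ℝ} (hg : ∀ n, Reg ρ n g) (t : ℝ)
    (k : ℕ) : ∃ C, 0 ≤ C ∧ ∀ x, |iteratedDeriv k (g t) x| ≤ C * ρ x := by
  induction k generalizing g with
  | zero =>
    obtain ⟨C, hC, h⟩ := (hg 0).wBdd.bdd |t|
    exact ⟨C, hC, fun x => by simpa using h t x le_rfl⟩
  | succ k ih =>
    simp only [iteratedDeriv_succ']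
    exact ih (Reg.deriv_space hg)

lemma Reg.contDiff_space {ρ : ℝ → ℝ} {g : ℝ → ℝ → ℝ} (hg : ∀ n, Reg ρ n g) (t : ℝ) :
    ContDiff ℝ ∞ (g t) :=
  contDiff_infty.2 fun n => (hg n).contDiff.comp (contDiff_const.prodMk contDiff_id)

lemma Reg.exists_schwartz {g : ℝ → ℝ → ℝ} (hg : ∀ n, Reg (fun x => Real.exp (-|x| / 2)) n g) :
    ∃ F : ℝ → 𝓢(ℝ, ℂ), ∀ t x, F t x = g t x := by
  choose F hF using fun t => exists_schwartz_of_exp_decay (Reg.contDiff_space hg t)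
    (Reg.exists_iteratedDeriv_bound hg t)
  exact ⟨F, hF⟩

/-- Exponentially decaying smooth functions of `(t, x)` are continuous in time with values in every
Sobolev space. The order is lowered by `2` at a time by passing to `(1 - ∂ₓ²) g`. -/
lemma Reg.tendsto_sobolevLp {g : ℝ → ℝ → ℝ} (hg : ∀ n, Reg (fun x => Real.exp (-|x| / 2)) n g)
    {F : ℝ → 𝓢(ℝ, ℂ)} (hF : ∀ t x, F t x = g t x) (t : ℝ) (m : ℕ) {σ : ℝ} (hσ : σ ≤ 2 * m) :
    Tendsto (fun τ => ‖sobolevLp σ (F τ - F t)‖ₑ) (𝓝 t) (𝓝 0) := by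
  induction m generalizing σ g F with
  | zero =>
    have hσ0 : σ ≤ 0 := by simpa using hσ
    obtain ⟨C, hC, hb⟩ := (hg 0).wBdd.bdd (|t| + 1)
    have hw : MemLp (fun x => C * Real.exp (-|x| / 2) + C * Real.exp (-|x| / 2)) 2
        (volume : Measure ℝ) := by
      have h1 : MemLp (fun x : ℝ => Real.exp (-|x| / 2)) 2 (volume : Measure ℝ) := by
        refine (memLp_two_iff_integrable_sq (Continuous.aestronglyMeasurable (by fun_prop))).2 ?_
        refine integrable_exp_neg_abs_half.mono (Continuous.aestronglyMeasurable (by fun_prop))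
          (Eventually.of_forall fun x => ?_)
        rw [Real.norm_of_nonneg (by positivity), Real.norm_of_nonneg (by positivity)]
        exact pow_le_of_le_one (Real.exp_pos _).le (isWeight_exp.le_one x) two_ne_zero
      exact (h1.const_mul C).add (h1.const_mul C)
    have h0 : Tendsto (fun τ => eLpNorm (F τ - F t : 𝓢(ℝ, ℂ)) 2 volume) (𝓝 t) (𝓝 0) := by
      refine tendsto_eLpNorm_zero_of_dominated (fun τ => (F τ - F t).continuous) hw ?_ fun x => ?_
      · have hs : {τ : ℝ | |τ| < |t| + 1} ∈ 𝓝 t :=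
          (isOpen_lt continuous_abs continuous_const).mem_nhds (by simp)
        filter_upwards [hs] with τ hτ x
        rw [sub_apply]
        refine (norm_sub_le _ _).trans (add_le_add ?_ ?_)
        · rw [hF, Complex.norm_real]
          exact hb τ x (le_of_lt hτ)
        · rw [hF, Complex.norm_real]
          exact hb t x (by linarith)
      · have h1 := (((hg 0).wBdd.cont_time x).tendsto t).sub_const (g t x)
        have h2 := (Complex.continuous_ofReal.tendsto _).comp h1
        rw [sub_self, Complex.ofReal_zero] at h2
        refine h2.congr fun τ => ?_
        rw [sub_apply, hF, hF, ← Complex.ofReal_sub]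
        rfl
    exact tendsto_of_tendsto_of_tendsto_of_le_of_le tendsto_const_nhds h0 (fun _ => bot_le)
      fun τ => enorm_sobolevLp_le hσ0 _
  | succ m ih =>
    have hx := Reg.deriv_space hg
    have hxx := Reg.deriv_space hx
    have hd : ∀ {g : ℝ → ℝ → ℝ} {F : ℝ → 𝓢(ℝ, ℂ)},
        (∀ n, Reg (fun x => Real.exp (-|x| / 2)) n g) → (∀ t x, F t x = g t x) →
        ∀ t x, SchwartzMap.derivCLM ℂ ℂ (F t) x = deriv (g t) x := by
      intro g F hg hF t x
      have e : (F t : ℝ → ℂ) = fun x => (g t x : ℂ) := funext (hF t)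
      rw [SchwartzMap.derivCLM_apply, e]
      exact (((Reg.contDiff_space hg t).differentiable (by simp) x).hasDerivAt.ofReal_comp).deriv
    have key := ih (g := fun t x => g t x - deriv (deriv (g t)) x)
      (F := fun t => F t - SchwartzMap.derivCLM ℂ ℂ (SchwartzMap.derivCLM ℂ ℂ (F t)))
      (fun n => (hg n).sub (hxx n)) (fun t x => by
        rw [sub_apply, hd (F := fun t => SchwartzMap.derivCLM ℂ ℂ (F t)) hx (hd hg hF), hF,
          Complex.ofReal_sub])
      (σ := σ - 2) (by push_cast at hσ; linarith)
    refine key.congr fun τ => ?_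
    have e := sobolevLp_add_two (σ - 2) (F τ - F t)
    rw [sub_add_cancel] at e
    rw [e]
    congr 2
    simp only [map_sub]
    abel

/-- A mild solution on the line with rapidly decaying data is a smooth solution, and a Schwartz
function at all times. -/
lemma IsMild.isSmoothSolutionLine {u₀ : ℝ → ℝ} {u : ℝ → ℝ → ℝ}
    (hu : IsMild (fun x => Real.exp (-|x| / 2)) u₀ u) (h₀ : ContDiff ℝ ∞ u₀)
    (hb : ∀ k, ∃ C, 0 ≤ C ∧ ∀ x, |iteratedDeriv k u₀ x| ≤ C * Real.exp (-|x| / 2)) :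
    IsSmoothSolutionLine u ∧ ∃ F : ℝ → 𝓢(ℝ, ℂ), ∀ t x, F t x = u t x := by
  have hreg := hu.reg isWeight_exp h₀ hb
  obtain ⟨F, hF⟩ := Reg.exists_schwartz hreg
  have hl := fun t => lineDist_eq (hF t)
  refine ⟨⟨hu.isSmoothSolution isWeight_exp h₀ hb, fun t _ => (hl t).1, fun σ t _ => ?_,
    fun σ t _ => ?_⟩, F, hF⟩
  · rw [(hl t).2]
    exact (F t).memSobolev
  · obtain ⟨m, hm⟩ := exists_nat_ge (σ / 2)
    refine tendsto_of_tendsto_of_tendsto_of_le_of_le tendsto_const_nhds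
      ((Reg.tendsto_sobolevLp hreg hF t m (σ := σ) (by linarith)).mono_left nhdsWithin_le_nhds)
      (fun _ => bot_le) fun τ => ?_
    have e : lineDist (u τ) - lineDist (u t) = ((F τ - F t : 𝓢(ℝ, ℂ)) : 𝓢'(ℝ, ℂ)) := by
      rw [(hl τ).2, (hl t).2, map_sub]
    simp only [e]
    exact lineSobolevNorm_coe_le σ _

/-! ### Norm inflation on the line -/

lemma exists_iteratedDeriv_bound_of_hasCompactSupport {f : ℝ → ℝ} (hf : ContDiff ℝ ∞ f)
    (hc : HasCompactSupport f) (k : ℕ) :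
    ∃ C, 0 ≤ C ∧ ∀ x, |iteratedDeriv k f x| ≤ C * Real.exp (-|x| / 2) := by
  have h1 : HasCompactSupport (iteratedDeriv k f) := by
    induction k with
    | zero => simpa using hc
    | succ k ih => rw [iteratedDeriv_succ]; exact ih.deriv
  have h2 : Continuous (iteratedDeriv k f) := hf.continuous_iteratedDeriv k (by exact_mod_cast le_top)
  obtain ⟨C, hC⟩ := (h1.mul_right (f' := fun x => Real.exp (|x| / 2))).exists_bound_of_continuous
    (by fun_prop)
  refine ⟨max C 0, le_max_right _ _, fun x => ?_⟩
  have h3 := hC x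
  rw [Pi.mul_apply, norm_mul, Real.norm_eq_abs, Real.norm_of_nonneg (Real.exp_pos _).le] at h3
  have h4 : Real.exp (|x| / 2) * Real.exp (-|x| / 2) = 1 := by
    rw [← Real.exp_add, show |x| / 2 + -|x| / 2 = 0 by ring, Real.exp_zero]
  calc |iteratedDeriv k f x| = |iteratedDeriv k f x| * Real.exp (|x| / 2) * Real.exp (-|x| / 2) := by
        rw [mul_assoc, h4, mul_one]
    _ ≤ _ := by
        gcongr
        exact h3.trans (le_max_left _ _)

/-- An amplitude `g` and a test function `θ`, both compactly supported, with `θ' = 1` where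
`g ≠ 0`. -/
lemma exists_amplitude_and_testFunction : ∃ g θ : ℝ → ℝ, ContDiff ℝ ∞ g ∧ HasCompactSupport g ∧
    ContDiff ℝ ∞ θ ∧ (∀ x, 3 ≤ |x| → θ x = 0) ∧
    0 < ∫ x in (-4 : ℝ)..4, g x ^ 2 * deriv θ x := by
  let g : ContDiffBump (0 : ℝ) := ⟨1 / 2, 1, by norm_num, by norm_num⟩
  let χ : ContDiffBump (0 : ℝ) := ⟨2, 3, by norm_num, by norm_num⟩
  have hθ : ContDiff ℝ ∞ (fun x => x * χ x) := contDiff_id.mul χ.contDiff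
  refine ⟨g, fun x => x * χ x, g.contDiff, g.hasCompactSupport, hθ, fun x hx => ?_, ?_⟩
  · simp only
    rw [χ.zero_of_le_dist (by simpa [Real.dist_eq] using hx), mul_zero]
  · have e : ∀ x, g x ^ 2 * deriv (fun x => x * χ x) x = g x ^ 2 := fun x => by
      rcases lt_or_ge |x| 2 with h | h
      · have hn : (fun x => x * χ x) =ᶠ[𝓝 x] fun x => x := by
          filter_upwards [(isOpen_lt continuous_abs continuous_const).mem_nhds h] with y hy
          rw [χ.one_of_mem_closedBall (by simpa [Real.dist_eq] using le_of_lt hy), mul_one]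
        rw [hn.deriv_eq, deriv_id'', mul_one]
      · rw [g.zero_of_le_dist (by
          change (1 : ℝ) ≤ dist x 0
          rw [Real.dist_eq, sub_zero]; linarith)]
        ring
    simp only [e]
    refine intervalIntegral.integral_pos (by norm_num) (g.continuous.pow 2).continuousOn
      (fun x _ => by positivity) ⟨0, by norm_num, ?_⟩
    have : g 0 = 1 := g.one_of_mem_closedBall (by simp; exact g.rIn_pos.le)
    rw [this]; norm_num

/-- Norm inflation on the line, measured through the pairing with the test function `θ - θ''`. -/
theorem line_inflation {s : ℝ} (hs : s < 0) {T : 𝓢'(ℝ, ℂ)} (hT : LineIsReal T)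
    (hm : TemperedDistribution.MemSobolev s 2 T) {ε : ℝ} (hε : 0 < ε) :
    ∃ (u : ℝ → ℝ → ℝ) (t : ℝ), IsSmoothSolutionLine u ∧ 0 < t ∧ t < ε ∧
      lineSobolevNorm s (lineDist (u 0) - T) < ENNReal.ofReal ε ∧
      ENNReal.ofReal ε⁻¹ < lineSobolevNorm s (lineDist (u t)) ∧
      lineSobolevNorm s (lineDist (u t)) < ⊤ := by
  obtain ⟨k, hk⟩ : ∃ k : Lp ℂ 2 (volume : Measure ℝ),
      TemperedDistribution.smulLeftCLM ℂ (fun η : ℝ => (lineWeight s η : ℂ)) (𝓕 T)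
        = (k : 𝓢'(ℝ, ℂ)) := by
    have := (lineSobolevNorm_lt_top_iff s T).2 hm
    simp only [lineSobolevNorm, iInf_lt_iff] at this
    obtain ⟨k, hk, -⟩ := this
    exact ⟨k, hk⟩
  obtain ⟨φ, Φ, hφ, hφc, hΦ, hΦk⟩ := exists_testFunction_close hs hT hk (half_pos hε)
  obtain ⟨g, θ, hg, hgc, hθ, hθ0, hpos⟩ := exists_amplitude_and_testFunction
  have hθ' : ContDiff ℝ ∞ (deriv θ) := by apply ContDiff.iterate_deriv 1 hθ
  have hθ'' : ContDiff ℝ ∞ (deriv (deriv θ)) := by apply ContDiff.iterate_deriv 1 hθ'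
  have hd1 : ∀ x, HasDerivAt θ (deriv θ x) x := fun x =>
    (hθ.differentiable (by simp) x).hasDerivAt
  have hd2 : ∀ x, HasDerivAt (deriv θ) (deriv (deriv θ) x) x := fun x =>
    (hθ'.differentiable (by simp) x).hasDerivAt
  have hz : ∀ x : ℝ, 3 < |x| → θ x = 0 ∧ deriv θ x = 0 ∧ deriv (deriv θ) x = 0 := fun x hx => by
    have h1 : θ =ᶠ[𝓝 x] fun _ => 0 := by
      filter_upwards [(isOpen_lt continuous_const continuous_abs).mem_nhds hx] with y hy
      exact hθ0 y (le_of_lt hy)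
    exact ⟨hθ0 x hx.le, by simpa using h1.deriv.eq_of_nhds, by simpa using h1.deriv.deriv.eq_of_nhds⟩
  -- the test function against which the solution is measured
  have hψd : ContDiff ℝ ∞ (fun x => ((θ x - deriv (deriv θ) x : ℝ) : ℂ)) :=
    Complex.ofRealCLM.contDiff.comp (hθ.sub hθ'')
  have hψc : HasCompactSupport (fun x => ((θ x - deriv (deriv θ) x : ℝ) : ℂ)) := by
    refine HasCompactSupport.intro (isCompact_closedBall (0 : ℝ) 3) fun x hx => ?_
    obtain ⟨h1, -, h3⟩ := hz x (by simpa [Real.dist_eq] using hx)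
    simp [h1, h3]
  obtain ⟨ψ, hψ⟩ := exists_schwartz_of_hasCompactSupport hψd hψc
  obtain ⟨D, hD0, hD⟩ := exists_enorm_apply_le s ψ
  have hcos : ∀ N : ℕ, ContDiff ℝ ∞ (fun x : ℝ => Real.cos (N * x)) := fun N =>
    Real.contDiff_cos.comp (contDiff_const.mul contDiff_id)
  have hdata : ∀ B N, ContDiff ℝ ∞ (inflData φ g B N) := fun B N =>
    hφ.add (contDiff_const.mul (hg.mul (hcos N)))
  have hdatac : ∀ B N, HasCompactSupport (inflData φ g B N) := fun B N =>
    hφc.add ((hgc.mul_right).mul_left)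
  have hdatab := fun B N => exists_iteratedDeriv_bound_of_hasCompactSupport (hdata B N) (hdatac B N)
  have hparts : ∀ B N, ∫ x in (-4 : ℝ)..4,
      bbmOp (fun y => inflData φ g B N y + inflData φ g B N y ^ 2 / 2) x
        * (θ x - deriv (deriv θ) x)
      = ∫ x in (-4 : ℝ)..4, (inflData φ g B N x + inflData φ g B N x ^ 2 / 2)
        * deriv θ x := fun B N => by
    obtain ⟨C, hC⟩ := (hdatac B N).exists_bound_of_continuous (hdata B N).continuous
    have hc := (hdata B N).continuous
    refine integral_bbmOp_mul (C := C + C ^ 2 / 2) (by fun_prop) (fun x => ?_) hd1 hd2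
      hθ''.continuous ?_
    · refine (abs_add_le _ _).trans (add_le_add (hC x) ?_)
      rw [abs_of_nonneg (by positivity), ← sq_abs]
      have := hC x
      rw [Real.norm_eq_abs] at this
      gcongr
    · obtain ⟨h1, h2, -⟩ := hz 4 (by norm_num [abs_of_pos])
      obtain ⟨h3, h4, -⟩ := hz (-4) (by norm_num [abs_of_pos])
      simp [h1, h2, h3, h4]
  obtain ⟨Cφ, hCφ⟩ := hφc.exists_bound_of_continuous hφ.continuous
  obtain ⟨Cg, hCg⟩ := hgc.exists_bound_of_continuous hg.continuous
  obtain ⟨B, t, ht0, htε, hev⟩ := exists_large_pairing hφ.continuous hg.continuous hCφ hCg hd1 hd2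
    hθ''.continuous (a := -4) (b := 4) (by norm_num) hpos hparts (R := ε⁻¹ * D) hε
  obtain ⟨G, hG⟩ := exists_schwartz_of_hasCompactSupport (f := fun x => (g x : ℂ))
    (Complex.ofRealCLM.contDiff.comp hg) (hgc.comp_left (g := fun r : ℝ => (r : ℂ)) rfl)
  choose F hF using fun N : ℕ => exists_schwartz_of_hasCompactSupport
    (f := fun x => ((g x * Real.cos (N * x) : ℝ) : ℂ))
    (Complex.ofRealCLM.contDiff.comp (hg.mul (hcos N)))
    (hgc.mul_right.comp_left (g := fun r : ℝ => (r : ℂ)) rfl)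
  have hsmall : ∀ᶠ N in atTop, ‖sobolevLp s (((B ^ 2 : ℝ) : ℂ) • F N)‖ₑ < ENNReal.ofReal (ε / 2) := by
    have h1 := tendsto_sobolevLp_mul_cos hs (G := ((B ^ 2 : ℝ) : ℂ) • G)
      (F := fun N => ((B ^ 2 : ℝ) : ℂ) • F N) fun N x => by
        rw [smul_apply, smul_apply, hF, hG]
        simp only [smul_eq_mul]
        push_cast
        ring
    exact h1.eventually (gt_mem_nhds (ENNReal.ofReal_pos.2 (by positivity)))
  obtain ⟨N, hN1, hN2⟩ := (hev.and hsmall).exists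
  obtain ⟨C0, hC00, hC0⟩ := hdatab B N 0
  obtain ⟨C1, hC10, hC1⟩ := hdatab B N 1
  simp only [iteratedDeriv_zero, iteratedDeriv_one] at hC0 hC1
  obtain ⟨u, hu⟩ := exists_isMild_line (C := C0 + C1) ((hdata B N).of_le (by simp))
    (fun x => (hC0 x).trans (by gcongr; linarith)) (fun x => (hC1 x).trans (by gcongr; linarith))
  obtain ⟨hsol, U, hU⟩ := hu.isSmoothSolutionLine (hdata B N) (hdatab B N)
  have hUt := (lineDist_eq (hU t)).2
  refine ⟨u, t, hsol, ht0, htε, ?_, ?_, ?_⟩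
  · have e : lineDist (u 0) = ((Φ + ((B ^ 2 : ℝ) : ℂ) • F N : 𝓢(ℝ, ℂ)) : 𝓢'(ℝ, ℂ)) :=
      (lineDist_eq fun x => by
        rw [add_apply, smul_apply, hΦ, hF, hu.zero, inflData, smul_eq_mul]
        push_cast
        ring).2
    rw [e]
    refine (lineSobolevNorm_coe_sub_le hk _).trans_lt ?_
    rw [sobolevLp_add, add_sub_right_comm, show ε = ε / 2 + ε / 2 by ring,
      ENNReal.ofReal_add (by positivity) (by positivity)]
    exact (enorm_add_le _ _).trans_lt (ENNReal.add_lt_add_of_le_of_lt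
      (ne_top_of_le_ne_top ENNReal.ofReal_ne_top hΦk) hΦk hN2)
  · have h1 := hN1 _ u isWeight_exp hu
    have h2 : lineDist (u t) ψ = ((∫ x in (-4 : ℝ)..4, u t x * (θ x - deriv (deriv θ) x) : ℝ) : ℂ) := by
      rw [hUt, SchwartzMap.coe_apply, ← intervalIntegral.integral_ofReal,
        intervalIntegral.integral_of_le (by norm_num), ← integral_Icc_eq_integral_Ioc,
        setIntegral_eq_integral_of_forall_compl_eq_zero]
      · congr 1; funext x
        rw [hψ, hU, smul_eq_mul]
        push_cast
        ring
      · intro x hx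
        obtain ⟨h3, -, h4⟩ := hz x (by
          by_contra! h
          exact hx ⟨by linarith [neg_abs_le x], by linarith [le_abs_self x]⟩)
        simp [h3, h4]
    have h3 := hD (lineDist (u t))
    have h4 : ENNReal.ofReal ε⁻¹ * ENNReal.ofReal D < ‖lineDist (u t) ψ‖ₑ := by
      rw [← ENNReal.ofReal_mul (by positivity), h2, ← ofReal_norm, Complex.norm_real]
      have h5 : 0 < ε⁻¹ * D := by positivity
      exact (ENNReal.ofReal_lt_ofReal_iff (by
        rw [Real.norm_eq_abs]; exact h5.trans (h1.trans_le (le_abs_self _)))).2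
        (h1.trans_le (le_abs_self _))
    exact lt_of_mul_lt_mul_right' (h4.trans_le h3)
  · rw [hUt]
    exact lineSobolevNorm_coe_lt_top s _

end BBM

end

theorem theorem1p3 (s : ℝ) (hs : s < 0) :
    (∀ u₀ : 𝓢'(ℝ, ℂ), BBM.LineIsReal u₀ → TemperedDistribution.MemSobolev s 2 u₀ →
      ∀ ε : ℝ, 0 < ε → ∃ (u : ℝ → ℝ → ℝ) (t : ℝ),
        BBM.IsSmoothSolutionLine u ∧ 0 < t ∧ t < ε ∧
        BBM.lineSobolevNorm s (BBM.lineDist (u 0) - u₀) < ENNReal.ofReal ε ∧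
        ENNReal.ofReal ε⁻¹ < BBM.lineSobolevNorm s (BBM.lineDist (u t)) ∧
        BBM.lineSobolevNorm s (BBM.lineDist (u t)) < ⊤) ∧
    (∀ u₀ : BBM.TorusDistribution, BBM.TorusIsReal u₀ → BBM.TorusMemSobolev s u₀ →
      ∀ ε : ℝ, 0 < ε → ∃ (u : ℝ → ℝ → ℝ) (t : ℝ),
        BBM.IsSmoothSolutionTorus u ∧ 0 < t ∧ t < ε ∧
        BBM.torusSobolevNorm s (BBM.torusDist (u 0) - u₀) < ENNReal.ofReal ε ∧
        ENNReal.ofReal ε⁻¹ < BBM.torusSobolevNorm s (BBM.torusDist (u t)) ∧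
        BBM.torusSobolevNorm s (BBM.torusDist (u t)) < ⊤) := by
  exact ⟨fun u₀ h₁ h₂ ε hε => BBM.line_inflation hs h₁ h₂ hε,
    fun u₀ h₁ h₂ ε hε => BBM.torus_inflation hs h₁ h₂ hε⟩
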